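/- **Ordinals.** Write $[p]=\{0,\dots,p\}$ for $p\ge 0$, $[-1]=\emptyset$, and $[p]^\wedge=[p+1]$. For a monotone map $g\colon[p]\to[q]$ let $g+[0]\colon[p+1]\to[q+1]$ be its extension sending $p+1$ to $q+1$, and let $g^\wedge\colon[q+1]\to[p+1]$, $g^\wedge(j)=\min\{i : j\le (g+[0])(i)\}$, be the left adjoint of $g+[0]$. **The categories $i\Delta_+$ and $i\Delta$.** The objects of $i\Delta_+$ are defined inductively: there is the trivial object $[-1]$; a non-trivial object $H$ is an ordinal $[p]$ with $p\ge 0$ together with, for each $j\in[p]^\wedge$, a previously constructed object $H(j)$, which is trivial if and only if $j$ is an end point ($0$ or $p+1$) of $[p]^\wedge$. There is a unique morphism from the trivial object to every object and no morphism from a non-trivial object to the trivial one. A morphism $g\colon H\to K$ of non-trivial objects, with underlying ordinals $[p]$ and $[q]$, is a monotone map $g\colon[p]\to[q]$ together with a morphism $g(j)\colon H(g^\wedge j)\to K(j)$ for every $j\in[q]^\wedge$. Composition is given by composition of monotone maps and $(g'\circ g)(j)=g'(j)\circ g(g'^\wedge j)$. The category $i\Delta$ is the full subcategory of $i\Delta_+$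 on the non-trivial objects. **$\Theta_+$, $\Theta$ and $\mathcal S$.** Let $\omega\mathbf{Cat}$ be the category of (small) strict $\omega$-categories and $\omega$-functors, and for a globular set ($\omega$-graph) $G$ let $[G]$ be the free strict $\omega$-category on $G$. A globular cardinal is a globular set with finitely many vertices for which the reflexive transitive relation generated by $s(y)\prec y$ and $x\prec t(x)$ on its vertices is a linear order. $\Theta_+$ (respectively $\Theta$) is the full subcategory of $\omega\mathbf{Cat}$ on the $\omega$-categories that are free on a possibly empty (respectively non-empty) globular cardinal. A cell $a$ of $[G]$ is maximal if it is not an identity cell and every monomorphism $m\colon H\to G$ such that $a$ is in the image of $[m]\colon[H]\to[G]$ is an isomorphism. $\mathcal S$ is the full subcategory of $\omega\mathbf{Cat}$ on the simple $\omega$-categories, those free on an $\omega$-graph $G$ for which $[G]$ has a unique maximal cell. **The functor $\Psi=\mathfrak F\circ\Upsilon\colon i\Delta_+\to\omega\mathbf{Cat}$.** For an object $H$ of $i\Delta_+$ the ordinal graph $\Upsilon H$ is empty if $H$ is trivial; otherwise its vertices are the elements of the underlying ordinal $[p]$ of $H$, its edge-object from $i-1$ to $i$ is $\Upsilon H(i)$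 for $1\le i\le p$, and its other edge-objects are empty. The free $\omega$-category $\mathfrak F\mathcal G$ on an ordinal graph $\mathcal G$ with vertices $0<\dots<p$ has these as objects, hom-objects $(\mathfrak F\mathcal G)(i,j)=\prod_{k=i+1}^{j}\mathfrak F(\mathcal G(k-1,k))$ for $i\le j$ (terminal if $i=j$) and $(\mathfrak F\mathcal G)(i,j)=\emptyset$ for $i>j$, and $0$-composition given by concatenation; $\mathfrak F\emptyset=\emptyset$. Thus $\Psi$ sends the trivial object to the empty $\omega$-category and, for non-trivial $H$, $(\Psi H)(i-1,i)=\Psi H(i)$. For $g\colon H\to K$ between non-trivial objects, $\Psi g$ is $g$ on objects, its component $\Psi H(i)\to\prod_{j=g(i-1)+1}^{g(i)}\Psi K(j)$ on the hom-object from $i-1$ to $i$ has components $\Psi(g(j))$ (for these $j$ one has $g^\wedge(j)=i$), and on the other hom-objects it is the product of these. **Theorem.** The functor $\Psi$ takes values in $\Theta_+$ and is an equivalence of categories $i\Delta_+\to\Theta_+$. Moreover $\Psi$ restricts to an equivalence $i\Delta\to\Theta$ and to an equivalence $i\Delta\to\mathcal S$. -/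

import Mathlib

open CategoryTheory

namespace OmegaTheta

/-! ### Ordinals and the left adjoint `g ↦ g^∧`

The ordinal `[p] = {0, …, p}` is `Fin (p + 1)`, so that `[p]^∧ = [p + 1]` is `Fin (p + 2)`. -/

/-- The map `g + [0] : [p + 1] → [q + 1]`, which extends `g : [p] → [q]` by sending the new greatest
element to the new greatest element. -/
def addTop {p q : ℕ} (g : Fin (p + 1) →o Fin (q + 1)) : Fin (p + 2) → Fin (q + 2) :=
  Fin.lastCases (Fin.last (q + 1)) (fun i => (g i).castSucc)

theorem wedge_nonempty {p q : ℕ} (g : Fin (p + 1) →o Fin (q + 1)) (j : Fin (q + 2)) :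
    (Finset.univ.filter fun i : Fin (p + 2) => j ≤ addTop g i).Nonempty :=
  ⟨Fin.last (p + 1), Finset.mem_filter.2 ⟨Finset.mem_univ _, by simp [addTop, Fin.le_last]⟩⟩

/-- The map `g^∧ : [q + 1] → [p + 1]` with `g^∧(j) = min {i : j ≤ (g + [0])(i)}`, the left adjoint of
`g + [0]`. -/
def wedge {p q : ℕ} (g : Fin (p + 1) →o Fin (q + 1)) (j : Fin (q + 2)) : Fin (p + 2) :=
  (Finset.univ.filter fun i : Fin (p + 2) => j ≤ addTop g i).min' (wedge_nonempty g j)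

theorem addTop_mono {p q : ℕ} (g : Fin (p + 1) →o Fin (q + 1)) : Monotone (addTop g) := by
  intro i i' h
  induction i' using Fin.lastCases with
  | last => simp [addTop, Fin.le_last]
  | cast i' =>
    induction i using Fin.lastCases with
    | last => exact absurd h (not_le.2 (Fin.castSucc_lt_last i'))
    | cast i =>
      simp only [addTop, Fin.lastCases_castSucc, Fin.castSucc_le_castSucc_iff]
      exact g.monotone (by simpa using h)

theorem wedge_le_iff {p q : ℕ} (g : Fin (p + 1) →o Fin (q + 1)) (j : Fin (q + 2))
    (i : Fin (p + 2)) : wedge g j ≤ i ↔ j ≤ addTop g i := by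
  constructor
  · intro h
    have h1 := Finset.min'_mem _ (wedge_nonempty g j)
    exact (Finset.mem_filter.1 h1).2.trans (addTop_mono g h)
  · intro h
    exact Finset.min'_le _ _ (by simpa using h)

theorem addTop_id (p : ℕ) (i : Fin (p + 2)) : addTop (OrderHom.id : Fin (p + 1) →o _) i = i := by
  induction i using Fin.lastCases with
  | last => simp [addTop]
  | cast i => simp [addTop]

theorem addTop_comp {p q r : ℕ} (g' : Fin (q + 1) →o Fin (r + 1)) (g : Fin (p + 1) →o Fin (q + 1))
    (i : Fin (p + 2)) : addTop (g'.comp g) i = addTop g' (addTop g i) := by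
  induction i using Fin.lastCases with
  | last => simp [addTop]
  | cast i => simp [addTop]

theorem wedge_id {p : ℕ} (j : Fin (p + 2)) : wedge (OrderHom.id : Fin (p + 1) →o _) j = j :=
  eq_of_forall_ge_iff fun i => by rw [wedge_le_iff, addTop_id]

theorem wedge_comp {p q r : ℕ} (g' : Fin (q + 1) →o Fin (r + 1)) (g : Fin (p + 1) →o Fin (q + 1))
    (j : Fin (r + 2)) : wedge (g'.comp g) j = wedge g (wedge g' j) :=
  eq_of_forall_ge_iff fun i => by simp only [wedge_le_iff, addTop_comp]

/-- The element `k + 1` of `[p + 1] = [p]^∧`, for `k < p`. These are the elements of `[p]^∧` which are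
not end points. -/
def mid {p : ℕ} (k : Fin p) : Fin (p + 2) := k.succ.castSucc

theorem mid_injective {p : ℕ} : Function.Injective (mid : Fin p → Fin (p + 2)) := fun _ _ h =>
  Fin.succ_injective _ (Fin.castSucc_injective _ h)

theorem mid_le_castSucc_iff {p : ℕ} (k : Fin p) (j : Fin (p + 1)) :
    mid k ≤ j.castSucc ↔ k.succ ≤ j := Fin.castSucc_le_castSucc_iff

theorem wedge_mid_le_iff {p q : ℕ} (g : Fin (p + 1) →o Fin (q + 1)) (l : Fin q) (j : Fin (p + 1)) :
    wedge g (mid l) ≤ j.castSucc ↔ l.succ ≤ g j := by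
  rw [wedge_le_iff, ← mid_le_castSucc_iff]
  simp only [addTop, Fin.lastCases_castSucc]

theorem le_castSucc_iff_not {p : ℕ} (k : Fin p) (i : Fin (p + 1)) :
    i ≤ k.castSucc ↔ ¬ k.succ ≤ i := by
  rw [not_le, Fin.le_castSucc_iff]

theorem exists_fiber {p q : ℕ} (g : Fin (p + 1) →o Fin (q + 1)) (l : Fin q) (i j : Fin (p + 1))
    (h₁ : g i ≤ l.castSucc) (h₂ : l.succ ≤ g j) :
    ∃ k : Fin p, wedge g (mid l) = mid k := by
  have h1 : ¬ wedge g (mid l) ≤ i.castSucc := by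
    rw [wedge_mid_le_iff]; exact (le_castSucc_iff_not _ _).1 h₁
  have h2 := (wedge_mid_le_iff g l j).2 h₂
  have h3 : i.val < (wedge g (mid l)).val := not_le.1 h1
  have h4 : (wedge g (mid l)).val ≤ j.val := h2
  have h5 : j.val < p + 1 := j.isLt
  refine ⟨⟨(wedge g (mid l)).val - 1, by omega⟩, Fin.ext ?_⟩
  have h6 : i.castSucc.val = i.val := rfl
  change (wedge g (mid l)).val = (wedge g (mid l)).val - 1 + 1
  omega

/-- If `g i ≤ l < g j`, the unique `k` with `g^∧ (l + 1) = k + 1`. -/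
def fiber {p q : ℕ} (g : Fin (p + 1) →o Fin (q + 1)) (l : Fin q) (i j : Fin (p + 1))
    (h₁ : g i ≤ l.castSucc) (h₂ : l.succ ≤ g j) : Fin p :=
  ⟨(wedge g (mid l)).val - 1, by
    obtain ⟨k, hk⟩ := exists_fiber g l i j h₁ h₂
    rw [hk]
    exact k.isLt⟩

theorem wedge_fiber {p q : ℕ} (g : Fin (p + 1) →o Fin (q + 1)) (l : Fin q) (i j : Fin (p + 1))
    (h₁ : g i ≤ l.castSucc) (h₂ : l.succ ≤ g j) : wedge g (mid l) = mid (fiber g l i j h₁ h₂) := by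
  obtain ⟨k, hk⟩ := exists_fiber g l i j h₁ h₂
  rw [hk]
  congr 1
  apply Fin.ext
  change k.val = (wedge g (mid l)).val - 1
  rw [hk]
  rfl

theorem succ_le_iff_of_wedge {p q : ℕ} {g : Fin (p + 1) →o Fin (q + 1)} {l : Fin q} {k : Fin p}
    (e : wedge g (mid l) = mid k) (j : Fin (p + 1)) : k.succ ≤ j ↔ l.succ ≤ g j := by
  rw [← wedge_mid_le_iff, e, mid_le_castSucc_iff]

theorem le_castSucc_iff_of_wedge {p q : ℕ} {g : Fin (p + 1) →o Fin (q + 1)} {l : Fin q} {k : Fin p}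
    (e : wedge g (mid l) = mid k) (i : Fin (p + 1)) : i ≤ k.castSucc ↔ g i ≤ l.castSucc := by
  rw [le_castSucc_iff_not, le_castSucc_iff_not, succ_le_iff_of_wedge e]

/-! ### The inductively defined category `iΔ₊` -/

/-- Labelled ordinals of finite height: `triv` is the trivial object `[-1]`, and `node p c` is the
ordinal `[p]` together with an object `c j` for every `j ∈ [p]^∧ = [p + 1]`. -/
inductive Tree : Type
  | triv : Tree
  | node (p : ℕ) (c : Fin (p + 2) → Tree) : Tree

/-- The objects of `iΔ₊`: hereditarily, `c j` is trivial if and only if `j` is an end point of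
`[p]^∧`. -/
def Tree.IsObj : Tree → Prop
  | .triv => True
  | .node p c =>
      (∀ j : Fin (p + 2), c j = .triv ↔ j = 0 ∨ j = Fin.last (p + 1)) ∧ ∀ j, (c j).IsObj

/-- Morphisms: there is a unique morphism from `triv` to every object; a morphism
`node p c ⟶ node q d` is an ordinal map `g : [p] → [q]` with a morphism `c (g^∧ j) ⟶ d j`
for every `j ∈ [q]^∧`; there is no morphism `node p c ⟶ triv`, since there is no map `[p] → [-1]`. -/
inductive Tree.Hom : Tree → Tree → Type
  | init (K : Tree) : Tree.Hom .triv K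
  | node {p q : ℕ} {c : Fin (p + 2) → Tree} {d : Fin (q + 2) → Tree}
      (g : Fin (p + 1) →o Fin (q + 1)) (sub : ∀ j : Fin (q + 2), Tree.Hom (c (wedge g j)) (d j)) :
      Tree.Hom (.node p c) (.node q d)

/-- Transport of the domain of a morphism along an equality of objects. -/
def Tree.Hom.castDom {H H' K : Tree} (h : H = H') (f : Tree.Hom H K) : Tree.Hom H' K := h ▸ f

def Tree.Hom.id : (H : Tree) → Tree.Hom H H
  | .triv => .init _
  | .node _ c =>
      .node OrderHom.id fun j => (Tree.Hom.id (c j)).castDom (congrArg c (wedge_id j).symm)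

/-- Composition: `(g' ∘ g)(j) = g'(j) ∘ g(g'^∧ j)`. -/
def Tree.Hom.comp : {H K L : Tree} → Tree.Hom H K → Tree.Hom K L → Tree.Hom H L
  | _, _, _, .init _, _ => .init _
  | _, _, _, .node (c := c) g sub, .node g' sub' =>
      .node (g'.comp g) fun j =>
        Tree.Hom.comp ((sub (wedge g' j)).castDom (congrArg c (wedge_comp g' g j).symm)) (sub' j)

theorem Tree.Hom.castDom_comp {H H' K L : Tree} (h : H = H') (f : Tree.Hom H K)
    (g : Tree.Hom K L) : (f.castDom h).comp g = (f.comp g).castDom h := by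
  subst h; rfl

theorem Tree.Hom.castDom_castDom {H H' H'' K : Tree} (h : H = H') (h' : H' = H'')
    (f : Tree.Hom H K) : (f.castDom h).castDom h' = f.castDom (h.trans h') := by
  subst h; subst h'; rfl

theorem Tree.Hom.id_comp {H K : Tree} (f : Tree.Hom H K) : (Tree.Hom.id H).comp f = f := by
  induction f with
  | init K => rfl
  | node g sub ih =>
    simp only [Tree.Hom.id, Tree.Hom.comp, castDom_castDom]
    congr 1
    funext j
    rw [castDom_comp, ih]
    rfl

theorem Tree.Hom.comp_id {H K : Tree} (f : Tree.Hom H K) : f.comp (Tree.Hom.id K) = f := by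
  induction f with
  | init K => cases K <;> rfl
  | @node p q c d g sub ih =>
    simp only [Tree.Hom.id, Tree.Hom.comp]
    congr 1
    funext j
    have key : ∀ (j' : Fin (q + 2)) (h : j' = j),
        ((sub j').castDom (congrArg (fun j => c (wedge g j)) h)).comp
          ((Tree.Hom.id (d j)).castDom (congrArg d h.symm)) = sub j := by
      intro j' h; subst h; exact ih _
    exact key _ (wedge_id j)

theorem Tree.Hom.comp_assoc {H K L M : Tree} (f : Tree.Hom H K) (g : Tree.Hom K L)
    (h : Tree.Hom L M) : (f.comp g).comp h = f.comp (g.comp h) := by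
  induction h generalizing H K with
  | init K =>
    cases g; cases f; rfl
  | @node r s e m h subh ih =>
    cases g with
    | init => cases f; rfl
    | @node q _ d _ g subg =>
      cases f with
      | init => rfl
      | @node p _ c _ f subf =>
        simp only [Tree.Hom.comp]
        congr 1
        funext j
        have key : ∀ (i i' : Fin (q + 2)) (hi : i = i') (x : Tree.Hom (d i) (e (wedge h j))),
            (subf i').comp (x.castDom (congrArg d hi)) =
              ((subf i).comp x).castDom (congrArg (fun i => c (wedge f i)) hi) := by
          intro i i' hi x; subst hi; rfl
        rw [castDom_comp, castDom_comp, castDom_comp, ← ih, castDom_comp, ← castDom_comp,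
          key _ _ (wedge_comp h g j).symm, castDom_comp, castDom_comp, castDom_castDom,
          castDom_comp, castDom_castDom]
        rfl

instance : Category Tree where
  Hom := Tree.Hom
  id := Tree.Hom.id
  comp := Tree.Hom.comp
  id_comp := Tree.Hom.id_comp
  comp_id := Tree.Hom.comp_id
  assoc := Tree.Hom.comp_assoc

/-- The category `iΔ₊`. -/
abbrev IDeltaPlus := ObjectProperty.FullSubcategory (C := Tree) Tree.IsObj

/-- The category `iΔ`, the full subcategory of `iΔ₊` on the non-trivial objects. -/
abbrev IDelta := ObjectProperty.FullSubcategory (C := IDeltaPlus) fun H => H.obj ≠ Tree.triv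

/-! ### Globular sets and globular cardinals -/

/-- Globular sets (also called `ω`-graphs). -/
structure GlobularSet where
  cell : ℕ → Type
  src : ∀ {n}, cell (n + 1) → cell n
  tgt : ∀ {n}, cell (n + 1) → cell n
  src_src : ∀ {n} (x : cell (n + 2)), src (src x) = src (tgt x)
  tgt_src : ∀ {n} (x : cell (n + 2)), tgt (src x) = tgt (tgt x)

namespace GlobularSet

@[ext]
structure Hom (X Y : GlobularSet) where
  app : ∀ n, X.cell n → Y.cell n
  app_src : ∀ {n} (x : X.cell (n + 1)), app n (X.src x) = Y.src (app (n + 1) x)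
  app_tgt : ∀ {n} (x : X.cell (n + 1)), app n (X.tgt x) = Y.tgt (app (n + 1) x)

instance : Category GlobularSet where
  Hom := Hom
  id X := ⟨fun _ x => x, fun _ => rfl, fun _ => rfl⟩
  comp f g := ⟨fun n x => g.app n (f.app n x),
    fun x => by rw [f.app_src, g.app_src], fun x => by rw [f.app_tgt, g.app_tgt]⟩

/-- The vertices of a globular set, in all dimensions. -/
abbrev Vertex (X : GlobularSet) : Type := Σ n, X.cell n

/-- The relation `x ≺ y` on vertices: `x = s(y)` or `y = t(x)`. -/
inductive Prec (X : GlobularSet) : X.Vertex → X.Vertex → Prop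
  | src {n : ℕ} (y : X.cell (n + 1)) : Prec X ⟨n, X.src y⟩ ⟨n + 1, y⟩
  | tgt {n : ℕ} (x : X.cell (n + 1)) : Prec X ⟨n + 1, x⟩ ⟨n, X.tgt x⟩

/-- The reflexive and transitive relation `x ◂ y` generated by `≺`. -/
def Le (X : GlobularSet) : X.Vertex → X.Vertex → Prop := Relation.ReflTransGen X.Prec

/-- A globular cardinal is a globular set with finitely many vertices on which `◂` is a linear
order. The empty globular set is one. -/
structure IsCardinal (X : GlobularSet) : Prop where
  finite : Finite X.Vertex
  antisymm : ∀ x y : X.Vertex, X.Le x y → X.Le y x → x = y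
  total : ∀ x y : X.Vertex, X.Le x y ∨ X.Le y x

end GlobularSet

/-! ### Strict `ω`-categories -/

/-- Strict `ω`-categories, in the single-sorted presentation: every cell is identified with the
identity cells on it, so that the `n`-cells are the cells `a` with `src n a = a`; `src n` and `tgt n`
are the `n`-source and the `n`-target; `comp n b a` is the composite of `a` followed by `b` along
their common boundary of dimension `n`. Each `(src n, tgt n, comp n)` is a category, for `m < n` the
pair `m, n` forms a strict `2`-category, and every cell is an `n`-cell for some `n`. -/
structure OmegaCat where
  Cell : Type
  src : ℕ → Cell → Cell
  tgt : ℕ → Cell → Cell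
  comp : ∀ (n : ℕ) (b a : Cell), src n b = tgt n a → Cell
  src_src : ∀ n a, src n (src n a) = src n a
  tgt_src : ∀ n a, tgt n (src n a) = src n a
  src_tgt : ∀ n a, src n (tgt n a) = tgt n a
  tgt_tgt : ∀ n a, tgt n (tgt n a) = tgt n a
  src_comp : ∀ n b a h, src n (comp n b a h) = src n a
  tgt_comp : ∀ n b a h, tgt n (comp n b a h) = tgt n b
  comp_src : ∀ n a h, comp n a (src n a) h = a
  tgt_comp_self : ∀ n a h, comp n (tgt n a) a h = a
  assoc : ∀ n c b a h₁ h₂ h₃ h₄, comp n (comp n c b h₁) a h₂ = comp n c (comp n b a h₃) h₄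
  src_src_lt : ∀ m n a, m < n → src n (src m a) = src m a
  src_tgt_lt : ∀ m n a, m < n → src n (tgt m a) = tgt m a
  lt_src_src : ∀ m n a, m < n → src m (src n a) = src m a
  lt_src_tgt : ∀ m n a, m < n → src m (tgt n a) = src m a
  lt_tgt_src : ∀ m n a, m < n → tgt m (src n a) = tgt m a
  lt_tgt_tgt : ∀ m n a, m < n → tgt m (tgt n a) = tgt m a
  src_comp_lt : ∀ m n b a h h', m < n → src n (comp m b a h) = comp m (src n b) (src n a) h'
  tgt_comp_lt : ∀ m n b a h h', m < n → tgt n (comp m b a h) = comp m (tgt n b) (tgt n a) h'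
  interchange : ∀ m n b' b a' a h₁ h₂ h₃ h₄ h₅ h₆, m < n →
    comp m (comp n b' b h₁) (comp n a' a h₂) h₃ = comp n (comp m b' a' h₄) (comp m b a h₅) h₆
  exists_dim : ∀ a, ∃ n, src n a = a

namespace OmegaCat

/-- Strict `ω`-functors. -/
@[ext]
structure Hom (C D : OmegaCat) where
  map : C.Cell → D.Cell
  map_src : ∀ n a, map (C.src n a) = D.src n (map a)
  map_tgt : ∀ n a, map (C.tgt n a) = D.tgt n (map a)
  map_comp : ∀ n b a h h', map (C.comp n b a h) = D.comp n (map b) (map a) h'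

theorem Hom.map_comp_cond {C D : OmegaCat} (F : Hom C D) {n : ℕ} {b a : C.Cell}
    (h : C.src n b = C.tgt n a) : D.src n (F.map b) = D.tgt n (F.map a) := by
  rw [← F.map_src, ← F.map_tgt, h]

/-- The category of strict `ω`-categories. -/
instance : Category OmegaCat where
  Hom := Hom
  id C := ⟨fun a => a, fun _ _ => rfl, fun _ _ => rfl, fun _ _ _ _ _ => rfl⟩
  comp F G := ⟨fun a => G.map (F.map a), fun n a => by rw [F.map_src, G.map_src],
    fun n a => by rw [F.map_tgt, G.map_tgt], fun n b a h h' => by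
      rw [F.map_comp n b a h (F.map_comp_cond h), G.map_comp n _ _ _ h']⟩

/-- The empty strict `ω`-category. -/
def empty : OmegaCat where
  Cell := Empty
  src _ a := a
  tgt _ a := a
  comp _ _ a _ := a
  src_src _ a := a.elim
  tgt_src _ a := a.elim
  src_tgt _ a := a.elim
  tgt_tgt _ a := a.elim
  src_comp _ _ a := a.elim
  tgt_comp _ _ a := a.elim
  comp_src _ a := a.elim
  tgt_comp_self _ a := a.elim
  assoc _ _ _ a := a.elim
  src_src_lt _ _ a := a.elim
  src_tgt_lt _ _ a := a.elim
  lt_src_src _ _ a := a.elim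
  lt_src_tgt _ _ a := a.elim
  lt_tgt_src _ _ a := a.elim
  lt_tgt_tgt _ _ a := a.elim
  src_comp_lt _ _ _ a := a.elim
  tgt_comp_lt _ _ _ a := a.elim
  interchange _ _ _ _ _ a := a.elim
  exists_dim a := a.elim

def fromEmpty (C : OmegaCat) : Hom empty C :=
  ⟨Empty.elim, fun _ a => a.elim, fun _ a => a.elim, fun _ _ a => a.elim⟩

/-- The cells of the `ω`-category with objects `0, …, p` and hom-objects
`A(i, j) = ∏_{i ≤ k < j} A k` for `i ≤ j` (the terminal `ω`-category if `i = j`, no cells if `i > j`):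
a cell consists of its `0`-source `i`, its `0`-target `j`, and a cell of `A(i, j)`. -/
structure PathCell {p : ℕ} (A : Fin p → OmegaCat) where
  i : Fin (p + 1)
  j : Fin (p + 1)
  le : i ≤ j
  val : ∀ k : Fin p, i ≤ k.castSucc → k.succ ≤ j → (A k).Cell

namespace PathCell

variable {p : ℕ} {A : Fin p → OmegaCat}

theorem ext' {x y : PathCell A} (hi : x.i = y.i) (hj : x.j = y.j)
    (h : ∀ k h₁ h₂ h₁' h₂', x.val k h₁ h₂ = y.val k h₁' h₂') : x = y := by
  obtain ⟨i, j, le, v⟩ := x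
  obtain ⟨i', j', le', v'⟩ := y
  obtain rfl : i = i' := hi
  obtain rfl : j = j' := hj
  have : v = v' := by
    funext k h₁ h₂
    exact h k h₁ h₂ h₁ h₂
  subst this
  rfl

theorem val_congr {x y : PathCell A} (e : x = y) (k : Fin p) (h₁ h₂ h₁' h₂') :
    x.val k h₁ h₂ = y.val k h₁' h₂' := by
  subst e; rfl

/-- The object `i`, seen as a cell. -/
def obj (i : Fin (p + 1)) : PathCell A :=
  ⟨i, i, le_rfl, fun k h₁ h₂ =>
    absurd (h₂.trans h₁) (not_le.2 (Fin.castSucc_lt_succ (i := k)))⟩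

def src : ℕ → PathCell A → PathCell A
  | 0, x => obj x.i
  | n + 1, x => ⟨x.i, x.j, x.le, fun k h₁ h₂ => (A k).src n (x.val k h₁ h₂)⟩

def tgt : ℕ → PathCell A → PathCell A
  | 0, x => obj x.j
  | n + 1, x => ⟨x.i, x.j, x.le, fun k h₁ h₂ => (A k).tgt n (x.val k h₁ h₂)⟩

theorem mid_eq {y x : PathCell A} (h : src 0 y = tgt 0 x) : y.i = x.j := congrArg PathCell.i h

theorem i_eq {n : ℕ} {y x : PathCell A} (h : src (n + 1) y = tgt (n + 1) x) : y.i = x.i := by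
  have e := congrArg PathCell.i h
  exact e

theorem j_eq {n : ℕ} {y x : PathCell A} (h : src (n + 1) y = tgt (n + 1) x) : y.j = x.j := by
  have e := congrArg PathCell.j h
  exact e

/-- Composition along dimension `0` is concatenation; composition along dimension `n + 1` is
componentwise composition along dimension `n`. -/
def comp : ∀ (n : ℕ) (y x : PathCell A), src n y = tgt n x → PathCell A
  | 0, y, x, h => ⟨x.i, y.j, x.le.trans ((mid_eq h).symm.le.trans y.le), fun k h₁ h₂ =>
      if hk : k.succ ≤ x.j then x.val k h₁ hk
      else y.val k ((mid_eq h).le.trans (Fin.le_castSucc_iff.2 (not_le.1 hk))) h₂⟩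
  | n + 1, y, x, h => ⟨x.i, x.j, x.le, fun k h₁ h₂ =>
      (A k).comp n (y.val k ((i_eq h).le.trans h₁) (h₂.trans (j_eq h).symm.le)) (x.val k h₁ h₂)
        (val_congr h k _ _ _ _)⟩

end PathCell

theorem src_of_le (C : OmegaCat) {m n : ℕ} {a : C.Cell} (h : C.src m a = a) (hmn : m ≤ n) :
    C.src n a = a := by
  rcases hmn.eq_or_lt with rfl | hlt
  · exact h
  · rw [← h, C.src_src_lt m n a hlt]

theorem comp_congr (C : OmegaCat) (n : ℕ) {b b' a a' : C.Cell} (hb : b = b') (ha : a = a')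
    (h : C.src n b = C.tgt n a) (h' : C.src n b' = C.tgt n a') :
    C.comp n b a h = C.comp n b' a' h' := by
  subst hb; subst ha; rfl

/-- The `ω`-category with objects `0, …, p` and hom-objects `A(i, j) = ∏_{i ≤ k < j} A k` for
`i ≤ j`, with `0`-composition given by concatenation. -/
def path {p : ℕ} (A : Fin p → OmegaCat) : OmegaCat where
  Cell := PathCell A
  src := PathCell.src
  tgt := PathCell.tgt
  comp := PathCell.comp
  src_src n a := by
    cases n with
    | zero => rfl
    | succ n => exact PathCell.ext' rfl rfl fun k _ _ _ _ => (A k).src_src n _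
  tgt_src n a := by
    cases n with
    | zero => rfl
    | succ n => exact PathCell.ext' rfl rfl fun k _ _ _ _ => (A k).tgt_src n _
  src_tgt n a := by
    cases n with
    | zero => rfl
    | succ n => exact PathCell.ext' rfl rfl fun k _ _ _ _ => (A k).src_tgt n _
  tgt_tgt n a := by
    cases n with
    | zero => rfl
    | succ n => exact PathCell.ext' rfl rfl fun k _ _ _ _ => (A k).tgt_tgt n _
  src_comp n b a h := by
    cases n with
    | zero => rfl
    | succ n => exact PathCell.ext' rfl rfl fun k _ _ _ _ => (A k).src_comp n _ _ _
  tgt_comp n b a h := by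
    cases n with
    | zero => rfl
    | succ n =>
      exact PathCell.ext' (PathCell.i_eq h).symm (PathCell.j_eq h).symm
        fun k _ _ _ _ => (A k).tgt_comp n _ _ _
  comp_src n a h := by
    cases n with
    | zero =>
      refine PathCell.ext' rfl rfl fun k h₁ h₂ h₁' h₂' => ?_
      exact dif_neg fun hk => absurd (hk.trans h₁) (not_le.2 (Fin.castSucc_lt_succ (i := k)))
    | succ n => exact PathCell.ext' rfl rfl fun k _ _ _ _ => (A k).comp_src n _ _
  tgt_comp_self n a h := by
    cases n with
    | zero => exact PathCell.ext' rfl rfl fun k h₁ h₂ h₁' h₂' => dif_pos h₂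
    | succ n => exact PathCell.ext' rfl rfl fun k _ _ _ _ => (A k).tgt_comp_self n _ _
  assoc n c b a h₁ h₂ h₃ h₄ := by
    cases n with
    | zero =>
      refine PathCell.ext' rfl rfl fun k g₁ g₂ g₁' g₂' => ?_
      have hb : a.j ≤ b.j := (PathCell.mid_eq h₃).symm.le.trans b.le
      by_cases ha : k.succ ≤ a.j
      · simp [PathCell.comp, ha, ha.trans hb]
      · simp [PathCell.comp, ha]
    | succ n => exact PathCell.ext' rfl rfl fun k _ _ _ _ => (A k).assoc n _ _ _ _ _ _ _
  src_src_lt m n a h := by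
    obtain ⟨n, rfl⟩ := Nat.exists_eq_succ_of_ne_zero (Nat.ne_zero_of_lt h)
    cases m with
    | zero =>
      exact PathCell.ext' rfl rfl fun k h₁ h₂ _ _ =>
        absurd (h₂.trans h₁) (not_le.2 (Fin.castSucc_lt_succ (i := k)))
    | succ m =>
      exact PathCell.ext' rfl rfl fun k _ _ _ _ =>
        (A k).src_src_lt m n _ (Nat.lt_of_succ_lt_succ h)
  src_tgt_lt m n a h := by
    obtain ⟨n, rfl⟩ := Nat.exists_eq_succ_of_ne_zero (Nat.ne_zero_of_lt h)
    cases m with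
    | zero =>
      exact PathCell.ext' rfl rfl fun k h₁ h₂ _ _ =>
        absurd (h₂.trans h₁) (not_le.2 (Fin.castSucc_lt_succ (i := k)))
    | succ m =>
      exact PathCell.ext' rfl rfl fun k _ _ _ _ =>
        (A k).src_tgt_lt m n _ (Nat.lt_of_succ_lt_succ h)
  lt_src_src m n a h := by
    obtain ⟨n, rfl⟩ := Nat.exists_eq_succ_of_ne_zero (Nat.ne_zero_of_lt h)
    cases m with
    | zero => rfl
    | succ m =>
      exact PathCell.ext' rfl rfl fun k _ _ _ _ =>
        (A k).lt_src_src m n _ (Nat.lt_of_succ_lt_succ h)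
  lt_src_tgt m n a h := by
    obtain ⟨n, rfl⟩ := Nat.exists_eq_succ_of_ne_zero (Nat.ne_zero_of_lt h)
    cases m with
    | zero => rfl
    | succ m =>
      exact PathCell.ext' rfl rfl fun k _ _ _ _ =>
        (A k).lt_src_tgt m n _ (Nat.lt_of_succ_lt_succ h)
  lt_tgt_src m n a h := by
    obtain ⟨n, rfl⟩ := Nat.exists_eq_succ_of_ne_zero (Nat.ne_zero_of_lt h)
    cases m with
    | zero => rfl
    | succ m =>
      exact PathCell.ext' rfl rfl fun k _ _ _ _ =>
        (A k).lt_tgt_src m n _ (Nat.lt_of_succ_lt_succ h)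
  lt_tgt_tgt m n a h := by
    obtain ⟨n, rfl⟩ := Nat.exists_eq_succ_of_ne_zero (Nat.ne_zero_of_lt h)
    cases m with
    | zero => rfl
    | succ m =>
      exact PathCell.ext' rfl rfl fun k _ _ _ _ =>
        (A k).lt_tgt_tgt m n _ (Nat.lt_of_succ_lt_succ h)
  src_comp_lt m n b a h h' hlt := by
    obtain ⟨n, rfl⟩ := Nat.exists_eq_succ_of_ne_zero (Nat.ne_zero_of_lt hlt)
    cases m with
    | zero =>
      refine PathCell.ext' rfl rfl fun k h₁ h₂ _ _ => ?_
      by_cases hk : k.succ ≤ a.j <;> simp [PathCell.comp, PathCell.src, hk]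
    | succ m =>
      exact PathCell.ext' rfl rfl fun k _ _ _ _ =>
        (A k).src_comp_lt m n _ _ _ _ (Nat.lt_of_succ_lt_succ hlt)
  tgt_comp_lt m n b a h h' hlt := by
    obtain ⟨n, rfl⟩ := Nat.exists_eq_succ_of_ne_zero (Nat.ne_zero_of_lt hlt)
    cases m with
    | zero =>
      refine PathCell.ext' rfl rfl fun k h₁ h₂ _ _ => ?_
      by_cases hk : k.succ ≤ a.j <;> simp [PathCell.comp, PathCell.tgt, hk]
    | succ m =>
      exact PathCell.ext' rfl rfl fun k _ _ _ _ =>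
        (A k).tgt_comp_lt m n _ _ _ _ (Nat.lt_of_succ_lt_succ hlt)
  interchange m n b' b a' a h₁ h₂ h₃ h₄ h₅ h₆ hlt := by
    obtain ⟨n, rfl⟩ := Nat.exists_eq_succ_of_ne_zero (Nat.ne_zero_of_lt hlt)
    cases m with
    | zero =>
      refine PathCell.ext' rfl rfl fun k g₁ g₂ _ _ => ?_
      have ha : a'.j = a.j := PathCell.j_eq h₂
      by_cases hk : k.succ ≤ a.j
      · simp [PathCell.comp, hk, ha]
      · simp [PathCell.comp, hk, ha]
    | succ m =>
      exact PathCell.ext' rfl rfl fun k _ _ _ _ =>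
        (A k).interchange m n _ _ _ _ _ _ _ _ _ _ (Nat.lt_of_succ_lt_succ hlt)
  exists_dim a := by
    have h : ∀ k : Fin p, ∃ n, ∀ h₁ h₂, (A k).src n (a.val k h₁ h₂) = a.val k h₁ h₂ := by
      intro k
      by_cases hk : a.i ≤ k.castSucc ∧ k.succ ≤ a.j
      · obtain ⟨n, hn⟩ := (A k).exists_dim (a.val k hk.1 hk.2)
        exact ⟨n, fun _ _ => hn⟩
      · exact ⟨0, fun h₁ h₂ => absurd ⟨h₁, h₂⟩ hk⟩
    choose N hN using h
    exact ⟨Finset.univ.sup N + 1, PathCell.ext' rfl rfl fun k h₁ h₂ _ _ =>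
      (A k).src_of_le (hN k h₁ h₂) (Finset.le_sup (Finset.mem_univ k))⟩

/-- The cell map of `pathMap`. -/
def pathMapCell {p q : ℕ} {A : Fin p → OmegaCat} {B : Fin q → OmegaCat}
    (g : Fin (p + 1) →o Fin (q + 1))
    (F : ∀ (l : Fin q) (k : Fin p), wedge g (mid l) = mid k → Hom (A k) (B l))
    (x : PathCell A) : PathCell B where
  i := g x.i
  j := g x.j
  le := g.monotone x.le
  val l h₁ h₂ :=
    (F l (fiber g l x.i x.j h₁ h₂) (wedge_fiber g l x.i x.j h₁ h₂)).map
      (x.val (fiber g l x.i x.j h₁ h₂)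
        ((le_castSucc_iff_of_wedge (wedge_fiber g l x.i x.j h₁ h₂) _).2 h₁)
        ((succ_le_iff_of_wedge (wedge_fiber g l x.i x.j h₁ h₂) _).2 h₂))

theorem pathMapCell_val {p q : ℕ} {A : Fin p → OmegaCat} {B : Fin q → OmegaCat}
    (g : Fin (p + 1) →o Fin (q + 1))
    (F : ∀ (l : Fin q) (k : Fin p), wedge g (mid l) = mid k → Hom (A k) (B l))
    (x : PathCell A) (l : Fin q) (k : Fin p) (e : wedge g (mid l) = mid k) (h₁ h₂ h₁' h₂') :
    (pathMapCell g F x).val l h₁ h₂ = (F l k e).map (x.val k h₁' h₂') := by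
  have hk : fiber g l x.i x.j h₁ h₂ = k :=
    mid_injective ((wedge_fiber g l x.i x.j h₁ h₂).symm.trans e)
  subst hk
  rfl

/-- The `ω`-functor given on objects by `g` and on the hom-object from `i` to `j` by the map
`∏_{i ≤ k < j} A k ⟶ ∏_{g i ≤ l < g j} B l` whose `l`-th component is the `k`-th projection followed
by `F l k : A k ⟶ B l`, where `k + 1 = g^∧ (l + 1)`. -/
def pathMap {p q : ℕ} {A : Fin p → OmegaCat} {B : Fin q → OmegaCat}
    (g : Fin (p + 1) →o Fin (q + 1))
    (F : ∀ (l : Fin q) (k : Fin p), wedge g (mid l) = mid k → Hom (A k) (B l)) :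
    Hom (path A) (path B) where
  map := pathMapCell g F
  map_src n a := by
    cases n with
    | zero =>
      exact PathCell.ext' rfl rfl fun k h₁ h₂ _ _ =>
        absurd (h₂.trans h₁) (not_le.2 (Fin.castSucc_lt_succ (i := k)))
    | succ n => exact PathCell.ext' rfl rfl fun l _ _ _ _ => Hom.map_src _ n _
  map_tgt n a := by
    cases n with
    | zero =>
      exact PathCell.ext' rfl rfl fun k h₁ h₂ _ _ =>
        absurd (h₂.trans h₁) (not_le.2 (Fin.castSucc_lt_succ (i := k)))
    | succ n => exact PathCell.ext' rfl rfl fun l _ _ _ _ => Hom.map_tgt _ n _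
  map_comp n b a h h' := by
    cases n with
    | zero =>
      refine PathCell.ext' rfl rfl fun l h₁ h₂ h₁' h₂' => ?_
      have e := wedge_fiber g l a.i b.j h₁ h₂
      have hi := (le_castSucc_iff_of_wedge e a.i).2 h₁
      have hj := (succ_le_iff_of_wedge e b.j).2 h₂
      have hm : b.i = a.j := PathCell.mid_eq h
      refine (pathMapCell_val g F _ l _ e h₁ h₂ hi hj).trans ?_
      by_cases hl : l.succ ≤ g a.j
      · have hk := (succ_le_iff_of_wedge e a.j).2 hl
        refine (congrArg (F l _ e).map (dif_pos hk)).trans ?_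
        refine Eq.trans ?_ (dif_pos hl).symm
        exact (pathMapCell_val g F a l _ e _ _ _ _).symm
      · have hk : ¬ (fiber g l a.i b.j h₁ h₂).succ ≤ a.j := fun hk =>
          hl ((succ_le_iff_of_wedge e a.j).1 hk)
        refine (congrArg (F l _ e).map (dif_neg hk)).trans ?_
        refine Eq.trans ?_ (dif_neg hl).symm
        exact (pathMapCell_val g F b l _ e _ _ _ _).symm
    | succ n =>
      refine PathCell.ext' rfl rfl fun l h₁ h₂ h₁' h₂' => ?_
      have e := wedge_fiber g l a.i a.j h₁ h₂
      have hi := (le_castSucc_iff_of_wedge e a.i).2 h₁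
      have hj := (succ_le_iff_of_wedge e a.j).2 h₂
      refine (pathMapCell_val g F _ l _ e h₁ h₂ hi hj).trans ?_
      refine ((F l _ e).map_comp n _ _ _ ((F l _ e).map_comp_cond
        (PathCell.val_congr h _ _ _ _ _))).trans ?_
      refine (B l).comp_congr n ?_ ?_ _ _
      · exact (pathMapCell_val g F b l _ e _ _ _ _).symm
      · exact (pathMapCell_val g F a l _ e _ _ _ _).symm

/-- The underlying globular set of a strict `ω`-category. Its `n`-vertices are the `n`-cells,
identity cells included. -/
def forget : OmegaCat ⥤ GlobularSet where
  obj C :=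
    { cell := fun n => {a : C.Cell // C.src n a = a}
      src := fun {n} a => ⟨C.src n a.1, C.src_src n a.1⟩
      tgt := fun {n} a => ⟨C.tgt n a.1, C.src_tgt n a.1⟩
      src_src := fun {n} a => Subtype.ext <|
        (C.lt_src_src n (n + 1) a.1 n.lt_succ_self).trans
          (C.lt_src_tgt n (n + 1) a.1 n.lt_succ_self).symm
      tgt_src := fun {n} a => Subtype.ext <|
        (C.lt_tgt_src n (n + 1) a.1 n.lt_succ_self).trans
          (C.lt_tgt_tgt n (n + 1) a.1 n.lt_succ_self).symm }
  map F :=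
    { app := fun n a => ⟨F.map a.1, by rw [← F.map_src, a.2]⟩
      app_src := fun {n} a => Subtype.ext (F.map_src n a.1)
      app_tgt := fun {n} a => Subtype.ext (F.map_tgt n a.1) }

/-- `η` exhibits `C` as the free strict `ω`-category on the globular set `G`. -/
def IsFree {G : GlobularSet} {C : OmegaCat} (η : G ⟶ forget.obj C) : Prop :=
  ∀ (D : OmegaCat) (f : G ⟶ forget.obj D), ∃! F : C ⟶ D, η ≫ forget.map F = f

/-! ### The categories `Θ₊`, `Θ` and `𝒮` -/

/-- `C` is a free strict `ω`-category on a (possibly empty) globular cardinal. -/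
def IsThetaPlus : ObjectProperty OmegaCat := fun C =>
  ∃ (X : GlobularSet) (η : X ⟶ forget.obj C), X.IsCardinal ∧ IsFree η

/-- `C` is a free strict `ω`-category on a non-empty globular cardinal. -/
def IsTheta : ObjectProperty OmegaCat := fun C =>
  ∃ (X : GlobularSet) (η : X ⟶ forget.obj C), X.IsCardinal ∧ Nonempty X.Vertex ∧ IsFree η

/-- An `n`-cell is proper if it is not an identity cell, that is, if it is not an `m`-cell for
any `m < n`. -/
def IsProper {C : OmegaCat} (a : (forget.obj C).Vertex) : Prop :=
  ∀ m < a.1, C.src m a.2.1 ≠ a.2.1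

/-- With `C` the free strict `ω`-category on `G` and `m : H ⟶ G`, the cell `a` of `C` is in the image
of the `ω`-functor `[m] : [H] ⟶ [G]` that `m` induces between the free strict `ω`-categories. -/
def InImage {G : GlobularSet} {C : OmegaCat} (η : G ⟶ forget.obj C) {H : GlobularSet} (m : H ⟶ G)
    (a : (forget.obj C).Vertex) : Prop :=
  ∃ (D : OmegaCat) (θ : H ⟶ forget.obj D) (F : D ⟶ C), IsFree θ ∧ θ ≫ forget.map F = m ≫ η ∧
    ∃ b : (forget.obj D).cell a.1, (forget.map F).app a.1 b = a.2

/-- With `C` the free strict `ω`-category on `G`, the cell `a` is maximal: it is proper, and the only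
monomorphisms `m : H ⟶ G` with `a` in the image of `[m]` are the isomorphisms. -/
def IsMaximal {G : GlobularSet} {C : OmegaCat} (η : G ⟶ forget.obj C)
    (a : (forget.obj C).Vertex) : Prop :=
  IsProper a ∧ ∀ (H : GlobularSet) (m : H ⟶ G), Mono m → InImage η m a → IsIso m

/-- `C` is simple: it is the free strict `ω`-category `[G]` on a composable `ω`-graph `G`, one for
which `[G]` has a unique maximal element. -/
def IsSimple : ObjectProperty OmegaCat := fun C =>
  ∃ (G : GlobularSet) (η : G ⟶ forget.obj C), IsFree η ∧ ∃! a, IsMaximal η a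

/-- The category `Θ₊`. -/
abbrev ThetaPlus := IsThetaPlus.FullSubcategory

/-- The category `Θ`. -/
abbrev Theta := IsTheta.FullSubcategory

/-- The category `𝒮` of simple strict `ω`-categories. -/
abbrev Simple := IsSimple.FullSubcategory

end OmegaCat

/-! ### The functor `Ψ` -/

/-- Enriched graphs on finite ordinals: the empty graph, and the graph with vertices `0 < 1 < ⋯ < p`
and edge-object `edge k` from `k` to its successor `k + 1`, all the other edge-objects being empty. -/
inductive OrdGraph : Type
  | empty : OrdGraph
  | mk (p : ℕ) (edge : Fin p → OrdGraph) : OrdGraph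

/-- Ordinal graphs: hereditarily, the edge-object from a vertex to its successor is non-empty. -/
def OrdGraph.IsOrdinal : OrdGraph → Prop
  | .empty => True
  | .mk _ edge => ∀ k, edge k ≠ .empty ∧ (edge k).IsOrdinal

/-- The free strict `ω`-category `𝔉 G` on an ordinal graph `G`: its objects are the vertices of `G`, and
its hom-object from `i` to `j` is the product of the `𝔉 (edge k)` over `i ≤ k < j` if `i ≤ j`, and is
empty if `i > j`. -/
def OrdGraph.free : OrdGraph → OmegaCat
  | .empty => .empty
  | .mk _ edge => .path fun k => (edge k).free

/-- The ordinal graph `Υ H` of an object `H` of `iΔ₊`: its vertices are the elements of the underlying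
ordinal of `H`, with edge-object `Υ H(i)` from `i - 1` to `i`. -/
def upsilon : Tree → OrdGraph
  | .triv => .empty
  | .node p c => .mk p fun k => upsilon (c (mid k))

theorem mid_ne_endpoint {p : ℕ} (k : Fin p) : ¬ (mid k = 0 ∨ mid k = Fin.last (p + 1)) := by
  have hk := k.isLt
  have hv : (mid k).val = k.val + 1 := rfl
  rintro (h | h)
  · have := congrArg Fin.val h
    simp only [Fin.val_zero] at this
    omega
  · have := congrArg Fin.val h
    simp only [Fin.val_last] at this
    omega

theorem upsilon_isOrdinal (H : Tree) (h : H.IsObj) : (upsilon H).IsOrdinal := by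
  induction H with
  | triv => exact trivial
  | node p c ih =>
    intro k
    refine ⟨fun e => ?_, ih _ (h.2 _)⟩
    apply mid_ne_endpoint k
    rw [← h.1 (mid k)]
    cases hc : c (mid k) with
    | triv => rfl
    | node q d =>
      change upsilon (c (mid k)) = OrdGraph.empty at e
      rw [hc] at e
      exact absurd e (by simp [upsilon])

/-- `Ψ H = 𝔉 (Υ H)`. -/
abbrev psiObj (H : Tree) : OmegaCat := (upsilon H).free

/-- Transport of the domain of an `ω`-functor along an equality of objects of `iΔ₊`. -/
def psiCast {H H' : Tree} {C : OmegaCat} (h : H = H') (F : OmegaCat.Hom (psiObj H) C) :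
    OmegaCat.Hom (psiObj H') C := h ▸ F

/-- `Ψ` on morphisms, inductively: `Ψ g` is `g` on objects, and on the hom-object from `i - 1` to `i` it
is the map `Ψ H(i) ⟶ ∏_{j} Ψ K(j)`, over those `j` with `g(i - 1) < j ≤ g(i)`, with components
`Ψ g(j)`; for these `j` one has `g^∧ j = i`. -/
def psiMap : {H K : Tree} → Tree.Hom H K → OmegaCat.Hom (psiObj H) (psiObj K)
  | _, _, .init K => OmegaCat.fromEmpty (psiObj K)
  | _, _, .node (c := c) g sub =>
      OmegaCat.pathMap g fun l _ e => psiCast (congrArg c e) (psiMap (sub (mid l)))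

theorem psiMap_castDom {H H' K : Tree} (h : H = H') (f : Tree.Hom H K) :
    psiMap (f.castDom h) = psiCast h (psiMap f) := by
  subst h; rfl

theorem psiCast_psiCast {H H' H'' : Tree} {C : OmegaCat} (h : H = H') (h' : H' = H'')
    (F : OmegaCat.Hom (psiObj H) C) : psiCast h' (psiCast h F) = psiCast (h.trans h') F := by
  subst h; subst h'; rfl

theorem psiCast_comp {H H' : Tree} {C D : OmegaCat} (h : H = H') (F : psiObj H ⟶ C) (G : C ⟶ D) :
    psiCast h (F ≫ G) =
      CategoryStruct.comp (X := psiObj H') (Y := C) (Z := D) (psiCast h F) G := by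
  subst h; rfl

theorem psiMap_id (H : Tree) : psiMap (Tree.Hom.id H) = 𝟙 (psiObj H) := by
  induction H with
  | triv => exact OmegaCat.Hom.ext (funext fun a => a.elim)
  | node p c ih =>
    refine OmegaCat.Hom.ext (funext fun x => ?_)
    refine OmegaCat.PathCell.ext' rfl rfl fun l h₁ h₂ h₁' h₂' => ?_
    refine (OmegaCat.pathMapCell_val _ _ x l l (wedge_id (mid l)) h₁ h₂ h₁' h₂').trans ?_
    rw [psiMap_castDom, psiCast_psiCast, ih]
    rfl

theorem psiMap_comp {H K L : Tree} (f : Tree.Hom H K) (f' : Tree.Hom K L) :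
    psiMap (f.comp f') =
      CategoryStruct.comp (X := psiObj H) (Y := psiObj K) (Z := psiObj L) (psiMap f) (psiMap f') := by
  induction f' generalizing H with
  | init K =>
    cases f
    exact OmegaCat.Hom.ext (funext fun a => a.elim)
  | @node q r d e g' sub' ih =>
    cases f with
    | init => exact OmegaCat.Hom.ext (funext fun a => a.elim)
    | @node p _ c _ g sub =>
      refine OmegaCat.Hom.ext (funext fun x => ?_)
      refine OmegaCat.PathCell.ext' rfl rfl fun l h₁ h₂ h₁' h₂' => ?_
      obtain ⟨k', e'⟩ := exists_fiber g' l (g x.i) (g x.j) h₁ h₂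
      have a₁ := (le_castSucc_iff_of_wedge e' _).2 h₁
      have a₂ := (succ_le_iff_of_wedge e' _).2 h₂
      obtain ⟨k, e''⟩ := exists_fiber g k' x.i x.j a₁ a₂
      have b₁ := (le_castSucc_iff_of_wedge e'' _).2 a₁
      have b₂ := (succ_le_iff_of_wedge e'' _).2 a₂
      have e₀ : wedge (g'.comp g) (mid l) = mid k := by rw [wedge_comp, e', e'']
      have key : ∀ (i : Fin (q + 2)) (G : OmegaCat.Hom (psiObj (d i)) (psiObj (e (mid l))))
          (h : i = mid k') (h' : wedge g i = mid k) (y : (psiObj (c (mid k))).Cell),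
          (psiCast (congrArg d h) G).map ((psiCast (congrArg c e'') (psiMap (sub (mid k')))).map y) =
            G.map ((psiCast (congrArg c h') (psiMap (sub i))).map y) := by
        intro i G h h' y
        subst h
        rfl
      refine (OmegaCat.pathMapCell_val _ _ x l k e₀ h₁ h₂ b₁ b₂).trans ?_
      refine Eq.trans ?_ (OmegaCat.pathMapCell_val _ _ _ l k' e' h₁' h₂' a₁ a₂).symm
      have v : ((psiMap (Tree.Hom.node g sub)).map x).val k' a₁ a₂ =
          (psiCast (congrArg c e'') (psiMap (sub (mid k')))).map (x.val k b₁ b₂) :=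
        OmegaCat.pathMapCell_val g (fun l _ e => psiCast (congrArg c e) (psiMap (sub (mid l))))
          x k' k e'' a₁ a₂ b₁ b₂
      refine Eq.trans ?_ (congrArg (OmegaCat.Hom.map _) v).symm
      refine Eq.trans ?_ (key _ (psiMap (sub' (mid l))) e' (by rw [e', e'']) _).symm
      have w : psiCast (congrArg c e₀) (psiMap (((sub (wedge g' (mid l))).castDom
            (congrArg c (wedge_comp g' g (mid l)).symm)).comp (sub' (mid l)))) =
          CategoryStruct.comp (X := psiObj (c (mid k))) (Y := psiObj (d (wedge g' (mid l))))
            (Z := psiObj (e (mid l)))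
            (psiCast (congrArg c (show wedge g (wedge g' (mid l)) = mid k by rw [e', e'']))
              (psiMap (sub (wedge g' (mid l))))) (psiMap (sub' (mid l))) := by
        rw [Tree.Hom.castDom_comp, psiMap_castDom, psiCast_psiCast, ih, psiCast_comp]
      exact congrArg (fun F : OmegaCat.Hom _ _ => F.map (x.val k b₁ b₂)) w

/-- The functor `Ψ` on all labelled ordinals of finite height. -/
def psiTree : Tree ⥤ OmegaCat where
  obj := psiObj
  map f := psiMap f
  map_id := psiMap_id
  map_comp f g := psiMap_comp f g

/-- The functor `Ψ` from `iΔ₊` to strict `ω`-categories. -/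
def psi : IDeltaPlus ⥤ OmegaCat := ObjectProperty.ι _ ⋙ psiTree

/-- The restriction of `Ψ` to the category `iΔ` of non-trivial objects. -/
def psiNontrivial : IDelta ⥤ OmegaCat := ObjectProperty.ι _ ⋙ psi

end OmegaTheta

/-!
The functor `Ψ` is fully faithful because an `ω`-functor between path categories is visibly a monotone
map on objects together with `ω`-functors between the hom-objects of consecutive objects: `path A` is
generated under `0`-composition by its objects and by the cells from `k` to `k + 1`
(`OmegaCat.PathCell.induction_on`), so every `ω`-functor out of it is a `pathMap`
(`OmegaCat.pathMap_surjective`). Non-triviality of the inner labels of an object of `iΔ₊` makes these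
hom-objects non-empty, hence the map on objects monotone, and triviality of the end labels leaves no
further choice. The claim follows by induction (`psiMap_injective`, `psiMap_surjective`).

For the rest, the free strict `ω`-category on an arbitrary globular set `X` is made explicit. Its cells
are pasting trees with labels in `X`: a cell is a walk `x₀, c₁, x₁, …, c_p, x_p` in which each edge `c_k`
is, recursively, such a cell in the globular set of the cells of `X` from `x_{k-1}` to `x_k`. On trees all
the operations are defined by recursion and all the laws of `ω`-categories hold, whatever the labels are;
the trees whose labels fit together (`PasteTree.WF`) form the `ω`-category `freeCat X`, which is
free on `X` (`freeUnit_isFree`).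

The labels of a tree, read from left to right, form a list whose consecutive members are related by
`≺` (`PasteTree.WF.isChain`), and the tree can be recovered from this list
(`exists_tree_of_isChain`, `PasteTree.WF.flat_append_injective`). Therefore `X` is a non-empty globular
cardinal if and only if its vertices can be arranged, without repetition, in a pasting tree, and
this tree is then unique. A copy of an ordinal graph `o` in `X` (`Shape`) identifies `𝔉 o` with
`freeCat X` (`Shape.exists_iso`); since each object of `iΔ₊` has such a copy and each cardinal is one, `Ψ`
takes values in `Θ₊` and is essentially surjective (`exists_cardinal_of_isObj`,
`exists_isObj_of_cardinal`).

Finally, a proper cell of the free `ω`-category on `G` is maximal if and only if all the vertices of `G`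
occur in its tree (`OmegaCat.isMaximal_iff`). A tree with a repeated label contains a closed walk, and
going round once more produces a second tree with the same labels (`PasteTree.WF.exists_larger`). So a
unique maximal cell exists exactly if `G` is a non-empty globular cardinal: the simple
`ω`-categories are the objects of `Θ` (`isSimple_eq_isTheta`), and the last two equivalences coincide.
-/

namespace OmegaTheta

/-! ### Fullness and faithfulness of `Ψ` -/

namespace OmegaCat

section PathFunctors

variable {p q : ℕ} {A : Fin p → OmegaCat} {B : Fin q → OmegaCat}

theorem Hom.map_congr_eq {C D : OmegaCat} {F F' : Hom C D} (h : F = F') (a : C.Cell) :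
    F.map a = F'.map a := by rw [h]

theorem PathCell.eq_of_single_bounds {k k' : Fin p} (h₁ : k.castSucc ≤ k'.castSucc)
    (h₂ : k'.succ ≤ k.succ) : k = k' :=
  le_antisymm (Fin.castSucc_le_castSucc_iff.1 h₁) (Fin.succ_le_succ_iff.1 h₂)

theorem PathCell.not_bounds {k : Fin p} {i : Fin (p + 1)} (h₁ : i ≤ k.castSucc)
    (h₂ : k.succ ≤ i) : False :=
  absurd (h₂.trans h₁) (not_le.2 (Fin.castSucc_lt_succ (i := k)))

/-- A cell `y` of the hom-object `A k` from `k` to `k + 1`, seen as a cell of `path A`. -/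
def PathCell.single (k : Fin p) (y : (A k).Cell) : PathCell A where
  i := k.castSucc
  j := k.succ
  le := (Fin.castSucc_lt_succ (i := k)).le
  val _ h₁ h₂ := (PathCell.eq_of_single_bounds h₁ h₂) ▸ y

theorem PathCell.src_single (n : ℕ) (k : Fin p) (y : (A k).Cell) :
    (path A).src (n + 1) (PathCell.single k y) = PathCell.single k ((A k).src n y) := by
  refine PathCell.ext' rfl rfl fun k' h₁ h₂ _ _ => ?_
  obtain rfl := PathCell.eq_of_single_bounds h₁ h₂
  rfl

theorem PathCell.tgt_single (n : ℕ) (k : Fin p) (y : (A k).Cell) :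
    (path A).tgt (n + 1) (PathCell.single k y) = PathCell.single k ((A k).tgt n y) := by
  refine PathCell.ext' rfl rfl fun k' h₁ h₂ _ _ => ?_
  obtain rfl := PathCell.eq_of_single_bounds h₁ h₂
  rfl

theorem PathCell.comp_single (n : ℕ) (k : Fin p) (y x : (A k).Cell) (h h') :
    (path A).comp (n + 1) (PathCell.single k y) (PathCell.single k x) h =
      PathCell.single k ((A k).comp n y x h') := by
  refine PathCell.ext' rfl rfl fun k' h₁ h₂ _ _ => ?_
  obtain rfl := PathCell.eq_of_single_bounds h₁ h₂
  rfl

/-- The cells of `path A` are generated under `0`-composition by the objects and the cells of the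
hom-objects between consecutive objects. -/
theorem PathCell.induction_on {S : (path A).Cell → Prop} (hobj : ∀ i, S (PathCell.obj i))
    (hsingle : ∀ k y, S (PathCell.single k y))
    (hcomp : ∀ b a h, S b → S a → S ((path A).comp 0 b a h)) (a : (path A).Cell) : S a := by
  suffices H : ∀ (d : ℕ) (a : PathCell A), a.j.val = a.i.val + d → S a by
    have h : a.i.val ≤ a.j.val := a.le
    exact H (a.j.val - a.i.val) a (by omega)
  intro d
  induction d with
  | zero =>
    rintro ⟨i, j, le, v⟩ h
    obtain rfl : i = j := Fin.ext (by simpa using h.symm)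
    have : (⟨i, i, le, v⟩ : PathCell A) = PathCell.obj i :=
      PathCell.ext' rfl rfl fun k h₁ h₂ _ _ => (PathCell.not_bounds h₁ h₂).elim
    rw [this]
    exact hobj i
  | succ d ih =>
    rintro ⟨i, j, le, v⟩ h
    replace h : j.val = i.val + (d + 1) := h
    have hj := j.isLt
    obtain ⟨k, rfl⟩ : ∃ k : Fin p, k.castSucc = i := ⟨⟨i.val, by omega⟩, rfl⟩
    have hkj : k.succ ≤ j := by
      change k.val + 1 ≤ j.val
      have : (k.castSucc).val = k.val := rfl
      omega
    let b : PathCell A := ⟨k.succ, j, hkj, fun l h₁ h₂ =>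
      v l ((Fin.castSucc_lt_succ (i := k)).le.trans h₁) h₂⟩
    have e := hcomp b (PathCell.single k (v k le_rfl hkj)) rfl
      (ih b (by
        change j.val = k.val + 1 + d
        have : (k.castSucc).val = k.val := rfl
        omega)) (hsingle _ _)
    have : (⟨k.castSucc, j, le, v⟩ : PathCell A) =
        (path A).comp 0 b (PathCell.single k (v k le_rfl hkj)) rfl := by
      refine PathCell.ext' rfl rfl fun l h₁ h₂ h₁' h₂' => ?_
      by_cases hl : l.succ ≤ k.succ
      · obtain rfl := PathCell.eq_of_single_bounds h₁ hl
        refine Eq.trans ?_ (dif_pos hl).symm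
        rfl
      · refine Eq.trans ?_ (dif_neg hl).symm
        rfl
    rw [this]
    exact e

/-- Two `ω`-functors out of `path A` agree if they agree on objects and on the hom-objects between
consecutive objects. -/
theorem path_hom_ext {D : OmegaCat} {F F' : Hom (path A) D}
    (hobj : ∀ i, F.map (PathCell.obj i) = F'.map (PathCell.obj i))
    (hsingle : ∀ k y, F.map (PathCell.single k y) = F'.map (PathCell.single k y)) : F = F' := by
  refine Hom.ext (funext fun a => ?_)
  refine PathCell.induction_on (S := fun a => F.map a = F'.map a) hobj hsingle ?_ a
  intro b a h hb ha
  rw [F.map_comp 0 b a h (F.map_comp_cond h), F'.map_comp 0 b a h (F'.map_comp_cond h)]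
  exact D.comp_congr 0 hb ha _ _

theorem pathMap_obj (g : Fin (p + 1) →o Fin (q + 1))
    (F : ∀ (l : Fin q) (k : Fin p), wedge g (mid l) = mid k → Hom (A k) (B l)) (i : Fin (p + 1)) :
    (pathMap g F).map (PathCell.obj i) = PathCell.obj (g i) :=
  PathCell.ext' rfl rfl fun _ h₁ h₂ _ _ => (PathCell.not_bounds h₁ h₂).elim

theorem pathMap_single_val (g : Fin (p + 1) →o Fin (q + 1))
    (F : ∀ (l : Fin q) (k : Fin p), wedge g (mid l) = mid k → Hom (A k) (B l)) (l : Fin q)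
    (k : Fin p) (e : wedge g (mid l) = mid k) (y : (A k).Cell) (h₁ h₂) :
    ((pathMap g F).map (PathCell.single k y)).val l h₁ h₂ = (F l k e).map y :=
  pathMapCell_val g F (PathCell.single k y) l k e h₁ h₂ le_rfl le_rfl

theorem pathMap_ordinal_injective {g g' : Fin (p + 1) →o Fin (q + 1)}
    {F : ∀ (l : Fin q) (k : Fin p), wedge g (mid l) = mid k → Hom (A k) (B l)}
    {F' : ∀ (l : Fin q) (k : Fin p), wedge g' (mid l) = mid k → Hom (A k) (B l)}
    (h : pathMap g F = pathMap g' F') : g = g' := by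
  refine OrderHom.ext _ _ (funext fun i => ?_)
  exact congrArg PathCell.i (Hom.map_congr_eq h (PathCell.obj i))

theorem pathMap_component_injective {g : Fin (p + 1) →o Fin (q + 1)}
    {F F' : ∀ (l : Fin q) (k : Fin p), wedge g (mid l) = mid k → Hom (A k) (B l)}
    (h : pathMap g F = pathMap g F') (l : Fin q) (k : Fin p) (e : wedge g (mid l) = mid k) :
    F l k e = F' l k e := by
  refine Hom.ext (funext fun y => ?_)
  have h₁ : g k.castSucc ≤ l.castSucc := (le_castSucc_iff_of_wedge e _).1 le_rfl
  have h₂ : l.succ ≤ g k.succ := (succ_le_iff_of_wedge e _).1 le_rfl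
  rw [← pathMap_single_val g F l k e y h₁ h₂, ← pathMap_single_val g F' l k e y h₁ h₂]
  exact PathCell.val_congr (Hom.map_congr_eq h _) _ _ _ _ _

/-- Every `ω`-functor `path A ⟶ path B` is a `pathMap`, provided that the hom-objects `A k` are
non-empty: non-emptiness makes the map on objects monotone. -/
theorem pathMap_surjective (hA : ∀ k, Nonempty (A k).Cell) (F : Hom (path A) (path B)) :
    ∃ (g : Fin (p + 1) →o Fin (q + 1))
      (G : ∀ (l : Fin q) (k : Fin p), wedge g (mid l) = mid k → Hom (A k) (B l)),
      F = pathMap g G := by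
  -- objects are the cells which are their own `0`-source, so that `F` preserves them
  let g₀ : Fin (p + 1) → Fin (q + 1) := fun i => (F.map (PathCell.obj i)).i
  have hobj : ∀ i, F.map (PathCell.obj i) = PathCell.obj (g₀ i) := fun i =>
    F.map_src 0 (PathCell.obj i)
  have hi : ∀ k y, (F.map (PathCell.single k y)).i = g₀ k.castSucc := fun k y => by
    have h := F.map_src 0 (PathCell.single k y)
    exact (congrArg PathCell.i h).symm
  have hj : ∀ k y, (F.map (PathCell.single k y)).j = g₀ k.succ := fun k y => by
    have h := F.map_tgt 0 (PathCell.single k y)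
    exact (congrArg PathCell.i h).symm
  let g : Fin (p + 1) →o Fin (q + 1) := ⟨g₀, Fin.monotone_iff_le_succ.2 fun k => by
    obtain ⟨y⟩ := hA k
    rw [← hi k y, ← hj k y]
    exact PathCell.le _⟩
  have hb : ∀ {l : Fin q} {k : Fin p}, wedge g (mid l) = mid k → ∀ y : (A k).Cell,
      (F.map (PathCell.single k y)).i ≤ l.castSucc ∧ l.succ ≤ (F.map (PathCell.single k y)).j :=
    fun {l k} e y => ⟨(hi k y).le.trans ((le_castSucc_iff_of_wedge e _).1 le_rfl),
      ((succ_le_iff_of_wedge e _).1 le_rfl).trans (hj k y).ge⟩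
  -- the component at `l` is read off from the image of the cells from `k` to `k + 1`
  let G : ∀ (l : Fin q) (k : Fin p), wedge g (mid l) = mid k → Hom (A k) (B l) := fun l k e =>
    { map := fun y => (F.map (PathCell.single k y)).val l (hb e y).1 (hb e y).2
      map_src := fun n y => by
        have h := (congrArg F.map (PathCell.src_single n k y)).symm.trans
          (F.map_src (n + 1) (PathCell.single k y))
        exact PathCell.val_congr h l _ _ (hb e y).1 (hb e y).2
      map_tgt := fun n y => by
        have h := (congrArg F.map (PathCell.tgt_single n k y)).symm.trans
          (F.map_tgt (n + 1) (PathCell.single k y))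
        exact PathCell.val_congr h l _ _ (hb e y).1 (hb e y).2
      map_comp := fun n y x h h' => by
        have h₀ : (path A).src (n + 1) (PathCell.single k y) =
            (path A).tgt (n + 1) (PathCell.single k x) := by
          rw [PathCell.src_single, PathCell.tgt_single, h]
        have h₁ := (congrArg F.map (PathCell.comp_single n k y x h₀ h)).symm.trans
          (F.map_comp (n + 1) _ _ h₀ (F.map_comp_cond h₀))
        exact PathCell.val_congr h₁ l _ _ (hb e x).1 (hb e x).2 }
  refine ⟨g, G, path_hom_ext (fun i => (hobj i).trans (pathMap_obj g G i).symm) fun k y => ?_⟩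
  refine PathCell.ext' (hi k y) (hj k y) fun l h₁ h₂ h₁' h₂' => ?_
  have e : wedge g (mid l) = mid k := by
    rw [wedge_fiber g l _ _ h₁' h₂']
    congr 1
    exact (PathCell.eq_of_single_bounds
      ((le_castSucc_iff_of_wedge (wedge_fiber g l _ _ h₁' h₂') k.castSucc).2 h₁')
      ((succ_le_iff_of_wedge (wedge_fiber g l _ _ h₁' h₂') k.succ).2 h₂')).symm
  exact (pathMap_single_val g G l k e y h₁' h₂').symm

end PathFunctors

end OmegaCat

/-- An element of `[p + 1]` is an end point or of the form `mid k`. -/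
theorem eq_endpoint_or_mid {p : ℕ} (j : Fin (p + 2)) :
    (j = 0 ∨ j = Fin.last (p + 1)) ∨ ∃ k : Fin p, j = mid k := by
  by_cases h : j = 0 ∨ j = Fin.last (p + 1)
  · exact Or.inl h
  · rw [not_or, Fin.ext_iff, Fin.ext_iff] at h
    have h0 : j.val ≠ 0 := h.1
    have h1 : j.val ≠ p + 1 := h.2
    have := j.isLt
    exact Or.inr ⟨⟨j.val - 1, by omega⟩, Fin.ext (by change j.val = j.val - 1 + 1; omega)⟩

theorem wedge_endpoint {p q : ℕ} (g : Fin (p + 1) →o Fin (q + 1)) {j : Fin (q + 2)}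
    (h : j = 0 ∨ j = Fin.last (q + 1)) : wedge g j = 0 ∨ wedge g j = Fin.last (p + 1) := by
  rcases h with rfl | rfl
  · exact Or.inl (le_antisymm ((wedge_le_iff g _ _).2 (Fin.zero_le _)) (Fin.zero_le _))
  · refine Or.inr (le_antisymm (Fin.le_last _) ?_)
    have h := (wedge_le_iff g (Fin.last (q + 1)) (wedge g (Fin.last (q + 1)))).1 le_rfl
    by_contra hne
    obtain ⟨i, hi⟩ : ∃ i : Fin (p + 1), i.castSucc = wedge g (Fin.last (q + 1)) :=
      ⟨(wedge g (Fin.last (q + 1))).castPred fun e => hne e.ge, Fin.castSucc_castPred _ _⟩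
    rw [← hi] at h
    simp only [addTop, Fin.lastCases_castSucc] at h
    exact absurd h (not_le.2 (Fin.castSucc_lt_last _))

theorem Tree.Hom.eq_of_dom_triv {H K : Tree} (hH : H = .triv) (f f' : Tree.Hom H K) : f = f' := by
  subst hH
  cases f
  cases f'
  rfl

theorem psiObj_nonempty {H : Tree} (h : H ≠ .triv) : Nonempty (psiObj H).Cell := by
  cases H with
  | triv => exact absurd rfl h
  | node p c => exact ⟨OmegaCat.PathCell.obj 0⟩

theorem psiCast_injective {H H' : Tree} {C : OmegaCat} (h : H = H')
    {F F' : OmegaCat.Hom (psiObj H) C} (e : psiCast h F = psiCast h F') : F = F' := by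
  subst h
  exact e

theorem Tree.IsObj.child_mid_ne_triv {p : ℕ} {c : Fin (p + 2) → Tree} (h : (Tree.node p c).IsObj)
    (k : Fin p) : c (mid k) ≠ .triv := fun e => mid_ne_endpoint k ((h.1 _).1 e)

theorem Tree.IsObj.child_wedge_eq_triv {p q : ℕ} {c : Fin (p + 2) → Tree}
    (h : (Tree.node p c).IsObj) (g : Fin (p + 1) →o Fin (q + 1)) {j : Fin (q + 2)}
    (hj : j = 0 ∨ j = Fin.last (q + 1)) : c (wedge g j) = .triv :=
  (h.1 _).2 (wedge_endpoint g hj)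

/-- `Ψ` is faithful on the objects of `iΔ₊`: the components of a morphism at the elements `j` which are
not visible in the `ω`-functor have trivial domain. -/
theorem psiMap_injective {H K : Tree} (hH : H.IsObj) :
    Function.Injective (psiMap : Tree.Hom H K → _) := by
  intro f f' h
  induction f with
  | init K => exact Tree.Hom.eq_of_dom_triv rfl _ _
  | @node p q c d g sub ih =>
    cases f' with
    | node g' sub' =>
      obtain rfl : g = g' := OmegaCat.pathMap_ordinal_injective h
      congr 1
      funext j
      rcases eq_endpoint_or_mid j with hj | ⟨l, rfl⟩
      · exact Tree.Hom.eq_of_dom_triv (hH.child_wedge_eq_triv g hj) _ _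
      · rcases eq_endpoint_or_mid (wedge g (mid l)) with hw | ⟨k, e⟩
        · exact Tree.Hom.eq_of_dom_triv ((hH.1 _).2 hw) _ _
        · refine ih (mid l) (hH.2 _) ?_
          exact psiCast_injective (congrArg c e) (OmegaCat.pathMap_component_injective h l k e)

/-- `Ψ` is full on the objects of `iΔ₊`. -/
theorem psiMap_surjective {H K : Tree} (hH : H.IsObj) :
    Function.Surjective (psiMap : Tree.Hom H K → _) := by
  intro F
  induction K generalizing H with
  | triv =>
    cases H with
    | triv => exact ⟨.init _, OmegaCat.Hom.ext (funext fun a => a.elim)⟩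
    | node p c => exact (F.map (OmegaCat.PathCell.obj 0)).elim
  | node q d ih =>
    cases H with
    | triv => exact ⟨.init _, OmegaCat.Hom.ext (funext fun a => a.elim)⟩
    | node p c =>
      obtain ⟨g, G, hG⟩ := OmegaCat.pathMap_surjective
        (fun k => psiObj_nonempty (hH.child_mid_ne_triv k)) F
      -- heterogeneous equality, because the codomains agree only after `j = mid l` is substituted
      have h : ∀ j, ∃ s : Tree.Hom (c (wedge g j)) (d j), ∀ (l : Fin q) (k : Fin p), j = mid l →
          ∀ (e : wedge g (mid l) = mid k) (e' : wedge g j = mid k),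
          HEq (G l k e) (psiCast (congrArg c e') (psiMap s)) := by
        intro j
        rcases eq_endpoint_or_mid (wedge g j) with hw | ⟨k, e⟩
        · have ht : c (wedge g j) = .triv := (hH.1 _).2 hw
          exact ⟨(Tree.Hom.init _).castDom ht.symm, fun l k _ _ e' =>
            absurd (e' ▸ hw) (mid_ne_endpoint k)⟩
        · rcases eq_endpoint_or_mid j with hj | ⟨l, rfl⟩
          · exact absurd (e ▸ wedge_endpoint g hj) (mid_ne_endpoint k)
          · obtain ⟨s, hs⟩ := ih (mid l) (hH.2 (wedge g (mid l)))
              (psiCast (congrArg c e.symm) (G l k e))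
            refine ⟨s, fun l' k' hl e₁ e₂ => ?_⟩
            obtain rfl := mid_injective hl
            obtain rfl : k = k' := mid_injective (e.symm.trans e₁)
            refine heq_of_eq ?_
            rw [hs, psiCast_psiCast]
            rfl
      choose s hs using h
      refine ⟨.node g s, hG.symm ▸ ?_⟩
      change OmegaCat.pathMap g _ = OmegaCat.pathMap g _
      congr 1
      funext l k e
      exact (eq_of_heq (hs (mid l) l k rfl e e)).symm

instance psi_faithful : psi.Faithful where
  map_injective {H _} _ _ h := ObjectProperty.hom_ext _ (psiMap_injective H.property h)

instance psi_full : psi.Full where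
  map_surjective {H _} F := by
    obtain ⟨f, hf⟩ := psiMap_surjective H.property F
    exact ⟨ObjectProperty.homMk f, hf⟩

instance psiNontrivial_faithful : psiNontrivial.Faithful :=
  inferInstanceAs (ObjectProperty.ι _ ⋙ psi).Faithful

instance psiNontrivial_full : psiNontrivial.Full :=
  inferInstanceAs (ObjectProperty.ι _ ⋙ psi).Full

/-! ### Labelled pasting trees -/

/-- Trees with labels in `V`, describing pasting diagrams: `pt x` is the vertex `x`, and `cons x c w`
is the walk whose first vertex is `x`, whose first edge is the pasting diagram `c` one dimension up,
and whose remaining part is the walk `w`. -/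
inductive PasteTree (V : Type) : Type
  | pt (x : V) : PasteTree V
  | cons (x : V) (c w : PasteTree V) : PasteTree V

namespace PasteTree

variable {V W : Type}

/-- The first vertex of a walk. -/
def head : PasteTree V → V
  | pt x => x
  | cons x _ _ => x

/-- The last vertex of a walk. -/
def last : PasteTree V → V
  | pt x => x
  | cons _ _ w => w.last

/-- The `n`-source: truncation at height `n`, keeping the first vertices. -/
def src : ℕ → PasteTree V → PasteTree V
  | 0, t => pt t.head
  | _ + 1, pt x => pt x
  | n + 1, cons x c w => cons x (src n c) (src (n + 1) w)

/-- The `n`-target: truncation at height `n`, keeping the last vertices. -/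
def tgt : ℕ → PasteTree V → PasteTree V
  | 0, t => pt t.last
  | _ + 1, pt x => pt x
  | n + 1, cons x c w => cons x (tgt n c) (tgt (n + 1) w)

/-- `comp n b a` is the composite of `a` followed by `b` along dimension `n`: concatenation of walks
if `n = 0`, and edgewise composition otherwise. It is only meaningful if `src n b = tgt n a`. -/
def comp : ℕ → PasteTree V → PasteTree V → PasteTree V
  | 0, b, pt _ => b
  | 0, b, cons x c w => cons x c (comp 0 b w)
  | _ + 1, _, pt x => pt x
  | n + 1, cons _ d v, cons x c w => cons x (comp n d c) (comp (n + 1) v w)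
  -- a junk value: the walks have different lengths, hence are not composable
  | _ + 1, pt _, cons x c w => cons x c w

/-- Relabelling of a tree. -/
def map (f : V → W) : PasteTree V → PasteTree W
  | pt x => pt (f x)
  | cons x c w => cons (f x) (c.map f) (w.map f)

@[simp] theorem head_pt (x : V) : (pt x).head = x := rfl
@[simp] theorem head_cons (x : V) (c w) : (cons x c w).head = x := rfl
@[simp] theorem last_pt (x : V) : (pt x).last = x := rfl
@[simp] theorem last_cons (x : V) (c w) : (cons x c w).last = w.last := rfl
@[simp] theorem src_zero (t : PasteTree V) : src 0 t = pt t.head := by cases t <;> simp [src]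
@[simp] theorem tgt_zero (t : PasteTree V) : tgt 0 t = pt t.last := by cases t <;> simp [tgt]
@[simp] theorem src_pt (n : ℕ) (x : V) : src n (pt x) = pt x := by cases n <;> simp [src]
@[simp] theorem tgt_pt (n : ℕ) (x : V) : tgt n (pt x) = pt x := by cases n <;> simp [tgt]
@[simp] theorem src_cons (n : ℕ) (x : V) (c w) :
    src (n + 1) (cons x c w) = cons x (src n c) (src (n + 1) w) := by simp [src]
@[simp] theorem tgt_cons (n : ℕ) (x : V) (c w) :
    tgt (n + 1) (cons x c w) = cons x (tgt n c) (tgt (n + 1) w) := by simp [tgt]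
@[simp] theorem comp_zero_pt (b : PasteTree V) (x : V) : comp 0 b (pt x) = b := by
  cases b <;> simp [comp]
@[simp] theorem comp_zero_cons (b : PasteTree V) (x : V) (c w) :
    comp 0 b (cons x c w) = cons x c (comp 0 b w) := by cases b <;> simp [comp]
@[simp] theorem comp_succ_pt (n : ℕ) (b : PasteTree V) (x : V) : comp (n + 1) b (pt x) = pt x := by
  cases b <;> simp [comp]
@[simp] theorem comp_succ_cons (n : ℕ) (y x : V) (d v c w) :
    comp (n + 1) (cons y d v) (cons x c w) = cons x (comp n d c) (comp (n + 1) v w) := by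
  simp [comp]

@[simp] theorem head_src (n : ℕ) (t : PasteTree V) : (src n t).head = t.head := by
  cases n <;> cases t <;> simp
@[simp] theorem last_src_succ (n : ℕ) (t : PasteTree V) : (src (n + 1) t).last = t.last := by
  induction t with
  | pt x => simp
  | cons x c w _ ih => simp [ih]

@[simp] theorem head_tgt_succ (n : ℕ) (t : PasteTree V) : (tgt (n + 1) t).head = t.head := by
  cases t <;> simp
@[simp] theorem last_tgt (n : ℕ) (t : PasteTree V) : (tgt n t).last = t.last := by
  induction t generalizing n with
  | pt x => simp
  | cons x c w _ ih => cases n <;> simp [ih]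

@[simp] theorem head_comp_succ (n : ℕ) (b a : PasteTree V) :
    (comp (n + 1) b a).head = a.head := by
  cases a <;> cases b <;> simp [comp]

theorem head_comp_zero {b a : PasteTree V} (h : b.head = a.last) :
    (comp 0 b a).head = a.head := by
  cases a <;> simp_all

theorem last_comp_zero (b a : PasteTree V) : (comp 0 b a).last = b.last := by
  induction a with
  | pt x => simp
  | cons x c w _ ih => simp [ih]

theorem src_src (n : ℕ) (t : PasteTree V) : src n (src n t) = src n t := by
  induction t generalizing n with
  | pt x => simp
  | cons x c w ih ih' => cases n <;> simp [ih, ih']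

theorem tgt_src (n : ℕ) (t : PasteTree V) : tgt n (src n t) = src n t := by
  induction t generalizing n with
  | pt x => simp
  | cons x c w ih ih' => cases n <;> simp [ih, ih']

theorem src_tgt (n : ℕ) (t : PasteTree V) : src n (tgt n t) = tgt n t := by
  induction t generalizing n with
  | pt x => simp
  | cons x c w ih ih' => cases n <;> simp [ih, ih']

theorem tgt_tgt (n : ℕ) (t : PasteTree V) : tgt n (tgt n t) = tgt n t := by
  induction t generalizing n with
  | pt x => simp
  | cons x c w ih ih' => cases n <;> simp [ih, ih']

/-! The laws of `ω`-categories hold for trees with arbitrary labels, by induction on the first cell. -/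

theorem src_comp {n : ℕ} {b a : PasteTree V} (h : src n b = tgt n a) :
    src n (comp n b a) = src n a := by
  induction a generalizing n b with
  | pt x => cases n <;> simp_all
  | cons x c w ih ih' =>
    cases n with
    | zero => simp
    | succ n =>
      cases b with
      | pt y => simp at h
      | cons y d v =>
        simp only [src_cons, tgt_cons, cons.injEq] at h
        simp [ih h.2.1, ih' h.2.2]

theorem tgt_comp {n : ℕ} {b a : PasteTree V} (h : src n b = tgt n a) :
    tgt n (comp n b a) = tgt n b := by
  induction a generalizing n b with
  | pt x =>
    cases n with
    | zero => simp
    | succ n => cases b <;> simp_all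
  | cons x c w ih ih' =>
    cases n with
    | zero => simp [last_comp_zero]
    | succ n =>
      cases b with
      | pt y => simp at h
      | cons y d v =>
        simp only [src_cons, tgt_cons, cons.injEq] at h
        simp [ih h.2.1, ih' h.2.2, h.1]

theorem comp_src (n : ℕ) (a : PasteTree V) : comp n a (src n a) = a := by
  induction a generalizing n with
  | pt x => cases n <;> simp
  | cons x c w ih ih' => cases n <;> simp [ih, ih']

theorem tgt_comp_self (n : ℕ) (a : PasteTree V) : comp n (tgt n a) a = a := by
  induction a generalizing n with
  | pt x => cases n <;> simp
  | cons x c w ih ih' =>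
    cases n with
    | zero => simpa using ih' 0
    | succ n => simp [ih, ih']

theorem assoc {n : ℕ} {c b a : PasteTree V} (h : src n c = tgt n b) (h' : src n b = tgt n a) :
    comp n (comp n c b) a = comp n c (comp n b a) := by
  induction a generalizing n b c with
  | pt x => cases n <;> simp
  | cons x c₁ w ih ih' =>
    cases n with
    | zero =>
      rw [src_zero, tgt_zero, pt.injEq] at h h'
      simp only [comp_zero_cons, cons.injEq, true_and]
      exact ih' (n := 0) (by simpa using h) (by simpa using h')
    | succ n =>
      cases b with
      | pt y => simp at h'
      | cons y d v =>
        cases c with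
        | pt z => simp at h
        | cons z e u =>
          simp only [src_cons, tgt_cons, cons.injEq] at h h'
          simp [ih h.2.1 h'.2.1, ih' h.2.2 h'.2.2]

theorem src_src_lt {m n : ℕ} (t : PasteTree V) (h : m < n) : src n (src m t) = src m t := by
  induction t generalizing m n with
  | pt x => simp
  | cons x c w ih ih' =>
    obtain ⟨n, rfl⟩ := Nat.exists_eq_succ_of_ne_zero (Nat.ne_zero_of_lt h)
    cases m with
    | zero => simp
    | succ m => simp [ih (Nat.lt_of_succ_lt_succ h), ih' h]

theorem src_tgt_lt {m n : ℕ} (t : PasteTree V) (h : m < n) : src n (tgt m t) = tgt m t := by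
  induction t generalizing m n with
  | pt x => simp
  | cons x c w ih ih' =>
    obtain ⟨n, rfl⟩ := Nat.exists_eq_succ_of_ne_zero (Nat.ne_zero_of_lt h)
    cases m with
    | zero => simp
    | succ m => simp [ih (Nat.lt_of_succ_lt_succ h), ih' h]

theorem lt_src_src {m n : ℕ} (t : PasteTree V) (h : m < n) : src m (src n t) = src m t := by
  induction t generalizing m n with
  | pt x => simp
  | cons x c w ih ih' =>
    obtain ⟨n, rfl⟩ := Nat.exists_eq_succ_of_ne_zero (Nat.ne_zero_of_lt h)
    cases m with
    | zero => simp
    | succ m => simp [ih (Nat.lt_of_succ_lt_succ h), ih' h]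

theorem lt_src_tgt {m n : ℕ} (t : PasteTree V) (h : m < n) : src m (tgt n t) = src m t := by
  induction t generalizing m n with
  | pt x => simp
  | cons x c w ih ih' =>
    obtain ⟨n, rfl⟩ := Nat.exists_eq_succ_of_ne_zero (Nat.ne_zero_of_lt h)
    cases m with
    | zero => simp
    | succ m => simp [ih (Nat.lt_of_succ_lt_succ h), ih' h]

theorem lt_tgt_src {m n : ℕ} (t : PasteTree V) (h : m < n) : tgt m (src n t) = tgt m t := by
  induction t generalizing m n with
  | pt x => simp
  | cons x c w ih ih' =>
    obtain ⟨n, rfl⟩ := Nat.exists_eq_succ_of_ne_zero (Nat.ne_zero_of_lt h)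
    cases m with
    | zero => simp
    | succ m => simp [ih (Nat.lt_of_succ_lt_succ h), ih' h]

theorem lt_tgt_tgt {m n : ℕ} (t : PasteTree V) (h : m < n) : tgt m (tgt n t) = tgt m t := by
  induction t generalizing m n with
  | pt x => simp
  | cons x c w ih ih' =>
    obtain ⟨n, rfl⟩ := Nat.exists_eq_succ_of_ne_zero (Nat.ne_zero_of_lt h)
    cases m with
    | zero => simp
    | succ m => simp [ih (Nat.lt_of_succ_lt_succ h), ih' h]

theorem src_comp_lt {m n : ℕ} {b a : PasteTree V} (h : src m b = tgt m a) (hlt : m < n) :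
    src n (comp m b a) = comp m (src n b) (src n a) := by
  obtain ⟨n, rfl⟩ := Nat.exists_eq_succ_of_ne_zero (Nat.ne_zero_of_lt hlt)
  induction a generalizing m n b with
  | pt x => cases m <;> simp
  | cons x c w ih ih' =>
    cases m with
    | zero => simpa using ih' (m := 0) (b := b) (by simpa using h) n hlt
    | succ m =>
      obtain ⟨n, rfl⟩ := Nat.exists_eq_succ_of_ne_zero (Nat.ne_zero_of_lt (Nat.lt_of_succ_lt_succ hlt))
      cases b with
      | pt y => simp at h
      | cons y d v =>
        simp only [src_cons, tgt_cons, cons.injEq] at h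
        simp [ih h.2.1 n (Nat.lt_of_succ_lt_succ hlt), ih' h.2.2 (n + 1) hlt]

theorem tgt_comp_lt {m n : ℕ} {b a : PasteTree V} (h : src m b = tgt m a) (hlt : m < n) :
    tgt n (comp m b a) = comp m (tgt n b) (tgt n a) := by
  obtain ⟨n, rfl⟩ := Nat.exists_eq_succ_of_ne_zero (Nat.ne_zero_of_lt hlt)
  induction a generalizing m n b with
  | pt x => cases m <;> simp
  | cons x c w ih ih' =>
    cases m with
    | zero => simpa using ih' (m := 0) (b := b) (by simpa using h) n hlt
    | succ m =>
      obtain ⟨n, rfl⟩ := Nat.exists_eq_succ_of_ne_zero (Nat.ne_zero_of_lt (Nat.lt_of_succ_lt_succ hlt))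
      cases b with
      | pt y => simp at h
      | cons y d v =>
        simp only [src_cons, tgt_cons, cons.injEq] at h
        simp [ih h.2.1 n (Nat.lt_of_succ_lt_succ hlt), ih' h.2.2 (n + 1) hlt]

theorem interchange {m n : ℕ} {b' b a' a : PasteTree V} (h₁ : src n b' = tgt n b)
    (h₂ : src n a' = tgt n a) (h₄ : src m b' = tgt m a') (h₅ : src m b = tgt m a) (hlt : m < n) :
    comp m (comp n b' b) (comp n a' a) = comp n (comp m b' a') (comp m b a) := by
  obtain ⟨n, rfl⟩ := Nat.exists_eq_succ_of_ne_zero (Nat.ne_zero_of_lt hlt)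
  induction a generalizing m n b a' b' with
  | pt x =>
    cases a' with
    | pt y => cases m <;> simp
    | cons y d v => simp at h₂
  | cons x c w ih ih' =>
    cases a' with
    | pt y => simp at h₂
    | cons y c' w' =>
      cases m with
      | zero =>
        simp only [src_cons, tgt_cons, cons.injEq] at h₂
        simpa using ih' (m := 0) (by simpa using h₄) (by simpa using h₅) n h₁ h₂.2.2 hlt
      | succ m =>
        obtain ⟨n, rfl⟩ :=
          Nat.exists_eq_succ_of_ne_zero (Nat.ne_zero_of_lt (Nat.lt_of_succ_lt_succ hlt))
        cases b with
        | pt z => simp at h₅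
        | cons z d v =>
          cases b' with
          | pt z => simp at h₄
          | cons z' d' v' =>
            simp only [src_cons, tgt_cons, cons.injEq] at h₁ h₂ h₄ h₅
            simp [ih h₄.2.1 h₅.2.1 n h₁.2.1 h₂.2.1 (Nat.lt_of_succ_lt_succ hlt),
              ih' h₄.2.2 h₅.2.2 (n + 1) h₁.2.2 h₂.2.2 hlt]

theorem src_of_le {m n : ℕ} {t : PasteTree V} (h : src m t = t) (hmn : m ≤ n) : src n t = t := by
  rcases hmn.eq_or_lt with rfl | hlt
  · exact h
  · rw [← h, src_src_lt _ hlt]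

theorem exists_dim (t : PasteTree V) : ∃ n, src n t = t := by
  induction t with
  | pt x => exact ⟨0, by simp⟩
  | cons x c w ih ih' =>
    obtain ⟨n, hn⟩ := ih
    obtain ⟨m, hm⟩ := ih'
    refine ⟨max n m + 1, ?_⟩
    rw [src_cons, src_of_le hn (le_max_left n m),
      src_of_le hm ((le_max_right n m).trans (Nat.le_succ _))]

@[simp] theorem head_map (f : V → W) (t : PasteTree V) : (t.map f).head = f t.head := by
  cases t <;> rfl

@[simp] theorem last_map (f : V → W) (t : PasteTree V) : (t.map f).last = f t.last := by
  induction t with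
  | pt x => rfl
  | cons x c w _ ih => exact ih

theorem map_src (f : V → W) (n : ℕ) (t : PasteTree V) : (src n t).map f = src n (t.map f) := by
  induction t generalizing n with
  | pt x => simp [map]
  | cons x c w ih ih' => cases n <;> simp [map, ih, ih']

theorem map_tgt (f : V → W) (n : ℕ) (t : PasteTree V) : (tgt n t).map f = tgt n (t.map f) := by
  induction t generalizing n with
  | pt x => simp [map]
  | cons x c w ih ih' => cases n <;> simp [map, ih, ih']

theorem map_comp (f : V → W) (n : ℕ) (b a : PasteTree V) :
    (comp n b a).map f = comp n (b.map f) (a.map f) := by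
  induction a generalizing n b with
  | pt x => cases n <;> simp [map]
  | cons x c w ih ih' =>
    cases n with
    | zero => simp [map, ih']
    | succ n =>
      cases b with
      | pt y => simp [map, comp]
      | cons y d v => simp [map, ih, ih']

/-! ### Well-formed trees -/

/-- Well-formed trees. Here `E x v y` says that `v` is an edge from `x` to `y`, and `P` is the
collection of the labels which are allowed as vertices of the walk; the vertices of the edge of the
walk from `x` to `y` have to be edges from `x` to `y`. -/
def WF (E : V → V → V → Prop) : (V → Prop) → PasteTree V → Prop
  | P, pt x => P x
  | P, cons x c w => P x ∧ WF E (fun v => E x v w.head) c ∧ WF E P w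

variable {E : V → V → V → Prop} {P : V → Prop}

theorem WF.head {t : PasteTree V} (h : WF E P t) : P t.head := by
  cases t with
  | pt x => exact h
  | cons x c w => exact h.1

theorem WF.last {t : PasteTree V} (h : WF E P t) : P t.last := by
  induction t with
  | pt x => exact h
  | cons x c w _ ih => exact ih h.2.2

theorem WF.src {t : PasteTree V} (h : WF E P t) (n : ℕ) : WF E P (src n t) := by
  induction t generalizing n P with
  | pt x => simpa using h
  | cons x c w ih ih' =>
    cases n with
    | zero => exact h.1
    | succ n =>
      rw [src_cons]
      refine ⟨h.1, ?_, ih' h.2.2 _⟩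
      rw [head_src]
      exact ih h.2.1 n

theorem WF.tgt {t : PasteTree V} (h : WF E P t) (n : ℕ) : WF E P (tgt n t) := by
  induction t generalizing n P with
  | pt x => simpa using h
  | cons x c w ih ih' =>
    cases n with
    | zero => rw [tgt_zero]; exact h.last
    | succ n =>
      rw [tgt_cons]
      refine ⟨h.1, ?_, ih' h.2.2 _⟩
      rw [head_tgt_succ]
      exact ih h.2.1 n

theorem WF.comp {b a : PasteTree V} (hb : WF E P b) (ha : WF E P a) {n : ℕ}
    (h : PasteTree.src n b = PasteTree.tgt n a) : WF E P (comp n b a) := by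
  induction a generalizing n P b with
  | pt x =>
    cases n with
    | zero => simpa using hb
    | succ n => simpa using ha
  | cons x c w ih ih' =>
    cases n with
    | zero =>
      rw [src_zero, tgt_zero, pt.injEq] at h
      rw [comp_zero_cons]
      refine ⟨ha.1, ?_, ih' hb ha.2.2 (by simpa using h)⟩
      rw [head_comp_zero (by simpa using h)]
      exact ha.2.1
    | succ n =>
      cases b with
      | pt y => simp at h
      | cons y d v =>
        simp only [src_cons, tgt_cons, cons.injEq] at h
        rw [comp_succ_cons]
        have hv : v.head = w.head := by
          have := congrArg PasteTree.head h.2.2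
          simpa using this
        refine ⟨ha.1, ?_, ih' hb.2.2 ha.2.2 h.2.2⟩
        rw [head_comp_succ]
        refine ih ?_ ha.2.1 h.2.1
        rw [← h.1, ← hv]
        exact hb.2.1

theorem WF.map {E' : W → W → W → Prop} {P' : W → Prop} {f : V → W}
    (hE : ∀ x v y, E x v y → E' (f x) (f v) (f y)) {t : PasteTree V} (h : WF E P t)
    (hP : ∀ v, P v → P' (f v)) : WF E' P' (t.map f) := by
  induction t generalizing P P' with
  | pt x => exact hP _ h
  | cons x c w ih ih' =>
    refine ⟨hP _ h.1, ?_, ih' h.2.2 hP⟩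
    rw [head_map]
    exact ih h.2.1 fun v hv => hE _ _ _ hv

theorem WF.of_map {E' : W → W → W → Prop} {P' : W → Prop} {f : V → W}
    (hE : ∀ x v y, E' (f x) (f v) (f y) → E x v y) {t : PasteTree V} (h : WF E' P' (t.map f))
    (hP : ∀ v, P' (f v) → P v) : WF E P t := by
  induction t generalizing P P' with
  | pt x => exact hP _ h
  | cons x c w ih ih' =>
    refine ⟨hP _ h.1, ?_, ih' h.2.2 hP⟩
    have := h.2.1
    rw [head_map] at this
    exact ih this fun v hv => hE _ _ _ hv

end PasteTree

/-! ### The free `ω`-category on a globular set -/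

namespace GlobularSet

/-- `X.Edge x v y` says that the vertex `v` has positive dimension, source `x` and target `y`. -/
inductive Edge (X : GlobularSet) : X.Vertex → X.Vertex → X.Vertex → Prop
  | mk {n : ℕ} (z : X.cell (n + 1)) : Edge X ⟨n, X.src z⟩ ⟨n + 1, z⟩ ⟨n, X.tgt z⟩

variable {X : GlobularSet}

theorem Edge.dim {x v y : X.Vertex} (h : X.Edge x v y) : v.1 = x.1 + 1 := by
  cases h; rfl

theorem Edge.dim_tgt {x v y : X.Vertex} (h : X.Edge x v y) : v.1 = y.1 + 1 := by
  cases h; rfl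

theorem Edge.unique {x v y x' y' : X.Vertex} (h : X.Edge x v y) (h' : X.Edge x' v y') :
    x = x' ∧ y = y' := by
  cases h; cases h'; exact ⟨rfl, rfl⟩

/-- Source and target of a vertex are parallel. -/
theorem Edge.parallel {a b x v y : X.Vertex} (h : X.Edge x v y) :
    X.Edge a x b ↔ X.Edge a y b := by
  cases h with
  | @mk n z =>
    cases n with
    | zero => exact ⟨fun h => (by have := h.dim; simp at this), fun h => (by have := h.dim; simp at this)⟩
    | succ n =>
      constructor
      · intro h
        obtain ⟨rfl, rfl⟩ := h.unique (Edge.mk (X.src z))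
        rw [X.src_src, X.tgt_src]
        exact Edge.mk _
      · intro h
        obtain ⟨rfl, rfl⟩ := h.unique (Edge.mk (X.tgt z))
        rw [← X.src_src, ← X.tgt_src]
        exact Edge.mk _

/-- The map induced on vertices by a morphism of globular sets. -/
def Hom.vertex {X Y : GlobularSet} (m : X ⟶ Y) (v : X.Vertex) : Y.Vertex := ⟨v.1, m.app v.1 v.2⟩

theorem Edge.map {Y : GlobularSet} (m : X ⟶ Y) {x v y : X.Vertex} (h : X.Edge x v y) :
    Y.Edge (Hom.vertex m x) (Hom.vertex m v) (Hom.vertex m y) := by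
  cases h with
  | @mk n z =>
    have := Edge.mk (m.app (n + 1) z)
    rw [← m.app_src, ← m.app_tgt] at this
    exact this

end GlobularSet

open GlobularSet PasteTree

/-- The free strict `ω`-category on the globular set `X`: its cells are the pasting trees labelled in
`X`. -/
def freeCat (X : GlobularSet) : OmegaCat where
  Cell := {t : PasteTree X.Vertex // WF X.Edge (fun v => v.1 = 0) t}
  src n t := ⟨src n t.1, t.2.src n⟩
  tgt n t := ⟨tgt n t.1, t.2.tgt n⟩
  comp n b a h := ⟨comp n b.1 a.1, b.2.comp a.2 (Subtype.ext_iff.1 h)⟩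
  src_src n a := Subtype.ext (PasteTree.src_src n a.1)
  tgt_src n a := Subtype.ext (PasteTree.tgt_src n a.1)
  src_tgt n a := Subtype.ext (PasteTree.src_tgt n a.1)
  tgt_tgt n a := Subtype.ext (PasteTree.tgt_tgt n a.1)
  src_comp n b a h := Subtype.ext (PasteTree.src_comp (Subtype.ext_iff.1 h))
  tgt_comp n b a h := Subtype.ext (PasteTree.tgt_comp (Subtype.ext_iff.1 h))
  comp_src n a h := Subtype.ext (PasteTree.comp_src n a.1)
  tgt_comp_self n a h := Subtype.ext (PasteTree.tgt_comp_self n a.1)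
  assoc n c b a h₁ h₂ h₃ h₄ :=
    Subtype.ext (PasteTree.assoc (Subtype.ext_iff.1 h₁) (Subtype.ext_iff.1 h₃))
  src_src_lt m n a h := Subtype.ext (PasteTree.src_src_lt a.1 h)
  src_tgt_lt m n a h := Subtype.ext (PasteTree.src_tgt_lt a.1 h)
  lt_src_src m n a h := Subtype.ext (PasteTree.lt_src_src a.1 h)
  lt_src_tgt m n a h := Subtype.ext (PasteTree.lt_src_tgt a.1 h)
  lt_tgt_src m n a h := Subtype.ext (PasteTree.lt_tgt_src a.1 h)
  lt_tgt_tgt m n a h := Subtype.ext (PasteTree.lt_tgt_tgt a.1 h)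
  src_comp_lt m n b a h h' hlt := Subtype.ext (PasteTree.src_comp_lt (Subtype.ext_iff.1 h) hlt)
  tgt_comp_lt m n b a h h' hlt := Subtype.ext (PasteTree.tgt_comp_lt (Subtype.ext_iff.1 h) hlt)
  interchange m n b' b a' a h₁ h₂ h₃ h₄ h₅ h₆ hlt :=
    Subtype.ext (PasteTree.interchange (Subtype.ext_iff.1 h₁) (Subtype.ext_iff.1 h₂)
      (Subtype.ext_iff.1 h₄) (Subtype.ext_iff.1 h₅) hlt)
  exists_dim a := by
    obtain ⟨n, hn⟩ := PasteTree.exists_dim a.1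
    exact ⟨n, Subtype.ext hn⟩

section Globes

variable {X : GlobularSet}

/-- The labels which are allowed in the place of the vertex `z`: the vertices of dimension `n` which
are parallel to `z`. -/
def parallelTo : (n : ℕ) → X.cell n → X.Vertex → Prop
  | 0, _, v => v.1 = 0
  | n + 1, z, v => X.Edge ⟨n, X.src z⟩ v ⟨n, X.tgt z⟩

theorem parallelTo_self (n : ℕ) (z : X.cell n) : parallelTo n z ⟨n, z⟩ := by
  cases n with
  | zero => rfl
  | succ n => exact Edge.mk z

theorem parallelTo_dim {n : ℕ} {z : X.cell n} {v : X.Vertex} (h : parallelTo n z v) : v.1 = n := by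
  cases n with
  | zero => exact h
  | succ n => exact h.dim

theorem parallelTo_tgt {n : ℕ} (z : X.cell (n + 1)) :
    parallelTo n (X.src z) ⟨n, X.tgt z⟩ := by
  cases n with
  | zero => rfl
  | succ n => exact (Edge.mk z).parallel.1 (Edge.mk _)

/-- `wrap n z c` puts the tree `c` of `n`-cells parallel to `z` inside the boundary of the vertex `z`
of dimension `n`, which turns it into a tree of objects. -/
def wrap : (n : ℕ) → X.cell n → PasteTree X.Vertex → PasteTree X.Vertex
  | 0, _, c => c
  | n + 1, z, c => wrap n (X.src z) (.cons ⟨n, X.src z⟩ c (.pt ⟨n, X.tgt z⟩))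

theorem wrap_wf {n : ℕ} (z : X.cell n) {c : PasteTree X.Vertex}
    (h : WF X.Edge (parallelTo n z) c) : WF X.Edge (fun v => v.1 = 0) (wrap n z c) := by
  induction n generalizing c with
  | zero => exact h
  | succ n ih => exact ih _ ⟨parallelTo_self _ _, h, parallelTo_tgt z⟩

/-- `wrap n z` only depends on the boundary of `z`. -/
theorem wrap_congr {n : ℕ} {z z' : X.cell n} (h : parallelTo n z ⟨n, z'⟩)
    (c : PasteTree X.Vertex) : wrap n z c = wrap n z' c := by
  cases n with
  | zero => rfl
  | succ n =>
    have e := h.unique (Edge.mk z')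
    simp only [Sigma.mk.injEq, heq_eq_eq, true_and] at e
    simp only [wrap, e.1, e.2]

theorem wrap_src (n k : ℕ) (z : X.cell n) (c : PasteTree X.Vertex) :
    src (n + k) (wrap n z c) = wrap n z (src k c) := by
  induction n generalizing k c with
  | zero => simp [wrap]
  | succ n ih =>
    rw [Nat.add_right_comm, Nat.add_assoc, wrap, ih, src_cons]
    simp [wrap]

theorem wrap_tgt (n k : ℕ) (z : X.cell n) (c : PasteTree X.Vertex) :
    tgt (n + k) (wrap n z c) = wrap n z (tgt k c) := by
  induction n generalizing k c with
  | zero => simp [wrap]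
  | succ n ih =>
    rw [Nat.add_right_comm, Nat.add_assoc, wrap, ih, tgt_cons]
    simp [wrap]

theorem wrap_comp (n k : ℕ) (z : X.cell n) (b a : PasteTree X.Vertex) :
    comp (n + k) (wrap n z b) (wrap n z a) = wrap n z (comp k b a) := by
  induction n generalizing k b a with
  | zero => simp [wrap]
  | succ n ih =>
    rw [Nat.add_right_comm, Nat.add_assoc, wrap, wrap, ih, comp_succ_cons]
    simp [wrap]

/-- The pasting tree which consists of the single vertex `z` and its iterated boundaries. -/
def globe {n : ℕ} (z : X.cell n) : PasteTree X.Vertex := wrap n z (.pt ⟨n, z⟩)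

theorem globe_wf {n : ℕ} (z : X.cell n) : WF X.Edge (fun v => v.1 = 0) (globe z) :=
  wrap_wf z (parallelTo_self n z)

theorem src_globe {n : ℕ} (z : X.cell (n + 1)) : src n (globe z) = globe (X.src z) := by
  have := wrap_src n 0 (X.src z) (.cons ⟨n, X.src z⟩ (.pt ⟨n + 1, z⟩) (.pt ⟨n, X.tgt z⟩))
  simpa [globe, wrap] using this

theorem tgt_globe {n : ℕ} (z : X.cell (n + 1)) : tgt n (globe z) = globe (X.tgt z) := by
  have := wrap_tgt n 0 (X.src z) (.cons ⟨n, X.src z⟩ (.pt ⟨n + 1, z⟩) (.pt ⟨n, X.tgt z⟩))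
  rw [Nat.add_zero, tgt_zero] at this
  exact this.trans (wrap_congr (parallelTo_tgt z) _)

theorem src_globe_self {n : ℕ} (z : X.cell n) : src n (globe z) = globe z := by
  have := wrap_src n 0 z (.pt ⟨n, z⟩)
  simpa [globe] using this

end Globes

/-- The inclusion of generators into the free `ω`-category. -/
def freeUnit (X : GlobularSet) : X ⟶ OmegaCat.forget.obj (freeCat X) where
  app _ z := ⟨⟨globe z, globe_wf z⟩, Subtype.ext (src_globe_self z)⟩
  app_src z := Subtype.ext (Subtype.ext (src_globe z).symm)
  app_tgt z := Subtype.ext (Subtype.ext (tgt_globe z).symm)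

section Evaluation

open Classical in
/-- Composition in an `ω`-category, extended by a junk value to pairs which are not composable. -/
noncomputable def OmegaCat.totalComp (D : OmegaCat) (n : ℕ) (b a : D.Cell) : D.Cell :=
  if h : D.src n b = D.tgt n a then D.comp n b a h else a

theorem OmegaCat.totalComp_eq (D : OmegaCat) {n : ℕ} {b a : D.Cell} (h : D.src n b = D.tgt n a) :
    D.totalComp n b a = D.comp n b a h := dif_pos h

variable {X : GlobularSet} {D : OmegaCat}

/-- The value in `D` of a pasting diagram of `n`-cells whose labels are interpreted by `f`. -/
noncomputable def evalTree (f : X.Vertex → D.Cell) : ℕ → PasteTree X.Vertex → D.Cell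
  | _, .pt x => f x
  | n, .cons _ c w => D.totalComp n (evalTree f n w) (evalTree f (n + 1) c)

/-- An interpretation of the vertices of `X` by cells of `D` which is a morphism of globular sets. -/
structure IsInterpretation (f : X.Vertex → D.Cell) : Prop where
  src_self : ∀ v : X.Vertex, D.src v.1 (f v) = f v
  edge : ∀ {x v y : X.Vertex}, X.Edge x v y → D.src x.1 (f v) = f x ∧ D.tgt x.1 (f v) = f y

theorem OmegaCat.tgt_of_src (D : OmegaCat) {n : ℕ} {a : D.Cell} (h : D.src n a = a) :
    D.tgt n a = a := by
  rw [← h, D.tgt_src]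

variable {f : X.Vertex → D.Cell}

/-- The edge `c` and the remaining walk `w` are composable in `D`, and the boundary of the value of a
walk is given by its first and its last vertex. -/
theorem IsInterpretation.eval_boundary (hf : IsInterpretation f) {n : ℕ} {P : X.Vertex → Prop}
    (hP : ∀ v, P v → v.1 = n) {t : PasteTree X.Vertex} (ht : WF X.Edge P t) :
    D.src n (evalTree f n t) = f t.head ∧ D.tgt n (evalTree f n t) = f t.last := by
  induction t generalizing n P with
  | pt x =>
    have h := hf.src_self x
    rw [hP x ht] at h
    exact ⟨h, D.tgt_of_src h⟩
  | cons x c w ihc ihw =>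
    obtain ⟨hx, hc, hw⟩ := ht
    have hd : ∀ v, X.Edge x v w.head → v.1 = n + 1 := fun v hv => by rw [hv.dim, hP x hx]
    obtain ⟨c₁, c₂⟩ := ihc hd hc
    obtain ⟨w₁, w₂⟩ := ihw hP hw
    have e₁ := (hf.edge hc.head).1
    have e₂ := (hf.edge hc.last).2
    rw [hP x hx] at e₁ e₂
    have s₁ : D.src n (evalTree f (n + 1) c) = f x := by
      rw [← D.lt_src_src n (n + 1) _ n.lt_succ_self, c₁, e₁]
    have s₂ : D.tgt n (evalTree f (n + 1) c) = f w.head := by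
      rw [← D.lt_tgt_tgt n (n + 1) _ n.lt_succ_self, c₂, e₂]
    have h : D.src n (evalTree f n w) = D.tgt n (evalTree f (n + 1) c) := w₁.trans s₂.symm
    constructor
    · rw [evalTree, D.totalComp_eq h, D.src_comp, s₁]; rfl
    · rw [evalTree, D.totalComp_eq h, D.tgt_comp, w₂]; rfl

theorem IsInterpretation.composable (hf : IsInterpretation f) {n : ℕ} {P : X.Vertex → Prop}
    (hP : ∀ v, P v → v.1 = n) {x : X.Vertex} {c w : PasteTree X.Vertex}
    (ht : WF X.Edge P (.cons x c w)) :
    D.src n (evalTree f n w) = D.tgt n (evalTree f (n + 1) c) := by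
  obtain ⟨hx, hc, hw⟩ := ht
  have hd : ∀ v, X.Edge x v w.head → v.1 = n + 1 := fun v hv => by rw [hv.dim, hP x hx]
  have c₂ := (hf.eval_boundary hd hc).2
  have e₂ := (hf.edge hc.last).2
  rw [hP x hx] at e₂
  rw [(hf.eval_boundary hP hw).1, ← D.lt_tgt_tgt n (n + 1) _ n.lt_succ_self, c₂, e₂]

theorem IsInterpretation.eval_src (hf : IsInterpretation f) {n : ℕ} {P : X.Vertex → Prop}
    (hP : ∀ v, P v → v.1 = n) {t : PasteTree X.Vertex} (ht : WF X.Edge P t) (k : ℕ) :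
    evalTree f n (src k t) = D.src (n + k) (evalTree f n t) := by
  cases k with
  | zero => rw [src_zero, Nat.add_zero, (hf.eval_boundary hP ht).1]; rfl
  | succ k =>
    induction t generalizing n k P with
    | pt x =>
      have h := hf.src_self x
      rw [hP x ht] at h
      rw [src_pt, evalTree, D.src_of_le h (Nat.le_add_right _ _)]
    | cons x c w ihc ihw =>
      have h := hf.composable hP ht
      have hs := ht.src (k + 1)
      rw [src_cons] at hs
      have h' := hf.composable hP hs
      obtain ⟨hx, hc, hw⟩ := ht
      have hd : ∀ v, X.Edge x v w.head → v.1 = n + 1 := fun v hv => by rw [hv.dim, hP x hx]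
      have ew := ihw hP hw k
      have ec : evalTree f (n + 1) (src k c) = D.src (n + (k + 1)) (evalTree f (n + 1) c) := by
        cases k with
        | zero => rw [src_zero, (hf.eval_boundary hd hc).1]; rfl
        | succ k => rw [ihc hd hc k]; congr 1; omega
      rw [src_cons, evalTree, evalTree, D.totalComp_eq h, D.totalComp_eq h',
        D.src_comp_lt n (n + (k + 1)) _ _ h (by rw [← ew, ← ec]; exact h') (by omega)]
      exact D.comp_congr n ew ec _ _

theorem IsInterpretation.eval_tgt (hf : IsInterpretation f) {n : ℕ} {P : X.Vertex → Prop}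
    (hP : ∀ v, P v → v.1 = n) {t : PasteTree X.Vertex} (ht : WF X.Edge P t) (k : ℕ) :
    evalTree f n (tgt k t) = D.tgt (n + k) (evalTree f n t) := by
  cases k with
  | zero => rw [tgt_zero, Nat.add_zero, (hf.eval_boundary hP ht).2]; rfl
  | succ k =>
    induction t generalizing n k P with
    | pt x =>
      have h := hf.src_self x
      rw [hP x ht] at h
      rw [tgt_pt, evalTree, D.tgt_of_src (D.src_of_le h (Nat.le_add_right _ _))]
    | cons x c w ihc ihw =>
      have h := hf.composable hP ht
      have hs := ht.tgt (k + 1)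
      rw [tgt_cons] at hs
      have h' := hf.composable hP hs
      obtain ⟨hx, hc, hw⟩ := ht
      have hd : ∀ v, X.Edge x v w.head → v.1 = n + 1 := fun v hv => by rw [hv.dim, hP x hx]
      have ew := ihw hP hw k
      have ec : evalTree f (n + 1) (tgt k c) = D.tgt (n + (k + 1)) (evalTree f (n + 1) c) := by
        cases k with
        | zero => rw [tgt_zero, (hf.eval_boundary hd hc).2]; rfl
        | succ k => rw [ihc hd hc k]; congr 1; omega
      rw [tgt_cons, evalTree, evalTree, D.totalComp_eq h, D.totalComp_eq h',
        D.tgt_comp_lt n (n + (k + 1)) _ _ h (by rw [← ew, ← ec]; exact h') (by omega)]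
      exact D.comp_congr n ew ec _ _

theorem IsInterpretation.eval_comp_cond (hf : IsInterpretation f) {n : ℕ} {P : X.Vertex → Prop}
    (hP : ∀ v, P v → v.1 = n) {b a : PasteTree X.Vertex} (hb : WF X.Edge P b) (ha : WF X.Edge P a)
    {k : ℕ} (h : src k b = tgt k a) :
    D.src (n + k) (evalTree f n b) = D.tgt (n + k) (evalTree f n a) := by
  rw [← hf.eval_src hP hb, ← hf.eval_tgt hP ha, h]

/-- Concatenation of walks is evaluated to composition, by associativity. -/
theorem IsInterpretation.eval_comp_zero (hf : IsInterpretation f) {n : ℕ} {P : X.Vertex → Prop}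
    (hP : ∀ v, P v → v.1 = n) {b a : PasteTree X.Vertex} (hb : WF X.Edge P b) (ha : WF X.Edge P a)
    (h : src 0 b = tgt 0 a) (h' : D.src n (evalTree f n b) = D.tgt n (evalTree f n a)) :
    evalTree f n (comp 0 b a) = D.comp n (evalTree f n b) (evalTree f n a) h' := by
  induction a with
  | pt x =>
    have e : evalTree f n (.pt x) = D.src n (evalTree f n b) := by
      rw [(hf.eval_boundary hP hb).1]
      simp only [src_zero, tgt_zero, PasteTree.pt.injEq, PasteTree.last] at h
      rw [h]; rfl
    rw [comp_zero_pt]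
    exact (D.comp_src n _ (D.tgt_src n _).symm).symm.trans (D.comp_congr n rfl e.symm _ _)
  | cons x c w _ ihw =>
    have hc := hf.composable hP ha
    have hbw := hf.eval_comp_cond hP hb ha.2.2 (k := 0) (by simpa using h)
    have ew := ihw ha.2.2 (by simpa using h) hbw
    have hcomp := hb.comp ha h
    rw [comp_zero_cons] at hcomp
    have h₂ := hf.composable hP hcomp
    simp only [comp_zero_cons, evalTree]
    rw [D.totalComp_eq h₂]
    have h₃ : D.src n (D.comp n (evalTree f n b) (evalTree f n w) hbw) =
        D.tgt n (evalTree f (n + 1) c) := by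
      rw [D.src_comp, hc]
    refine (D.comp_congr n ew rfl h₂ h₃).trans ((D.assoc n _ _ _ _ _ hc ?_).trans ?_)
    · rw [D.tgt_comp]; exact hbw
    · exact D.comp_congr n rfl (D.totalComp_eq hc).symm _ _

/-- Composition of trees along dimension `k` is evaluated to composition along dimension `n + k`. For
`k > 0` this is the interchange law. -/
theorem IsInterpretation.eval_comp (hf : IsInterpretation f) {n : ℕ} {P : X.Vertex → Prop}
    (hP : ∀ v, P v → v.1 = n) {b a : PasteTree X.Vertex} (hb : WF X.Edge P b) (ha : WF X.Edge P a)
    {k : ℕ} (h : src k b = tgt k a)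
    (h' : D.src (n + k) (evalTree f n b) = D.tgt (n + k) (evalTree f n a)) :
    evalTree f n (comp k b a) = D.comp (n + k) (evalTree f n b) (evalTree f n a) h' := by
  induction a generalizing n k P b with
  | pt x =>
    cases k with
    | zero => exact hf.eval_comp_zero hP hb ha h h'
    | succ k =>
      cases b with
      | cons y d v => simp at h
      | pt y =>
        simp only [src_pt, tgt_pt, PasteTree.pt.injEq] at h
        subst h
        have e : evalTree f n (.pt y) = D.src (n + (k + 1)) (evalTree f n (.pt y)) := by
          rw [← hf.eval_src hP hb, src_pt]
        rw [comp_succ_pt]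
        exact (D.comp_src _ _ (D.tgt_src _ _).symm).symm.trans
          (D.comp_congr _ rfl e.symm _ _)
  | cons x c w ihc ihw =>
    cases k with
    | zero => exact hf.eval_comp_zero hP hb ha h h'
    | succ k =>
      cases b with
      | pt y => simp at h
      | cons y d v =>
        have hca := hf.composable hP ha
        have hcb := hf.composable hP hb
        have hcomp := hb.comp ha h
        rw [comp_succ_cons] at hcomp ⊢
        have hcc := hf.composable hP hcomp
        simp only [src_cons, tgt_cons, PasteTree.cons.injEq] at h
        obtain ⟨rfl, hdc, hvw⟩ := h
        obtain ⟨hx, hc, hw⟩ := ha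
        obtain ⟨-, hd, hv⟩ := hb
        have hvh : v.head = w.head := by
          have := congrArg PasteTree.head hvw
          simpa using this
        rw [hvh] at hd
        have hdim : ∀ u, X.Edge y u w.head → u.1 = n + 1 := fun u hu => by rw [hu.dim, hP y hx]
        have hk : n + 1 + k = n + (k + 1) := by omega
        have c₁ : D.src (n + (k + 1)) (evalTree f n v) = D.tgt (n + (k + 1)) (evalTree f n w) :=
          hf.eval_comp_cond hP hv hw hvw
        have c₂ : D.src (n + (k + 1)) (evalTree f (n + 1) d) =
            D.tgt (n + (k + 1)) (evalTree f (n + 1) c) := by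
          have := hf.eval_comp_cond hdim hd hc hdc
          rwa [hk] at this
        have e₁ := ihw hP hv hw hvw c₁
        have e₂ : evalTree f (n + 1) (comp k d c) =
            D.comp (n + (k + 1)) (evalTree f (n + 1) d) (evalTree f (n + 1) c) c₂ := by
          have := ihc hdim hd hc hdc (hf.eval_comp_cond hdim hd hc hdc)
          simp only [hk] at this
          exact this
        have hcc' := hcc
        rw [e₁, e₂] at hcc'
        rw [evalTree, D.totalComp_eq hcc]
        refine (D.comp_congr n e₁ e₂ hcc hcc').trans ?_
        have h₆ : D.src (n + (k + 1)) (D.comp n _ _ hcb) =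
            D.tgt (n + (k + 1)) (D.comp n _ _ hca) := by
          simpa only [evalTree, D.totalComp_eq hca, D.totalComp_eq hcb] using h'
        refine (D.interchange n (n + (k + 1)) _ _ _ _ c₁ c₂ hcc' hcb hca h₆ (by omega)).trans ?_
        exact D.comp_congr _ (D.totalComp_eq hcb).symm (D.totalComp_eq hca).symm _ _

/-- The `ω`-functor out of the free `ω`-category which extends a morphism of globular sets. -/
noncomputable def freeLift (hf : IsInterpretation f) : OmegaCat.Hom (freeCat X) D where
  map t := evalTree f 0 t.1
  map_src n t := by
    have e := hf.eval_src (fun _ h => h) t.2 n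
    rw [Nat.zero_add] at e
    exact e
  map_tgt n t := by
    have e := hf.eval_tgt (fun _ h => h) t.2 n
    rw [Nat.zero_add] at e
    exact e
  map_comp n b a h h' := by
    have c := hf.eval_comp_cond (fun _ h => h) b.2 a.2 (Subtype.ext_iff.1 h)
    have e := hf.eval_comp (fun _ h => h) b.2 a.2 (Subtype.ext_iff.1 h) c
    simp only [Nat.zero_add] at e
    exact e

/-- Putting a tree inside a boundary does not change its value. -/
theorem IsInterpretation.eval_wrap (hf : IsInterpretation f) {n : ℕ} (z : X.cell n)
    {c : PasteTree X.Vertex} (hc : WF X.Edge (parallelTo n z) c) :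
    evalTree f 0 (wrap n z c) = evalTree f n c := by
  induction n generalizing c with
  | zero => rfl
  | succ n ih =>
    have hw : WF X.Edge (parallelTo n (X.src z)) (.cons ⟨n, X.src z⟩ c (.pt ⟨n, X.tgt z⟩)) :=
      ⟨parallelTo_self _ _, hc, parallelTo_tgt z⟩
    have h := hf.composable (fun v hv => parallelTo_dim hv) hw
    rw [wrap, ih _ hw, evalTree, D.totalComp_eq h]
    have e : evalTree f n (.pt ⟨n, X.tgt z⟩) = D.tgt n (evalTree f (n + 1) c) := by
      rw [← h, (hf.eval_boundary (fun v hv => parallelTo_dim hv) hw.2.2).1]; rfl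
    exact (D.comp_congr n e rfl h (D.src_tgt n _)).trans (D.tgt_comp_self n _ _)

end Evaluation

theorem isInterpretation_of_hom {X : GlobularSet} {D : OmegaCat} (f : X ⟶ OmegaCat.forget.obj D) :
    IsInterpretation (D := D) fun v : X.Vertex => (f.app v.1 v.2).1 where
  src_self v := (f.app v.1 v.2).2
  edge h := by
    cases h with
    | mk z => exact ⟨(Subtype.ext_iff.1 (f.app_src z)).symm, (Subtype.ext_iff.1 (f.app_tgt z)).symm⟩

/-- An `ω`-functor out of the free `ω`-category is determined by its values on the generators, since
every pasting tree is a composite of globes. -/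
theorem freeCat_hom_ext {X : GlobularSet} {D : OmegaCat} {F F' : OmegaCat.Hom (freeCat X) D}
    (h : ∀ (n : ℕ) (z : X.cell n),
      F.map ⟨globe z, globe_wf z⟩ = F'.map ⟨globe z, globe_wf z⟩) : F = F' := by
  have key : ∀ (t : PasteTree X.Vertex) (n : ℕ) (z : X.cell n)
      (ht : WF X.Edge (parallelTo n z) t),
      F.map ⟨wrap n z t, wrap_wf z ht⟩ = F'.map ⟨wrap n z t, wrap_wf z ht⟩ := by
    intro t
    induction t with
    | pt x =>
      intro n z ht
      obtain ⟨m, x⟩ := x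
      obtain rfl : m = n := parallelTo_dim ht
      have e : (⟨wrap m z (.pt ⟨m, x⟩), wrap_wf z ht⟩ : (freeCat X).Cell) =
          ⟨globe x, globe_wf x⟩ := Subtype.ext (wrap_congr ht _)
      rw [e, h]
    | cons x c w ihc ihw =>
      intro n z ht
      obtain ⟨hx, hc, hw⟩ := ht
      obtain ⟨⟨m, v⟩, hv⟩ : ∃ v, v = c.head := ⟨_, rfl⟩
      have he := hc.head
      rw [← hv] at he
      obtain ⟨k, x⟩ := x
      obtain rfl : k = n := parallelTo_dim hx
      obtain rfl : m = k + 1 := he.dim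
      obtain ⟨rfl, hy⟩ : x = X.src v ∧ w.head = ⟨k, X.tgt v⟩ := by
        have := he.unique (Edge.mk v)
        simpa using this
      have hc' : WF X.Edge (parallelTo (k + 1) v) c := by
        rw [hy] at hc; exact hc
      -- `wrap k z` of the walk is the composite of its first edge, a walk of length one, with the rest
      have hone : WF X.Edge (parallelTo k z) (.cons ⟨k, X.src v⟩ c (.pt w.head)) :=
        ⟨hx, hc, hw.head⟩
      have hcond : (freeCat X).src k ⟨wrap k z w, wrap_wf z hw⟩ =
          (freeCat X).tgt k ⟨wrap k z (.cons ⟨k, X.src v⟩ c (.pt w.head)), wrap_wf z hone⟩ := by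
        refine Subtype.ext ?_
        have h₁ := wrap_src k 0 z w
        have h₂ := wrap_tgt k 0 z (.cons ⟨k, X.src v⟩ c (.pt w.head))
        simp only [Nat.add_zero] at h₁ h₂
        exact (h₁.trans (by simp)).trans h₂.symm
      have e : (⟨wrap k z (.cons ⟨k, X.src v⟩ c w), wrap_wf z ⟨hx, hc, hw⟩⟩ : (freeCat X).Cell) =
          (freeCat X).comp k _ _ hcond := by
        refine Subtype.ext ?_
        have h₁ := wrap_comp k 0 z w (.cons ⟨k, X.src v⟩ c (.pt w.head))
        simp only [Nat.add_zero, comp_zero_cons, comp_zero_pt] at h₁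
        exact h₁.symm
      -- a walk of length one is a tree one dimension up, put inside the boundary of its vertices
      have e' : (⟨wrap k z (.cons ⟨k, X.src v⟩ c (.pt w.head)), wrap_wf z hone⟩ :
          (freeCat X).Cell) = ⟨wrap (k + 1) v c, wrap_wf v hc'⟩ := by
        refine Subtype.ext ?_
        change wrap k z _ = wrap k _ _
        rw [hy, wrap_congr hx]
      rw [e, F.map_comp k _ _ hcond (F.map_comp_cond hcond),
        F'.map_comp k _ _ hcond (F'.map_comp_cond hcond)]
      refine D.comp_congr k (ihw k z hw) ?_ _ _
      rw [e']
      exact ihc (k + 1) v hc'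
  refine OmegaCat.Hom.ext (funext fun t => ?_)
  obtain ⟨t, ht⟩ := t
  obtain ⟨⟨m, v⟩, hv⟩ : ∃ v, v = t.head := ⟨_, rfl⟩
  obtain rfl : m = 0 := by
    have := ht.head
    rw [← hv] at this
    exact this
  exact key t 0 v ht

theorem freeUnit_isFree (X : GlobularSet) : OmegaCat.IsFree (freeUnit X) := by
  intro D f
  refine ⟨freeLift (isInterpretation_of_hom f), ?_, ?_⟩
  · refine GlobularSet.Hom.ext (funext fun n => funext fun z => Subtype.ext ?_)
    exact (isInterpretation_of_hom f).eval_wrap (c := .pt ⟨n, z⟩) z (parallelTo_self n z)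
  · intro F hF
    refine freeCat_hom_ext fun n z => ?_
    have e : F.map ⟨globe z, globe_wf z⟩ = (f.app n z).1 := by
      rw [← hF]; rfl
    rw [e]
    exact ((isInterpretation_of_hom f).eval_wrap (c := .pt ⟨n, z⟩) z (parallelTo_self n z)).symm

/-! ### The list of labels of a pasting tree -/

namespace PasteTree

variable {V W : Type}

/-- The labels of a tree, from left to right: each vertex of a walk is followed by the labels of the
edge which leaves it. -/
def flat : PasteTree V → List V
  | pt x => [x]
  | cons x c w => x :: (c.flat ++ w.flat)

@[simp] theorem flat_pt (x : V) : (pt x).flat = [x] := rfl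
@[simp] theorem flat_cons (x : V) (c w) : (cons x c w).flat = x :: (c.flat ++ w.flat) := rfl

theorem flat_head? (t : PasteTree V) : t.flat.head? = some t.head := by cases t <;> rfl

theorem flat_getLast? (t : PasteTree V) : t.flat.getLast? = some t.last := by
  induction t with
  | pt x => rfl
  | cons x c w _ ih =>
    rw [flat_cons, List.getLast?_cons, List.getLast?_append, ih]
    simp

theorem flat_eq_head_cons (t : PasteTree V) : ∃ l, t.flat = t.head :: l := by
  cases t with
  | pt x => exact ⟨[], rfl⟩
  | cons x c w => exact ⟨_, rfl⟩

theorem head_mem_flat (t : PasteTree V) : t.head ∈ t.flat := by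
  obtain ⟨l, h⟩ := t.flat_eq_head_cons
  simp [h]

theorem flat_map (f : V → W) (t : PasteTree V) : (t.map f).flat = t.flat.map f := by
  induction t with
  | pt x => rfl
  | cons x c w ih ih' => simp [PasteTree.map, ih, ih']

theorem flat_comp_zero (b a : PasteTree V) (h : b.head = a.last) (v : V) :
    v ∈ (comp 0 b a).flat ↔ v ∈ b.flat ∨ v ∈ a.flat := by
  induction a with
  | pt x =>
    obtain rfl : b.head = x := h
    have := b.head_mem_flat
    simp only [comp_zero_pt, flat_pt, List.mem_singleton]
    exact ⟨Or.inl, by rintro (h | rfl) <;> assumption⟩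
  | cons x c w _ ih =>
    simp only [comp_zero_cons, flat_cons, List.mem_cons, List.mem_append, ih h]
    tauto

/-- A tree all of whose labels are in the range of `f` comes from a tree labelled in the domain. -/
theorem exists_map_eq (f : V → W) (t : PasteTree W) (h : ∀ v ∈ t.flat, ∃ u, f u = v) :
    ∃ t', PasteTree.map f t' = t := by
  induction t with
  | pt x =>
    obtain ⟨u, rfl⟩ := h x (by simp)
    exact ⟨pt u, rfl⟩
  | cons x c w ih ih' =>
    obtain ⟨u, rfl⟩ := h x (by simp)
    obtain ⟨c', rfl⟩ := ih fun v hv => h v (by simp [hv])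
    obtain ⟨w', rfl⟩ := ih' fun v hv => h v (by simp [hv])
    exact ⟨cons u c' w', rfl⟩

variable {X : GlobularSet} {P : X.Vertex → Prop} {t : PasteTree X.Vertex}

theorem WF.le_dim {n : ℕ} (hP : ∀ v, P v → v.1 = n) (ht : WF X.Edge P t) :
    ∀ v ∈ t.flat, n ≤ v.1 := by
  induction t generalizing n P with
  | pt x => simp [hP x ht]
  | cons x c w ih ih' =>
    obtain ⟨hx, hc, hw⟩ := ht
    intro v hv
    simp only [flat_cons, List.mem_cons, List.mem_append] at hv
    rcases hv with rfl | hv | hv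
    · exact (hP v hx).ge
    · have := ih (n := n + 1) (fun u hu => by rw [hu.dim, hP x hx]) hc v hv
      omega
    · exact ih' hP hw v hv

/-- A label of a tree is either a vertex of the walk, or its source and its target occur before and
after it. -/
theorem WF.boundary_sublist (ht : WF X.Edge P t) {v : X.Vertex} (hv : v ∈ t.flat) :
    P v ∨ ∃ a b, X.Edge a v b ∧ List.Sublist [a, v, b] t.flat := by
  induction t generalizing P with
  | pt x =>
    rw [flat_pt, List.mem_singleton] at hv
    exact Or.inl (hv ▸ ht)
  | cons x c w ih ih' =>
    obtain ⟨hx, hc, hw⟩ := ht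
    simp only [flat_cons, List.mem_cons, List.mem_append] at hv
    rcases hv with rfl | hv | hv
    · exact Or.inl hx
    · refine Or.inr ?_
      rcases ih hc hv with h | ⟨a, b, h, hs⟩
      · refine ⟨x, w.head, h, List.Sublist.cons_cons _ ?_⟩
        exact List.Sublist.append (l₁ := [v]) (List.singleton_sublist.2 hv)
          (List.singleton_sublist.2 w.head_mem_flat)
      · exact ⟨a, b, h, (hs.trans (List.sublist_append_left _ _)).cons _⟩
    · rcases ih' hw hv with h | ⟨a, b, h, hs⟩
      · exact Or.inl h
      · exact Or.inr ⟨a, b, h, (hs.trans (List.sublist_append_right _ _)).cons _⟩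

theorem WF.src_mem (ht : WF X.Edge P t) {v a b : X.Vertex} (hv : v ∈ t.flat) (h : X.Edge a v b) :
    P v ∨ a ∈ t.flat := by
  rcases ht.boundary_sublist hv with h' | ⟨a', b', h', hs⟩
  · exact Or.inl h'
  · obtain ⟨rfl, rfl⟩ := h.unique h'
    exact Or.inr (hs.subset (by simp))

theorem WF.tgt_mem (ht : WF X.Edge P t) {v a b : X.Vertex} (hv : v ∈ t.flat) (h : X.Edge a v b) :
    P v ∨ b ∈ t.flat := by
  rcases ht.boundary_sublist hv with h' | ⟨a', b', h', hs⟩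
  · exact Or.inl h'
  · obtain ⟨rfl, rfl⟩ := h.unique h'
    exact Or.inr (hs.subset (by simp))

end PasteTree

theorem GlobularSet.Edge.prec_left {X : GlobularSet} {x v y : X.Vertex} (h : X.Edge x v y) :
    X.Prec x v := by
  cases h; exact Prec.src _

theorem GlobularSet.Edge.prec_right {X : GlobularSet} {x v y : X.Vertex} (h : X.Edge x v y) :
    X.Prec v y := by
  cases h; exact Prec.tgt _

theorem GlobularSet.Prec.exists_edge {X : GlobularSet} {x y : X.Vertex} (h : X.Prec x y) :
    (∃ z, X.Edge x y z) ∨ ∃ z, X.Edge z x y := by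
  cases h
  · exact Or.inl ⟨_, Edge.mk _⟩
  · exact Or.inr ⟨_, Edge.mk _⟩

theorem GlobularSet.Prec.ne {X : GlobularSet} {x y : X.Vertex} (h : X.Prec x y) : x ≠ y := by
  rintro rfl
  rcases h.exists_edge with ⟨z, h⟩ | ⟨z, h⟩
  · have := h.dim; omega
  · have := h.dim_tgt; omega

namespace PasteTree

variable {X : GlobularSet} {P : X.Vertex → Prop} {t : PasteTree X.Vertex}

/-- Consecutive labels of a tree are related by `≺`. -/
theorem WF.isChain (ht : WF X.Edge P t) : t.flat.IsChain X.Prec := by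
  induction t generalizing P with
  | pt x => simp
  | cons x c w ih ih' =>
    obtain ⟨hx, hc, hw⟩ := ht
    rw [flat_cons, List.isChain_cons, List.head?_append, flat_head?, List.isChain_append,
      flat_getLast?, flat_head?]
    refine ⟨?_, ih hc, ih' hw, ?_⟩
    · simpa using hc.head.prec_left
    · simpa using hc.last.prec_right

/-- A well-formed tree is determined by its list of labels: the dimensions of the labels tell where
the edges begin and end. The lists `l` and `l'` are what follows the two trees inside larger ones. -/
theorem WF.flat_append_injective {n : ℕ} {P' : X.Vertex → Prop} {t' : PasteTree X.Vertex}
    (hP : ∀ v, P v → v.1 = n) (hP' : ∀ v, P' v → v.1 = n) (ht : WF X.Edge P t)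
    (ht' : WF X.Edge P' t') {l l' : List X.Vertex} (hn : ∀ v ∈ l.head?, v.1 < n) (hn' : ∀ v ∈ l'.head?, v.1 < n)
    (h : t.flat ++ l = t'.flat ++ l') : t = t' ∧ l = l' := by
  induction t generalizing n P P' t' l l' with
  | pt x =>
    cases t' with
    | pt y =>
      simp only [flat_pt, List.cons_append, List.nil_append, List.cons.injEq] at h
      exact ⟨by rw [h.1], h.2⟩
    | cons y c w =>
      exfalso
      simp only [flat_pt, flat_cons, List.cons_append, List.nil_append, List.cons.injEq] at h
      have e := hn c.head (by simp [h.2, flat_head?])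
      have := ht'.2.1.head.dim
      have := hP' y ht'.1
      omega
  | cons x c w ih ih' =>
    cases t' with
    | pt y =>
      exfalso
      simp only [flat_pt, flat_cons, List.cons_append, List.nil_append, List.cons.injEq] at h
      have e := hn' c.head (by simp [← h.2, flat_head?])
      have := ht.2.1.head.dim
      have := hP x ht.1
      omega
    | cons y d v =>
      simp only [flat_cons, List.cons_append, List.cons.injEq, List.append_assoc] at h
      obtain ⟨rfl, h⟩ := h
      have hw := hP _ ht.2.2.head
      have hv := hP' _ ht'.2.2.head
      have hx := hP _ ht.1
      obtain ⟨rfl, h₂⟩ := ih (n := n + 1) (fun u hu => by rw [hu.dim, hx])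
        (fun u hu => by rw [hu.dim, hx]) ht.2.1 ht'.2.1
        (by simp [flat_head?, hw]) (by simp [flat_head?, hv]) h
      obtain ⟨rfl, rfl⟩ := ih' hP hP' ht.2.2 ht'.2.2 hn hn' h₂
      exact ⟨rfl, rfl⟩

end PasteTree

/-! ### Globular cardinals and pasting trees -/

theorem idxOf_lt_of_sublist {α : Type} [DecidableEq α] {u v : α} {l : List α}
    (h : List.Sublist [u, v] l) (hl : l.Nodup) : l.idxOf u < l.idxOf v := by
  induction l with
  | nil => simp at h
  | cons a l ih =>
    rw [List.nodup_cons] at hl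
    cases h with
    | cons _ h =>
      have hu : u ≠ a := fun e => hl.1 (e ▸ h.subset (by simp))
      have hv : v ≠ a := fun e => hl.1 (e ▸ h.subset (by simp))
      rw [List.idxOf_cons_ne _ hu.symm, List.idxOf_cons_ne _ hv.symm]
      exact Nat.succ_lt_succ (ih h hl.2)
    | cons_cons _ h =>
      have hv : v ≠ u := fun e => hl.1 (e ▸ List.singleton_sublist.1 h)
      rw [List.idxOf_cons_self, List.idxOf_cons_ne _ hv.symm]
      exact Nat.succ_pos _

/-- If the vertices of `X` can be arranged in a pasting tree, without repetition, then `X` is a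
globular cardinal: the order `◂` is the order of the list of labels. -/
theorem isCardinal_of_tree {X : GlobularSet} {t : PasteTree X.Vertex}
    (ht : WF X.Edge (fun v => v.1 = 0) t) (hnodup : t.flat.Nodup) (hall : ∀ v, v ∈ t.flat) :
    X.IsCardinal := by
  classical
  have hmono : ∀ x y, X.Le x y → t.flat.idxOf x ≤ t.flat.idxOf y := by
    intro x y h
    induction h with
    | refl => exact le_rfl
    | tail _ h ih =>
      refine ih.trans (le_of_lt ?_)
      rcases h.exists_edge with ⟨z, h⟩ | ⟨z, h⟩
      · rcases ht.boundary_sublist (hall _) with h0 | ⟨a, b, h', hs⟩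
        · exact absurd (h.dim.symm.trans h0) (Nat.succ_ne_zero _)
        · obtain ⟨rfl, rfl⟩ := h.unique h'
          exact idxOf_lt_of_sublist
            (List.Sublist.trans (.cons_cons _ (.cons_cons _ (List.nil_sublist _))) hs) hnodup
      · rcases ht.boundary_sublist (hall _) with h0 | ⟨a, b, h', hs⟩
        · exact absurd (h.dim_tgt.symm.trans h0) (Nat.succ_ne_zero _)
        · obtain ⟨rfl, rfl⟩ := h.unique h'
          exact idxOf_lt_of_sublist (List.Sublist.trans (List.sublist_cons_self _ _) hs) hnodup
  refine ⟨?_, ?_, ?_⟩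
  · refine Set.finite_univ_iff.1 ((List.finite_toSet t.flat).subset fun v _ => hall v)
  · intro x y h h'
    exact (List.idxOf_inj (hall x)).1 (le_antisymm (hmono _ _ h) (hmono _ _ h'))
  · have : Trans X.Le X.Le X.Le := ⟨Relation.ReflTransGen.trans⟩
    have hp : t.flat.Pairwise X.Le :=
      (ht.isChain.imp fun _ _ h => Relation.ReflTransGen.single h).pairwise
    have : Std.Symm fun x y => X.Le x y ∨ X.Le y x := ⟨fun _ _ => Or.symm⟩
    intro x y
    exact List.Pairwise.forall_of_forall (R := fun x y => X.Le x y ∨ X.Le y x)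
      (fun _ _ => Or.inl Relation.ReflTransGen.refl) (hp.imp Or.inl) (hall x) (hall y)

theorem parallelTo_congr {X : GlobularSet} {n : ℕ} {z z' : X.cell n}
    (h : parallelTo n z ⟨n, z'⟩) : parallelTo n z = parallelTo n z' := by
  cases n with
  | zero => rfl
  | succ n =>
    have e := h.unique (Edge.mk z')
    simp only [Sigma.mk.injEq, heq_eq_eq, true_and] at e
    funext v
    simp only [parallelTo, e.1, e.2]

theorem exists_first {α : Type} {p : α → Prop} {l : List α} (h : ∃ v ∈ l, p v) :
    ∃ m u r, l = m ++ u :: r ∧ (∀ v ∈ m, ¬ p v) ∧ p u := by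
  induction l with
  | nil => simp at h
  | cons a l ih =>
    by_cases ha : p a
    · exact ⟨[], a, l, rfl, by simp, ha⟩
    · obtain ⟨m, u, r, rfl, hm, hu⟩ := ih (by simpa [ha] using h)
      exact ⟨a :: m, u, r, rfl, by simpa [ha] using hm, hu⟩

/-- A list of vertices of dimension at least `n`, whose first and last members have dimension `n`
and whose consecutive members are related by `≺`, is the list of labels of a pasting tree. -/
theorem exists_tree_of_isChain {X : GlobularSet} (N : ℕ) {n : ℕ} (z : X.cell n)
    (l : List X.Vertex) (hN : l.length < N) (hc : (⟨n, z⟩ :: l).IsChain X.Prec)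
    (hn : ∀ v ∈ l, n ≤ v.1) (hlast : ∀ v ∈ l.getLast?, v.1 = n) :
    ∃ t, flat t = ⟨n, z⟩ :: l ∧ WF X.Edge (parallelTo n z) t := by
  induction N generalizing n l with
  | zero => omega
  | succ N ih =>
    cases l with
    | nil => exact ⟨.pt ⟨n, z⟩, rfl, parallelTo_self n z⟩
    | cons y l =>
      rw [List.isChain_cons_cons] at hc
      obtain ⟨hy, hc⟩ := hc
      obtain ⟨b, hb⟩ : ∃ b, X.Edge ⟨n, z⟩ y b := by
        rcases hy.exists_edge with h | ⟨a, h⟩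
        · exact h
        · exfalso
          have h1 : n = y.1 + 1 := h.dim_tgt
          have := hn y (by simp)
          omega
      obtain ⟨k, y⟩ := y
      obtain rfl : k = n + 1 := hb.dim
      obtain ⟨e, rfl⟩ := hb.unique (Edge.mk y)
      simp only [Sigma.mk.injEq, heq_eq_eq, true_and] at e
      subst e
      -- the first edge ends where the list comes back to dimension `n` for the first time
      obtain ⟨m, u, r, hl, hm, hu⟩ : ∃ m u r, l = m ++ u :: r ∧
          (∀ v ∈ m, ¬ v.1 = n) ∧ u.1 = n := by
        refine exists_first (p := fun v : X.Vertex => v.1 = n) ?_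
        cases hl : l.getLast? with
        | none =>
          rw [List.getLast?_eq_none_iff] at hl
          subst hl
          have := hlast ⟨n + 1, y⟩ (by simp)
          simp at this
        | some v =>
          exact ⟨v, List.mem_of_getLast? hl, hlast v (by simp [List.getLast?_cons, hl])⟩
      subst hl
      have hc' := (List.isChain_append (l₁ := ⟨n + 1, y⟩ :: m) (l₂ := u :: r)).1 hc
      obtain ⟨hc₁, hc₂, hc₃⟩ := hc'
      have hlen : m.length < N ∧ r.length < N := by
        simp only [List.length_cons, List.length_append] at hN
        omega
      obtain ⟨j, u⟩ := u
      obtain rfl : j = n := hu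
      have hdim : ∀ v ∈ (⟨j + 1, y⟩ :: m : List X.Vertex), j + 1 ≤ v.1 := by
        intro v hv
        rcases List.mem_cons.1 hv with rfl | hv
        · exact le_rfl
        · have := hn v (by simp [hv])
          have := hm v hv
          omega
      have hlastm : ∀ v ∈ (⟨j + 1, y⟩ :: m : List X.Vertex).getLast?,
          ∃ a, X.Edge a v ⟨j, u⟩ := by
        intro v hv
        have hv' := hdim v (List.mem_of_getLast? hv)
        rcases (hc₃ v hv ⟨j, u⟩ (by simp)).exists_edge with ⟨a, h⟩ | h
        · have h1 : j = v.1 + 1 := h.dim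
          omega
        · exact h
      obtain ⟨c, hcf, hcw⟩ := ih y m hlen.1 hc₁ (fun v hv => hdim v (by simp [hv])) (by
        intro v hv
        obtain ⟨a, h⟩ := hlastm v (by
          rw [List.getLast?_cons]
          rw [Option.mem_def] at hv
          simp [hv])
        exact h.dim_tgt)
      obtain ⟨w, hwf, hww⟩ := ih u r hlen.2 hc₂ (fun v hv => hn v (by simp [hv])) (by
        intro v hv
        refine hlast v ?_
        rw [Option.mem_def] at hv
        simp [List.getLast?_cons, List.getLast?_append, hv])
      have hwh : w.head = ⟨j, u⟩ := by
        have := w.flat_head?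
        rw [hwf] at this
        simpa using this.symm
      obtain ⟨a, ha⟩ := hlastm c.last (by rw [← hcf, flat_getLast?]; rfl)
      have hut := (hcw.last.unique ha).2
      simp only [Sigma.mk.injEq, heq_eq_eq, true_and] at hut
      subst hut
      refine ⟨.cons ⟨j, X.src y⟩ c w, by simp [hcf, hwf], parallelTo_self _ _, ?_, ?_⟩
      · rw [hwh]; exact hcw
      · rw [parallelTo_congr (parallelTo_tgt y)]
        exact hww

namespace GlobularSet.IsCardinal

variable {X : GlobularSet}

theorem pairwise_of_wf (hX : X.IsCardinal) {P : X.Vertex → Prop} {t : PasteTree X.Vertex}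
    (ht : WF X.Edge P t) : t.flat.Pairwise fun x y => X.Le x y ∧ x ≠ y := by
  have : Trans (fun x y => X.Le x y ∧ x ≠ y) (fun x y => X.Le x y ∧ x ≠ y)
      (fun x y => X.Le x y ∧ x ≠ y) := ⟨fun {a b c} h h' => ⟨h.1.trans h'.1, by
    rintro rfl
    exact h.2 (hX.antisymm _ _ h.1 h'.1)⟩⟩
  exact (ht.isChain.imp fun _ _ h => ⟨Relation.ReflTransGen.single h, h.ne⟩).pairwise

/-- In a globular cardinal no label of a pasting tree is repeated. -/
theorem nodup_of_wf (hX : X.IsCardinal) {P : X.Vertex → Prop} {t : PasteTree X.Vertex}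
    (ht : WF X.Edge P t) : t.flat.Nodup :=
  (hX.pairwise_of_wf ht).imp fun h => h.2

/-- In a globular cardinal there is at most one pasting tree in which every vertex occurs, because
its list of labels is the increasing enumeration of the vertices. -/
theorem tree_unique (hX : X.IsCardinal) {t t' : PasteTree X.Vertex}
    (ht : WF X.Edge (fun v => v.1 = 0) t) (ht' : WF X.Edge (fun v => v.1 = 0) t')
    (h : ∀ v, v ∈ t.flat) (h' : ∀ v, v ∈ t'.flat) : t = t' := by
  have e : t.flat = t'.flat := by
    refine List.Perm.eq_of_pairwise (le := X.Le) (fun a b _ _ => hX.antisymm a b)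
      ((hX.pairwise_of_wf ht).imp And.left) ((hX.pairwise_of_wf ht').imp And.left) ?_
    rw [List.perm_ext_iff_of_nodup (hX.nodup_of_wf ht) (hX.nodup_of_wf ht')]
    exact fun v => ⟨fun _ => h' v, fun _ => h v⟩
  exact (ht.flat_append_injective (n := 0) (l := []) (l' := []) (fun _ h => h) (fun _ h => h) ht'
    (by simp) (by simp) (by simpa using e)).1

/-- The vertices of a non-empty globular cardinal can be arranged in a pasting tree. -/
theorem exists_tree (hX : X.IsCardinal) (hne : Nonempty X.Vertex) :
    ∃ t, WF X.Edge (fun v => v.1 = 0) t ∧ ∀ v, v ∈ t.flat := by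
  classical
  have := hX.finite
  have := Fintype.ofFinite X.Vertex
  have : IsTrans X.Vertex X.Le := ⟨fun _ _ _ => Relation.ReflTransGen.trans⟩
  have : Std.Antisymm X.Le := ⟨hX.antisymm⟩
  have : Std.Total X.Le := ⟨hX.total⟩
  obtain ⟨L, hL, hsort, hnodup⟩ : ∃ L : List X.Vertex, (∀ v, v ∈ L) ∧ L.Pairwise X.Le ∧ L.Nodup :=
    ⟨Finset.univ.sort X.Le, fun v => (Finset.mem_sort _).2 (Finset.mem_univ v),
      Finset.pairwise_sort _ _, Finset.sort_nodup _ _⟩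
  -- a chain of `≺` from a vertex to its successor in the linear order has only one step
  have hchain : L.IsChain X.Prec := by
    rw [List.isChain_iff_forall_rel_of_append_cons_cons]
    rintro a b l₁ l₂ rfl
    rw [List.pairwise_append] at hsort
    obtain ⟨-, hs, hs'⟩ := hsort
    rw [List.pairwise_cons, List.pairwise_cons] at hs
    have hab : a ≠ b := by
      rintro rfl
      simp [List.nodup_append] at hnodup
    rcases Relation.ReflTransGen.cases_head (hs.1 b (by simp)) with h | ⟨u, hau, hub⟩
    · exact absurd h hab
    · suffices u = b by rwa [this] at hau
      have hu := hL u
      rw [List.mem_append, List.mem_cons, List.mem_cons] at hu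
      rcases hu with hu | hu | hu | hu
      · exact absurd (hX.antisymm _ _ (Relation.ReflTransGen.single hau) (hs' u hu a (by simp)))
          hau.ne
      · exact absurd hu.symm hau.ne
      · exact hu
      · exact hX.antisymm _ _ hub (hs.2.1 u hu)
  obtain ⟨v₀⟩ := hne
  cases L with
  | nil => exact absurd (hL v₀) (by simp)
  | cons z l =>
    obtain ⟨n, z⟩ := z
    -- the least vertex has dimension `0`, since the source of a vertex precedes it
    obtain rfl : n = 0 := by
      cases n with
      | zero => rfl
      | succ n =>
        have hp := (Edge.mk z).prec_left
        rcases List.mem_cons.1 (hL ⟨n, X.src z⟩) with h | h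
        · exact absurd h hp.ne
        · exact absurd (hX.antisymm _ _ (Relation.ReflTransGen.single hp)
            ((List.pairwise_cons.1 hsort).1 _ h)) hp.ne
    obtain ⟨t, ht, hwf⟩ := exists_tree_of_isChain _ z l (Nat.lt_succ_self _) hchain
      (fun _ _ => Nat.zero_le _) (by
        rintro ⟨m, v⟩ hv
        cases m with
        | zero => rfl
        | succ m =>
          exfalso
          have hp := (Edge.mk v).prec_right
          obtain ⟨l', hl'⟩ := List.getLast?_eq_some_iff.1 hv
          rw [hl', ← List.cons_append, List.pairwise_append] at hsort
          have hm := hL ⟨m, X.tgt v⟩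
          rw [hl', ← List.cons_append, List.mem_append, List.mem_singleton] at hm
          rcases hm with hm | hm
          · exact hp.ne (hX.antisymm _ _ (Relation.ReflTransGen.single hp)
              (hsort.2.2 _ hm _ (by simp)))
          · exact hp.ne hm.symm)
    exact ⟨t, hwf, fun v => ht ▸ hL v⟩

end GlobularSet.IsCardinal

/-! ### Functoriality of the free `ω`-category -/

section FreeMap

variable {X Y : GlobularSet}

/-- The `ω`-functor between free `ω`-categories which relabels pasting trees along `m`. -/
def freeMap (m : X ⟶ Y) : OmegaCat.Hom (freeCat X) (freeCat Y) where
  map t := ⟨t.1.map (Hom.vertex m), t.2.map (fun _ _ _ h => h.map m) fun _ h => h⟩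
  map_src n t := Subtype.ext (PasteTree.map_src _ n t.1)
  map_tgt n t := Subtype.ext (PasteTree.map_tgt _ n t.1)
  map_comp n b a _ _ := Subtype.ext (PasteTree.map_comp _ n b.1 a.1)

theorem map_wrap (m : X ⟶ Y) {n : ℕ} (z : X.cell n) (c : PasteTree X.Vertex) :
    (wrap n z c).map (Hom.vertex m) = wrap n (m.app n z) (c.map (Hom.vertex m)) := by
  induction n generalizing c with
  | zero => rfl
  | succ n ih =>
    rw [wrap, ih, wrap, ← m.app_src, ← m.app_tgt]
    rfl

theorem freeUnit_freeMap (m : X ⟶ Y) :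
    freeUnit X ≫ OmegaCat.forget.map (X := freeCat X) (Y := freeCat Y) (freeMap m) =
      m ≫ freeUnit Y :=
  GlobularSet.Hom.ext (funext fun _ => funext fun z => Subtype.ext (Subtype.ext (map_wrap m z _)))

end FreeMap

theorem OmegaCat.IsFree.hom_ext {G : GlobularSet} {C D : OmegaCat} {η : G ⟶ forget.obj C}
    (h : IsFree η) {F F' : C ⟶ D} (e : η ≫ forget.map F = η ≫ forget.map F') : F = F' :=
  (h D (η ≫ forget.map F')).unique e rfl

/-- Two `ω`-categories which are free on the same globular set are isomorphic. -/
theorem OmegaCat.IsFree.exists_iso {G : GlobularSet} {C D : OmegaCat} {η : G ⟶ forget.obj C}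
    (h : IsFree η) {θ : G ⟶ forget.obj D} (h' : IsFree θ) :
    ∃ φ : C ≅ D, η ≫ forget.map φ.hom = θ := by
  obtain ⟨F, hF, -⟩ := h D θ
  obtain ⟨F', hF', -⟩ := h' C η
  refine ⟨⟨F, F', h.hom_ext ?_, h'.hom_ext ?_⟩, hF⟩
  · rw [forget.map_comp, ← Category.assoc, hF, hF', forget.map_id, Category.comp_id]
  · rw [forget.map_comp, ← Category.assoc, hF', hF, forget.map_id, Category.comp_id]

theorem OmegaCat.IsFree.of_iso {G : GlobularSet} {C D : OmegaCat} {η : G ⟶ forget.obj C}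
    (h : IsFree η) (φ : C ≅ D) : IsFree (η ≫ forget.map φ.hom) := by
  intro E f
  obtain ⟨F, hF, -⟩ := h E f
  refine ⟨φ.inv ≫ F, ?_, fun F' hF' => ?_⟩
  · change (η ≫ forget.map φ.hom) ≫ forget.map (φ.inv ≫ F) = f
    rw [Category.assoc, ← forget.map_comp, Iso.hom_inv_id_assoc, hF]
  · rw [Iso.eq_inv_comp]
    refine h.hom_ext ?_
    rw [forget.map_comp, ← Category.assoc, hF', hF]

/-! ### Monomorphisms of globular sets -/

/-- The globular set of pairs of cells of `X` with the same image under `m`. -/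
def kernelPair {X Y : GlobularSet} (m : X ⟶ Y) : GlobularSet where
  cell n := {z : X.cell n × X.cell n // m.app n z.1 = m.app n z.2}
  src z := ⟨(X.src z.1.1, X.src z.1.2), by
    rw [m.app_src, m.app_src, z.2]⟩
  tgt z := ⟨(X.tgt z.1.1, X.tgt z.1.2), by
    rw [m.app_tgt, m.app_tgt, z.2]⟩
  src_src z := Subtype.ext (Prod.ext (X.src_src _) (X.src_src _))
  tgt_src z := Subtype.ext (Prod.ext (X.tgt_src _) (X.tgt_src _))

theorem app_injective_of_mono {X Y : GlobularSet} (m : X ⟶ Y) [Mono m] (n : ℕ) :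
    Function.Injective (m.app n) := by
  intro z z' h
  let p₁ : kernelPair m ⟶ X := ⟨fun _ z => z.1.1, fun _ => rfl, fun _ => rfl⟩
  let p₂ : kernelPair m ⟶ X := ⟨fun _ z => z.1.2, fun _ => rfl, fun _ => rfl⟩
  have e : p₁ ≫ m = p₂ ≫ m :=
    GlobularSet.Hom.ext (funext fun n => funext fun z => z.2)
  have e' : p₁ = p₂ := (cancel_mono m).1 e
  exact congrArg (fun p : kernelPair m ⟶ X => p.app n ⟨(z, z'), h⟩) e'

theorem isIso_of_bijective {X Y : GlobularSet} (m : X ⟶ Y)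
    (h : ∀ n, Function.Bijective (m.app n)) : IsIso m := by
  let e := fun n => Equiv.ofBijective (m.app n) (h n)
  have he : ∀ n z, m.app n ((e n).symm z) = z := fun n z => (e n).apply_symm_apply z
  refine ⟨⟨fun n => (e n).symm, fun {n} z => ?_, fun {n} z => ?_⟩, ?_, ?_⟩
  · exact (h n).1 ((he n _).trans (by rw [m.app_src, he]))
  · exact (h n).1 ((he n _).trans (by rw [m.app_tgt, he]))
  · exact GlobularSet.Hom.ext (funext fun n => funext fun z => (e n).symm_apply_apply z)
  · exact GlobularSet.Hom.ext (funext fun n => funext fun z => he n z)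

/-- The sub-globular set of `X` on the labels of a pasting tree. -/
def labelSet {X : GlobularSet} (t : (freeCat X).Cell) : GlobularSet where
  cell n := {z : X.cell n // (⟨n, z⟩ : X.Vertex) ∈ t.1.flat}
  src z := ⟨X.src z.1, (t.2.src_mem z.2 (Edge.mk z.1)).resolve_left (Nat.succ_ne_zero _)⟩
  tgt z := ⟨X.tgt z.1, (t.2.tgt_mem z.2 (Edge.mk z.1)).resolve_left (Nat.succ_ne_zero _)⟩
  src_src _ := Subtype.ext (X.src_src _)
  tgt_src _ := Subtype.ext (X.tgt_src _)

/-- The inclusion of the globular set of the labels of a pasting tree. -/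
def labelInclusion {X : GlobularSet} (t : (freeCat X).Cell) : labelSet t ⟶ X :=
  ⟨fun _ z => z.1, fun _ => rfl, fun _ => rfl⟩

instance {X : GlobularSet} (t : (freeCat X).Cell) : Mono (labelInclusion t) where
  right_cancellation _ _ e := GlobularSet.Hom.ext (funext fun n => funext fun z => Subtype.ext
    (congrArg (fun p : _ ⟶ X => p.app n z) e))

/-- A cell of a free `ω`-category lives on the globular set of its labels. -/
theorem exists_freeMap_labelInclusion {X : GlobularSet} (t : (freeCat X).Cell) :
    ∃ t', (freeMap (labelInclusion t)).map t' = t := by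
  obtain ⟨t', ht'⟩ := PasteTree.exists_map_eq (Hom.vertex (labelInclusion t)) t.1
    fun v hv => ⟨⟨v.1, ⟨v.2, hv⟩⟩, rfl⟩
  have hwf : WF (labelSet t).Edge (fun v => v.1 = 0) t' := by
    have h := t.2
    rw [← ht'] at h
    refine h.of_map ?_ fun _ h => h
    rintro ⟨a, x⟩ ⟨b, v⟩ ⟨c, y⟩ h
    obtain rfl : b = a + 1 := h.dim
    obtain rfl : c = a := by simpa [Hom.vertex] using h.dim_tgt.symm
    have e := h.unique (Edge.mk v.1)
    simp only [Hom.vertex, labelInclusion, Sigma.mk.injEq, heq_eq_eq, true_and] at e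
    obtain rfl : x = (labelSet t).src v := Subtype.ext e.1
    obtain rfl : y = (labelSet t).tgt v := Subtype.ext e.2
    exact Edge.mk v
  exact ⟨⟨t', hwf⟩, Subtype.ext ht'⟩

/-! ### Maximal cells of free `ω`-categories -/

namespace OmegaCat

section Maximal

variable {G : GlobularSet} {C : OmegaCat} {η : G ⟶ forget.obj C}

/-- Being in the image of `[m]` may be tested on pasting trees. -/
theorem inImage_iff (φ : C ≅ freeCat G) (hφ : η ≫ forget.map φ.hom = freeUnit G)
    {H : GlobularSet} (m : H ⟶ G) (a : (forget.obj C).Vertex) :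
    InImage η m a ↔ ∃ t, (freeMap m).map t = φ.hom.map a.2.1 := by
  constructor
  · rintro ⟨D, θ, F, hθ, hF, b, hb⟩
    obtain ⟨ψ, hψ, -⟩ := hθ (freeCat H) (freeUnit H)
    have e : F ≫ φ.hom = CategoryStruct.comp (Y := freeCat H) ψ (freeMap m) := by
      refine hθ.hom_ext ?_
      rw [forget.map_comp, ← Category.assoc, hF, Category.assoc, hφ, ← freeUnit_freeMap, ← hψ,
        forget.map_comp]
      rfl
    refine ⟨ψ.map b.1, ?_⟩
    rw [← hb]
    exact (Hom.map_congr_eq e b.1).symm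
  · rintro ⟨t, ht⟩
    have hF : η = freeUnit G ≫ forget.map φ.inv := by
      rw [← hφ, Category.assoc, ← forget.map_comp, Iso.hom_inv_id, forget.map_id, Category.comp_id]
    refine ⟨freeCat H, freeUnit H, CategoryStruct.comp (Y := freeCat G) (freeMap m) φ.inv,
      freeUnit_isFree H, ?_, ⟨(freeCat H).src a.1 t, (freeCat H).src_src _ _⟩, Subtype.ext ?_⟩
    · rw [hF, ← Category.assoc, ← freeUnit_freeMap, forget.map_comp]
      rfl
    · change φ.inv.map ((freeMap m).map ((freeCat H).src a.1 t)) = a.2.1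
      rw [(freeMap m).map_src, ht, φ.inv.map_src]
      have : φ.inv.map (φ.hom.map a.2.1) = a.2.1 := Hom.map_congr_eq φ.hom_inv_id a.2.1
      rw [this]
      exact a.2.2

/-- A proper cell of the free `ω`-category on `G` is maximal if and only if every vertex of `G` occurs
in the corresponding pasting tree. -/
theorem isMaximal_iff (φ : C ≅ freeCat G) (hφ : η ≫ forget.map φ.hom = freeUnit G)
    (a : (forget.obj C).Vertex) :
    IsMaximal η a ↔ IsProper a ∧ ∀ v, v ∈ (φ.hom.map a.2.1).1.flat := by
  refine and_congr_right fun _ => ⟨fun h v => ?_, fun h H m hm hi => ?_⟩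
  · have hiso := h _ (labelInclusion (φ.hom.map a.2.1)) inferInstance
      ((inImage_iff φ hφ _ _).2 (exists_freeMap_labelInclusion _))
    have e := IsIso.inv_hom_id (labelInclusion (φ.hom.map a.2.1))
    have e' : ((inv (labelInclusion (φ.hom.map a.2.1))).app v.1 v.2).1 = v.2 :=
      congrArg (fun p : G ⟶ G => p.app v.1 v.2) e
    have := ((inv (labelInclusion (φ.hom.map a.2.1))).app v.1 v.2).2
    rw [e'] at this
    exact this
  · refine isIso_of_bijective m fun n => ⟨app_injective_of_mono m n, fun z => ?_⟩
    obtain ⟨t, ht⟩ := (inImage_iff φ hφ m a).1 hi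
    have hz := h ⟨n, z⟩
    rw [← ht] at hz
    change _ ∈ (t.1.map (Hom.vertex m)).flat at hz
    rw [flat_map, List.mem_map] at hz
    obtain ⟨⟨n', u⟩, -, hu⟩ := hz
    obtain rfl : n' = n := congrArg Sigma.fst hu
    simp only [Hom.vertex, Sigma.mk.injEq, heq_eq_eq, true_and] at hu
    exact ⟨u, hu⟩

/-- Every cell is proper when regarded as a cell of the least possible dimension. -/
theorem exists_isProper (C : OmegaCat) (c : C.Cell) :
    ∃ a : (forget.obj C).Vertex, a.2.1 = c ∧ IsProper a := by
  classical
  exact ⟨⟨Nat.find (C.exists_dim c), c, Nat.find_spec (C.exists_dim c)⟩, rfl,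
    fun m hm => Nat.find_min (C.exists_dim c) hm⟩

theorem IsProper.ext {a a' : (forget.obj C).Vertex} (h : IsProper a) (h' : IsProper a')
    (e : a.2.1 = a'.2.1) : a = a' := by
  obtain ⟨n, c, hc⟩ := a
  obtain ⟨n', c', hc'⟩ := a'
  obtain rfl : c = c' := e
  rcases lt_trichotomy n n' with hlt | rfl | hlt
  · exact absurd hc (h' n hlt)
  · rfl
  · exact absurd hc' (h n' hlt)

theorem existsUnique_isMaximal_iff (φ : C ≅ freeCat G)
    (hφ : η ≫ forget.map φ.hom = freeUnit G) :
    (∃! a, IsMaximal η a) ↔ ∃! t : (freeCat G).Cell, ∀ v, v ∈ t.1.flat := by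
  have hinv : ∀ t : (freeCat G).Cell, φ.hom.map (φ.inv.map t) = t := fun t =>
    Hom.map_congr_eq φ.inv_hom_id t
  have hinv' : ∀ c : C.Cell, φ.inv.map (φ.hom.map c) = c := fun c =>
    Hom.map_congr_eq φ.hom_inv_id c
  constructor
  · rintro ⟨a, ha, huniq⟩
    refine ⟨φ.hom.map a.2.1, ((isMaximal_iff φ hφ a).1 ha).2, fun t ht => ?_⟩
    obtain ⟨b, hb, hp⟩ := exists_isProper C (φ.inv.map t)
    have hmax : IsMaximal η b := (isMaximal_iff φ hφ b).2 ⟨hp, by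
      rw [hb, hinv]
      exact ht⟩
    rw [← huniq b hmax, hb, hinv]
  · rintro ⟨t, ht, huniq⟩
    obtain ⟨a, ha, hp⟩ := exists_isProper C (φ.inv.map t)
    refine ⟨a, (isMaximal_iff φ hφ a).2 ⟨hp, by
      rw [ha, hinv]
      exact ht⟩, fun b hb => ?_⟩
    obtain ⟨hbp, hbt⟩ := (isMaximal_iff φ hφ b).1 hb
    refine hbp.ext hp ?_
    rw [ha, ← huniq _ hbt, hinv']

end Maximal

end OmegaCat

/-! ### Repeated labels -/

namespace PasteTree

variable {X : GlobularSet} {P : X.Vertex → Prop}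

/-- If the first edge of a walk and the remaining walk have a label in common, then the walk comes
back to its first vertex. -/
theorem WF.start_mem_of_common {n : ℕ} (hP : ∀ v, P v → v.1 = n) {x : X.Vertex}
    {c w : PasteTree X.Vertex} (ht : WF X.Edge P (cons x c w)) {v : X.Vertex} (hc : v ∈ c.flat)
    (hw : v ∈ w.flat) : x ∈ w.flat := by
  obtain ⟨k, v⟩ := v
  have hx := hP x ht.1
  have hd : ∀ u, X.Edge x u w.head → u.1 = n + 1 := fun u hu => by rw [hu.dim, hx]
  induction k with
  | zero =>
    have : n + 1 ≤ 0 := ht.2.1.le_dim hd _ hc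
    omega
  | succ k ih =>
    have hdim : n + 1 ≤ k + 1 := ht.2.1.le_dim hd _ hc
    have hw' := (ht.2.2.src_mem hw (Edge.mk v)).resolve_left fun h => by
      have : k + 1 = n := hP _ h
      omega
    rcases ht.2.1.src_mem hc (Edge.mk v) with h | h
    · rwa [← (h.unique (Edge.mk v)).1] at hw'
    · exact ih _ h hw'

/-- A walk which passes through `x` has an initial part which ends in `x`. -/
theorem WF.exists_initial_walk {n : ℕ} (hP : ∀ v, P v → v.1 = n) {x : X.Vertex} (hx : x.1 = n)
    {w : PasteTree X.Vertex} (hw : WF X.Edge P w) (h : x ∈ w.flat) :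
    ∃ w', WF X.Edge P w' ∧ w'.head = w.head ∧ w'.last = x ∧ ∀ v ∈ w'.flat, v ∈ w.flat := by
  induction w with
  | pt y =>
    rw [flat_pt, List.mem_singleton] at h
    exact ⟨pt y, hw, rfl, h.symm, fun _ h => h⟩
  | cons y d w _ ih =>
    simp only [flat_cons, List.mem_cons, List.mem_append] at h
    rcases h with rfl | h | h
    · exact ⟨pt x, hw.1, rfl, rfl, fun v hv => by
        rw [flat_pt, List.mem_singleton] at hv
        simp [hv]⟩
    · have := hw.2.1.le_dim (n := n + 1) (fun u hu => by rw [hu.dim, hP y hw.1]) x h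
      omega
    · obtain ⟨w', h₁, h₂, h₃, h₄⟩ := ih hw.2.2 h
      refine ⟨cons y d w', ⟨hw.1, ?_, h₁⟩, rfl, h₃, fun v hv => ?_⟩
      · rw [h₂]; exact hw.2.1
      · simp only [flat_cons, List.mem_cons, List.mem_append] at hv ⊢
        exact hv.imp_right (Or.imp_right (h₄ v))

theorem length_flat_le_comp_zero (b a : PasteTree X.Vertex) :
    b.flat.length ≤ (comp 0 b a).flat.length := by
  induction a with
  | pt x => simp
  | cons x c w _ ih =>
    simp only [comp_zero_cons, flat_cons, List.length_cons, List.length_append]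
    omega

/-- A pasting tree with a repeated label contains a closed walk; going round once more gives a larger
tree with the same set of labels. -/
theorem WF.exists_larger {n : ℕ} (hP : ∀ v, P v → v.1 = n) {t : PasteTree X.Vertex}
    (ht : WF X.Edge P t) (h : ¬ t.flat.Nodup) :
    ∃ t', WF X.Edge P t' ∧ t'.head = t.head ∧ (∀ v, v ∈ t'.flat ↔ v ∈ t.flat) ∧
      t.flat.length < t'.flat.length := by
  induction t generalizing n P with
  | pt x => simp at h
  | cons x c w ih ih' =>
    have ht' := ht
    obtain ⟨hx, hc, hw⟩ := ht
    have hd : ∀ u, X.Edge x u w.head → u.1 = n + 1 := fun u hu => by rw [hu.dim, hP x hx]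
    -- if the walk comes back to `x`, it starts with a closed walk, which can be prepended to it
    by_cases hxw : x ∈ w.flat
    · obtain ⟨w', h₁, h₂, h₃, h₄⟩ := hw.exists_initial_walk hP (hP x hx) hxw
      have hs : WF X.Edge P (cons x c w') := ⟨hx, by rw [h₂]; exact hc, h₁⟩
      refine ⟨PasteTree.comp 0 (cons x c w) (cons x c w'), ht'.comp hs (by simp [h₃]), by simp,
        fun v => ?_, ?_⟩
      · rw [flat_comp_zero _ _ (by simp [h₃])]
        simp only [flat_cons, List.mem_cons, List.mem_append]
        have := h₄ v
        tauto
      · rw [comp_zero_cons, flat_cons (w := PasteTree.comp 0 _ _), List.length_cons, List.length_append]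
        have := length_flat_le_comp_zero (cons x c w) w'
        omega
    · by_cases hcn : c.flat.Nodup
      · by_cases hwn : w.flat.Nodup
        · refine absurd ?_ h
          rw [flat_cons, List.nodup_cons, List.mem_append, List.nodup_append]
          refine ⟨?_, hcn, hwn, fun v hv u hu e => ?_⟩
          · rintro (hxc | hxw')
            · have := hc.le_dim hd x hxc
              have := hP x hx
              omega
            · exact hxw hxw'
          · subst e
            exact hxw (ht'.start_mem_of_common hP hv hu)
        · obtain ⟨w', h₁, h₂, h₃, h₄⟩ := ih' hP hw hwn
          refine ⟨cons x c w', ⟨hx, by rw [h₂]; exact hc, h₁⟩, rfl, fun v => ?_, ?_⟩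
          · simp [h₃]
          · simp only [flat_cons, List.length_cons, List.length_append]
            omega
      · obtain ⟨c', h₁, h₂, h₃, h₄⟩ := ih hd hc hcn
        refine ⟨cons x c' w, ⟨hx, h₁, hw⟩, rfl, fun v => ?_, ?_⟩
        · simp [h₃]
        · simp only [flat_cons, List.length_cons, List.length_append]
          omega

end PasteTree

/-- There is exactly one pasting tree in which all the vertices of `G` occur if and only if `G` is a
non-empty globular cardinal. -/
theorem existsUnique_full_tree_iff (G : GlobularSet) :
    (∃! t : (freeCat G).Cell, ∀ v, v ∈ t.1.flat) ↔ G.IsCardinal ∧ Nonempty G.Vertex := by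
  constructor
  · rintro ⟨t, ht, huniq⟩
    refine ⟨isCardinal_of_tree t.2 ?_ ht, ⟨t.1.head⟩⟩
    by_contra hn
    obtain ⟨t', h₁, -, h₃, h₄⟩ := t.2.exists_larger (fun _ h => h) hn
    have e := huniq ⟨t', h₁⟩ fun v => (h₃ v).2 (ht v)
    rw [← e] at h₄
    exact lt_irrefl _ h₄
  · rintro ⟨hG, hne⟩
    obtain ⟨t, ht, hall⟩ := hG.exists_tree hne
    exact ⟨⟨t, ht⟩, hall, fun t' ht' => Subtype.ext (hG.tree_unique t'.2 ht ht' hall)⟩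

/-- The simple `ω`-categories are those which are free on a non-empty globular cardinal. -/
theorem isSimple_eq_isTheta : OmegaCat.IsSimple = OmegaCat.IsTheta := by
  funext C
  refine propext ⟨?_, ?_⟩
  · rintro ⟨G, η, hη, h⟩
    obtain ⟨φ, hφ⟩ := hη.exists_iso (freeUnit_isFree G)
    rw [OmegaCat.existsUnique_isMaximal_iff φ hφ, existsUnique_full_tree_iff] at h
    exact ⟨G, η, h.1, h.2, hη⟩
  · rintro ⟨G, η, hG, hne, hη⟩
    obtain ⟨φ, hφ⟩ := hη.exists_iso (freeUnit_isFree G)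
    refine ⟨G, η, hη, ?_⟩
    rw [OmegaCat.existsUnique_isMaximal_iff φ hφ, existsUnique_full_tree_iff]
    exact ⟨hG, hne⟩

/-! ### Walks with prescribed vertices and edges -/

namespace PasteTree

variable {V : Type}

/-- The walk of length `d` from `x i` to `x (i + d)` with edges `T i, …, T (i + d - 1)`. -/
def walk (x : ℕ → V) (T : ℕ → PasteTree V) : ℕ → ℕ → PasteTree V
  | i, 0 => pt (x i)
  | i, d + 1 => cons (x i) (T i) (walk x T (i + 1) d)

variable {x : ℕ → V} {T T' : ℕ → PasteTree V}

@[simp] theorem head_walk (i d : ℕ) : (walk x T i d).head = x i := by cases d <;> rfl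

@[simp] theorem last_walk (i d : ℕ) : (walk x T i d).last = x (i + d) := by
  induction d generalizing i with
  | zero => rfl
  | succ d ih =>
    rw [walk, last_cons, ih]
    congr 1
    omega

theorem walk_congr {i d : ℕ} (h : ∀ k, i ≤ k → k < i + d → T k = T' k) :
    walk x T i d = walk x T' i d := by
  induction d generalizing i with
  | zero => rfl
  | succ d ih =>
    rw [walk, walk, h i le_rfl (by omega), ih fun k h₁ h₂ => h k (by omega) (by omega)]

theorem walk_injective {i d : ℕ} (h : walk x T i d = walk x T' i d) (k : ℕ) (h₁ : i ≤ k)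
    (h₂ : k < i + d) : T k = T' k := by
  induction d generalizing i with
  | zero => omega
  | succ d ih =>
    simp only [walk, cons.injEq, true_and] at h
    rcases h₁.eq_or_lt with rfl | hlt
    · exact h.1
    · exact ih h.2 (by omega) (by omega)

theorem src_walk (n i d : ℕ) : src (n + 1) (walk x T i d) = walk x (fun k => src n (T k)) i d := by
  induction d generalizing i with
  | zero => simp [walk]
  | succ d ih => simp [walk, ih]

theorem tgt_walk (n i d : ℕ) : tgt (n + 1) (walk x T i d) = walk x (fun k => tgt n (T k)) i d := by
  induction d generalizing i with
  | zero => simp [walk]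
  | succ d ih => simp [walk, ih]

theorem comp_succ_walk (n i d : ℕ) :
    comp (n + 1) (walk x T' i d) (walk x T i d) = walk x (fun k => comp n (T' k) (T k)) i d := by
  induction d generalizing i with
  | zero => simp [walk]
  | succ d ih => simp [walk, ih]

theorem comp_zero_walk (i d d' : ℕ) :
    comp 0 (walk x T (i + d) d') (walk x T i d) = walk x T i (d + d') := by
  induction d generalizing i with
  | zero => simp [walk]
  | succ d ih =>
    rw [walk, comp_zero_cons, Nat.add_right_comm d 1 d', walk, ← ih (i + 1), Nat.add_right_comm,
      Nat.add_assoc]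

theorem wf_walk_iff {E : V → V → V → Prop} {P : V → Prop} (i d : ℕ) :
    WF E P (walk x T i d) ↔ (∀ k, i ≤ k → k ≤ i + d → P (x k)) ∧
      ∀ k, i ≤ k → k < i + d → WF E (fun v => E (x k) v (x (k + 1))) (T k) := by
  induction d generalizing i with
  | zero =>
    refine ⟨fun h => ⟨fun k h₁ h₂ => ?_, fun k h₁ h₂ => by omega⟩, fun h => h.1 i le_rfl le_rfl⟩
    obtain rfl : i = k := le_antisymm h₁ h₂
    exact h
  | succ d ih =>
    rw [walk, WF, ih, head_walk]
    constructor
    · rintro ⟨hx, hT, h₁, h₂⟩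
      refine ⟨fun k h h' => ?_, fun k h h' => ?_⟩ <;> rcases h.eq_or_lt with rfl | hlt
      · exact hx
      · exact h₁ k hlt (by omega)
      · exact hT
      · exact h₂ k hlt (by omega)
    · rintro ⟨h₁, h₂⟩
      exact ⟨h₁ i le_rfl (by omega), h₂ i le_rfl (by omega),
        fun k h h' => h₁ k (by omega) (by omega), fun k h h' => h₂ k (by omega) (by omega)⟩

theorem mem_flat_walk {v : V} (i d : ℕ) :
    v ∈ (walk x T i d).flat ↔ (∃ k, i ≤ k ∧ k ≤ i + d ∧ v = x k) ∨
      ∃ k, i ≤ k ∧ k < i + d ∧ v ∈ (T k).flat := by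
  induction d generalizing i with
  | zero =>
    rw [walk, flat_pt, List.mem_singleton]
    refine ⟨fun h => Or.inl ⟨i, le_rfl, le_rfl, h⟩, ?_⟩
    rintro (⟨k, h₁, h₂, rfl⟩ | ⟨k, h₁, h₂, -⟩)
    · rw [le_antisymm h₁ h₂]
    · omega
  | succ d ih =>
    rw [walk, flat_cons, List.mem_cons, List.mem_append, ih]
    constructor
    · rintro (rfl | h | ⟨k, h₁, h₂, h⟩ | ⟨k, h₁, h₂, h⟩)
      · exact Or.inl ⟨i, le_rfl, by omega, rfl⟩
      · exact Or.inr ⟨i, le_rfl, by omega, h⟩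
      · exact Or.inl ⟨k, by omega, by omega, h⟩
      · exact Or.inr ⟨k, by omega, by omega, h⟩
    · rintro (⟨k, h₁, h₂, h⟩ | ⟨k, h₁, h₂, h⟩) <;> rcases h₁.eq_or_lt with rfl | hlt
      · exact Or.inl h
      · exact Or.inr (Or.inr (Or.inl ⟨k, hlt, by omega, h⟩))
      · exact Or.inr (Or.inl h)
      · exact Or.inr (Or.inr (Or.inr ⟨k, hlt, by omega, h⟩))

theorem exists_eq_walk (t : PasteTree V) : ∃ x T d, t = walk x T 0 d := by
  suffices ∀ i, ∃ x T d, t = walk x T i d from this 0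
  induction t with
  | pt x => exact fun i => ⟨fun _ => x, fun _ => pt x, 0, rfl⟩
  | cons x c w _ ih =>
    intro i
    obtain ⟨y, T, d, rfl⟩ := ih (i + 1)
    refine ⟨fun k => if k = i then x else y k, fun k => if k = i then c else T k, d + 1, ?_⟩
    have key : ∀ d j, i < j → walk y T j d =
        walk (fun k => if k = i then x else y k) (fun k => if k = i then c else T k) j d := by
      intro d
      induction d with
      | zero =>
        intro j hj
        simp [walk, hj.ne']
      | succ d ih =>
        intro j hj
        simp [walk, hj.ne', ih (j + 1) (by omega)]
    simp [walk, key d (i + 1) (Nat.lt_succ_self i)]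

theorem nodup_walk {i d : ℕ} (h : (walk x T i d).flat.Nodup) :
    (∀ k l, i ≤ k → k < l → l ≤ i + d → x k ≠ x l) ∧
      (∀ k, i ≤ k → k < i + d → (T k).flat.Nodup) ∧
      ∀ k l, i ≤ k → k < l → l < i + d → ∀ v ∈ (T k).flat, v ∉ (T l).flat := by
  induction d generalizing i with
  | zero => exact ⟨by intros; omega, by intros; omega, by intros; omega⟩
  | succ d ih =>
    rw [walk, flat_cons, List.nodup_cons, List.mem_append, List.nodup_append] at h
    obtain ⟨hx, hT, hw, hd⟩ := h
    obtain ⟨ih₁, ih₂, ih₃⟩ := ih hw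
    refine ⟨fun k l h₁ h₂ h₃ => ?_, fun k h₁ h₂ => ?_, fun k l h₁ h₂ h₃ v hv => ?_⟩ <;>
      rcases h₁.eq_or_lt with rfl | hlt
    · exact fun e => hx (Or.inr ((mem_flat_walk _ _).2 (Or.inl ⟨l, h₂, by omega, e⟩)))
    · exact ih₁ k l hlt h₂ (by omega)
    · exact hT
    · exact ih₂ k hlt (by omega)
    · exact fun hv' => hd v hv v ((mem_flat_walk _ _).2 (Or.inr ⟨l, h₂, by omega, hv'⟩)) rfl
    · exact ih₃ k l hlt h₂ (by omega) v hv

/-- A walk has no repeated labels if its vertices are distinct and its edges have no repeated labels. -/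
theorem nodup_walk_of {X : GlobularSet} {P : X.Vertex → Prop} {n : ℕ} (hP : ∀ v, P v → v.1 = n)
    {x : ℕ → X.Vertex} {T : ℕ → PasteTree X.Vertex} {i d : ℕ} (hw : WF X.Edge P (walk x T i d))
    (hx : ∀ k l, i ≤ k → k < l → l ≤ i + d → x k ≠ x l)
    (hT : ∀ k, i ≤ k → k < i + d → (T k).flat.Nodup) : (walk x T i d).flat.Nodup := by
  induction d generalizing i with
  | zero => simp [walk]
  | succ d ih =>
    have hw' := hw
    rw [wf_walk_iff] at hw'
    have hdim : ∀ k, i ≤ k → k ≤ i + (d + 1) → (x k).1 = n := fun k h h' => hP _ (hw'.1 k h h')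
    have hi := hdim i le_rfl (by omega)
    have hle : ∀ k, i ≤ k → k < i + (d + 1) → ∀ v ∈ (T k).flat, n + 1 ≤ v.1 := fun k h h' =>
      (hw'.2 k h h').le_dim fun v hv => by rw [hv.dim, hdim k h (by omega)]
    have hmem : x i ∉ (walk x T (i + 1) d).flat := by
      rw [mem_flat_walk]
      rintro (⟨k, h₁, h₂, h⟩ | ⟨k, h₁, h₂, h⟩)
      · exact hx i k le_rfl h₁ (by omega) h
      · have := hle k (by omega) (by omega) _ h
        omega
    rw [walk] at hw ⊢
    rw [flat_cons, List.nodup_cons, List.mem_append, List.nodup_append]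
    refine ⟨?_, hT i le_rfl (by omega), ih hw.2.2 (fun k l h₁ h₂ h₃ => hx k l (by omega) h₂ (by omega))
      (fun k h₁ h₂ => hT k (by omega) (by omega)), fun v hv u hu e => ?_⟩
    · rintro (h | h)
      · have := hle i le_rfl (by omega) _ h
        omega
      · exact hmem h
    · subst e
      exact hmem (hw.start_mem_of_common hP hv hu)

end PasteTree

/-! ### Labellings of ordinal graphs -/

/-- `Shape E o P` says that the vertices which satisfy `P`, together with everything above them with
respect to the edge relation `E`, form a copy of the ordinal graph `o`: the vertices satisfying `P` are
`x 0, …, x p`, there are edges only from `x k` to `x (k + 1)`, and these form a copy of the edge-object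
of `o` from `k` to `k + 1`. -/
def Shape {V : Type} (E : V → V → V → Prop) : OrdGraph → (V → Prop) → Prop
  | .empty, P => ∀ v, ¬ P v
  | .mk p edge, P => ∃ x : ℕ → V, (∀ i j, i ≤ p → j ≤ p → x i = x j → i = j) ∧
      (∀ v, P v ↔ ∃ i ≤ p, v = x i) ∧
      (∀ i j v, i ≤ p → j ≤ p → E (x i) v (x j) → j = i + 1) ∧
      ∀ k : Fin p, Shape E (edge k) fun v => E (x k) v (x (k + 1))

/-- `e` identifies the `ω`-category `C` with that of the well-formed pasting trees of vertices
satisfying `P`. -/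
structure Encodes {V : Type} (E : V → V → V → Prop) (P : V → Prop) (C : OmegaCat)
    (e : C.Cell → PasteTree V) : Prop where
  wf : ∀ a, WF E P (e a)
  inj : Function.Injective e
  surj : ∀ t, WF E P t → ∃ a, e a = t
  src : ∀ n a, e (C.src n a) = PasteTree.src n (e a)
  tgt : ∀ n a, e (C.tgt n a) = PasteTree.tgt n (e a)
  comp : ∀ n b a h, e (C.comp n b a h) = PasteTree.comp n (e b) (e a)

section Encoding

variable {V : Type} {p : ℕ} {A : Fin p → OmegaCat}

/-- The trees which encode the components of a cell of `path A`; the values outside the range of the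
cell are irrelevant. -/
def encodeEdges (e : ∀ k, (A k).Cell → PasteTree V) (x₀ : V) (a : OmegaCat.PathCell A) (n : ℕ) :
    PasteTree V :=
  if h : a.i.val ≤ n ∧ n < a.j.val then
    e ⟨n, by omega⟩ (a.val ⟨n, by omega⟩ h.1 h.2)
  else .pt x₀

theorem encodeEdges_of_mem (e : ∀ k, (A k).Cell → PasteTree V) (x₀ : V) (a : OmegaCat.PathCell A)
    {n : ℕ} (h : n < p) (h₁ : a.i.val ≤ n) (h₂ : n < a.j.val) :
    encodeEdges e x₀ a n = e ⟨n, h⟩ (a.val ⟨n, h⟩ h₁ h₂) := dif_pos ⟨h₁, h₂⟩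

/-- The pasting tree which encodes a cell of `path A`. -/
def encodePath (e : ∀ k, (A k).Cell → PasteTree V) (x : ℕ → V) (a : OmegaCat.PathCell A) :
    PasteTree V :=
  walk x (encodeEdges e (x 0) a) a.i.val (a.j.val - a.i.val)

theorem encodePath_def (e : ∀ k, (A k).Cell → PasteTree V) (x : ℕ → V)
    (a : (OmegaCat.path A).Cell) : encodePath e x a =
      walk x (encodeEdges e (x 0) a) (OmegaCat.PathCell.i a).val ((OmegaCat.PathCell.j a).val - (OmegaCat.PathCell.i a).val) :=
  rfl

/-- If the cells of the `A k` are encoded by the trees of vertices from `x k` to `x (k + 1)`, then the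
cells of `path A` are encoded by the walks through the `x k`. -/
theorem encodePath_encodes {E : V → V → V → Prop} {P : V → Prop} {x : ℕ → V}
    (hx : ∀ i j, i ≤ p → j ≤ p → x i = x j → i = j) (hP : ∀ v, P v ↔ ∃ i ≤ p, v = x i)
    (hE : ∀ i j v, i ≤ p → j ≤ p → E (x i) v (x j) → j = i + 1)
    {e : ∀ k, (A k).Cell → PasteTree V}
    (he : ∀ k : Fin p, Encodes E (fun v => E (x k) v (x (k + 1))) (A k) (e k)) :
    Encodes E P (OmegaCat.path A) (encodePath e x) where
  wf a := by
    have h : a.i.val ≤ a.j.val := a.le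
    have hj := a.j.isLt
    rw [encodePath_def, wf_walk_iff]
    refine ⟨fun k _ h₂ => (hP _).2 ⟨k, by omega, rfl⟩, fun k h₁ h₂ => ?_⟩
    rw [encodeEdges_of_mem e _ a (by omega) h₁ (by omega)]
    exact (he ⟨k, by omega⟩).wf _
  inj a b h := by
    have ha : a.i.val ≤ a.j.val := a.le
    have hb : b.i.val ≤ b.j.val := b.le
    have haj := a.j.isLt
    have hbj := b.j.isLt
    have hi : a.i = b.i := by
      have := congrArg head h
      rw [encodePath_def, encodePath_def, head_walk, head_walk] at this
      exact Fin.ext (hx _ _ (by omega) (by omega) this)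
    have hj : a.j = b.j := by
      have := congrArg last h
      rw [encodePath_def, encodePath_def, last_walk, last_walk, Nat.add_sub_cancel' ha,
        Nat.add_sub_cancel' hb] at this
      exact Fin.ext (hx _ _ (by omega) (by omega) this)
    refine OmegaCat.PathCell.ext' hi hj fun k h₁ h₂ h₁' h₂' => ?_
    rw [encodePath_def, encodePath_def, hi, hj] at h
    have h₁'' : b.i.val ≤ k.val := h₁'
    have h₂'' : k.val < b.j.val := h₂'
    have := walk_injective h k.val h₁'' (by omega)
    rw [encodeEdges_of_mem e _ a k.isLt h₁ h₂, encodeEdges_of_mem e _ b k.isLt h₁' h₂'] at this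
    exact (he k).inj this
  surj t ht := by
    -- edges lead only from `x i` to `x (i + 1)`, so that a walk is a segment of `x 0, …, x p`
    have key : ∀ (t : PasteTree V) (i : ℕ), i ≤ p → WF E P t → t.head = x i →
        ∃ T d, i + d ≤ p ∧ t = walk x T i d := by
      intro t
      induction t with
      | pt y =>
        intro i hi _ h
        exact ⟨fun _ => .pt y, 0, hi, congrArg _ h⟩
      | cons y c w _ ih =>
        intro i hi ht h
        obtain rfl : y = x i := h
        obtain ⟨j, hj, hwj⟩ := (hP _).1 ht.2.2.head
        have hc := ht.2.1.head
        rw [hwj] at hc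
        obtain rfl := hE i j _ hi hj hc
        obtain ⟨T, d, hd, rfl⟩ := ih (i + 1) hj ht.2.2 hwj
        refine ⟨fun k => if k = i then c else T k, d + 1, by omega, ?_⟩
        rw [walk, if_pos rfl]
        congr 1
        refine walk_congr fun k h₁ h₂ => ?_
        rw [if_neg (by omega)]
    obtain ⟨i, hi, hti⟩ := (hP _).1 ht.head
    obtain ⟨T, d, hd, rfl⟩ := key t i hi ht hti
    rw [wf_walk_iff] at ht
    have hs : ∀ (k : Fin p), i ≤ k.val → k.val < i + d → ∃ y, e k y = T k.val :=
      fun k h₁ h₂ => (he k).surj _ (ht.2 k.val h₁ h₂)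
    choose y hy using hs
    let a : OmegaCat.PathCell A := ⟨⟨i, by omega⟩, ⟨i + d, by omega⟩, by
      change i ≤ i + d
      omega, y⟩
    refine ⟨a, ?_⟩
    change walk x _ i (i + d - i) = _
    rw [Nat.add_sub_cancel_left]
    refine walk_congr fun k h₁ h₂ => ?_
    rw [encodeEdges_of_mem e _ a (by omega) h₁ h₂]
    exact hy ⟨k, by omega⟩ h₁ h₂
  src n a := by
    cases n with
    | zero =>
      rw [src_zero, encodePath_def, encodePath_def, head_walk]
      change walk x _ a.i.val (a.i.val - a.i.val) = _
      rw [Nat.sub_self]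
      rfl
    | succ n =>
      have hj := a.j.isLt
      rw [encodePath_def, encodePath_def, src_walk]
      refine walk_congr fun k (h₁ : a.i.val ≤ k) (h₂ : k < a.i.val + (a.j.val - a.i.val)) => ?_
      rw [encodeEdges_of_mem e _ a (by omega) h₁ (by omega),
        encodeEdges_of_mem e _ ((OmegaCat.path A).src (n + 1) a) (by omega) h₁
          (show k < a.j.val by omega)]
      exact (he _).src n _
  tgt n a := by
    cases n with
    | zero =>
      have h : a.i.val ≤ a.j.val := a.le
      rw [tgt_zero, encodePath_def, encodePath_def, last_walk, Nat.add_sub_cancel' h]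
      change walk x _ a.j.val (a.j.val - a.j.val) = _
      rw [Nat.sub_self]
      rfl
    | succ n =>
      have hj := a.j.isLt
      rw [encodePath_def, encodePath_def, tgt_walk]
      refine walk_congr fun k (h₁ : a.i.val ≤ k) (h₂ : k < a.i.val + (a.j.val - a.i.val)) => ?_
      rw [encodeEdges_of_mem e _ a (by omega) h₁ (by omega),
        encodeEdges_of_mem e _ ((OmegaCat.path A).tgt (n + 1) a) (by omega) h₁
          (show k < a.j.val by omega)]
      exact (he _).tgt n _
  comp n b a h := by
    have ha : a.i.val ≤ a.j.val := a.le
    have hb : b.i.val ≤ b.j.val := b.le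
    have hj := a.j.isLt
    have hbj := b.j.isLt
    cases n with
    | zero =>
      have hm : b.i.val = a.j.val := congrArg Fin.val (OmegaCat.PathCell.mid_eq h)
      have e₁ : encodePath e x a = walk x (encodeEdges e (x 0) ((OmegaCat.path A).comp 0 b a h))
          a.i.val (a.j.val - a.i.val) := by
        refine walk_congr fun k h₁ h₂ => ?_
        rw [encodeEdges_of_mem e _ a (by omega) h₁ (by omega),
          encodeEdges_of_mem e _ ((OmegaCat.path A).comp 0 b a h) (by omega) h₁
            (show k < b.j.val by omega)]
        congr 1
        exact (dif_pos (show k < a.j.val by omega)).symm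
      have e₂ : encodePath e x b = walk x (encodeEdges e (x 0) ((OmegaCat.path A).comp 0 b a h))
          (a.i.val + (a.j.val - a.i.val)) (b.j.val - b.i.val) := by
        rw [Nat.add_sub_cancel' ha, ← hm]
        refine walk_congr fun k h₁ h₂ => ?_
        rw [encodeEdges_of_mem e _ b (by omega) h₁ (by omega),
          encodeEdges_of_mem e _ ((OmegaCat.path A).comp 0 b a h) (by omega)
            (show a.i.val ≤ k by omega) (show k < b.j.val by omega)]
        congr 1
        refine Eq.trans ?_ (dif_neg (show ¬ k < a.j.val by omega)).symm
        rfl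
      rw [e₁, e₂, comp_zero_walk]
      change walk x _ a.i.val (b.j.val - a.i.val) = _
      congr 1
      omega
    | succ n =>
      have hi : b.i.val = a.i.val := congrArg Fin.val (OmegaCat.PathCell.i_eq h)
      have hj' : b.j.val = a.j.val := congrArg Fin.val (OmegaCat.PathCell.j_eq h)
      rw [encodePath_def, encodePath_def, encodePath_def, hi, hj', comp_succ_walk]
      refine walk_congr fun k (h₁ : a.i.val ≤ k) (h₂ : k < a.i.val + (a.j.val - a.i.val)) => ?_
      rw [encodeEdges_of_mem e _ a (by omega) h₁ (by omega),
        encodeEdges_of_mem e _ b (by omega) (by omega) (by omega),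
        encodeEdges_of_mem e _ ((OmegaCat.path A).comp (n + 1) b a h) (by omega) h₁
          (show k < a.j.val by omega)]
      exact (he _).comp n _ _ _

end Encoding

/-- If `o` has a copy among the vertices above those satisfying `P`, then the cells of `𝔉 o` are the
pasting trees with labels in that copy. -/
theorem Shape.exists_encodes {V : Type} {E : V → V → V → Prop} {o : OrdGraph} {P : V → Prop}
    (h : Shape E o P) : ∃ e, Encodes E P o.free e := by
  induction o generalizing P with
  | empty =>
    exact ⟨fun a => a.elim, fun a => a.elim, fun a => a.elim, fun t ht => absurd ht.head (h _),
      fun _ a => a.elim, fun _ a => a.elim, fun _ a => a.elim⟩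
  | mk p edge ih =>
    obtain ⟨x, hx, hP, hE, hs⟩ := h
    choose e he using fun k => ih k (hs k)
    exact ⟨_, encodePath_encodes hx hP hE he⟩

/-! ### Objects of `iΔ₊` and globular cardinals -/

/-- Trees indexed by the inner elements of `[p]^∧` extend by the trivial object at the end points. -/
theorem exists_children {p : ℕ} (c : Fin p → Tree) :
    ∃ c' : Fin (p + 2) → Tree, (∀ k, c' (mid k) = c k) ∧
      ∀ j, (j = 0 ∨ j = Fin.last (p + 1)) → c' j = .triv := by
  refine ⟨Function.extend mid c fun _ => .triv, fun k => mid_injective.extend_apply _ _ k,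
    fun j hj => Function.extend_apply' _ _ _ ?_⟩
  rintro ⟨k, rfl⟩
  exact mid_ne_endpoint k hj

/-- A tree without repeated labels, in which all the vertices satisfying `P` and all those above them
occur, determines an object of `iΔ₊` whose ordinal graph they form. -/
theorem PasteTree.WF.exists_shape {X : GlobularSet} {n : ℕ} {P : X.Vertex → Prop}
    (hP : ∀ v, P v → v.1 = n) {t : PasteTree X.Vertex} (ht : WF X.Edge P t)
    (hnodup : t.flat.Nodup) (hmem : ∀ v, P v → v ∈ t.flat)
    (habove : ∀ a v b, X.Edge a v b → a ∈ t.flat → v ∈ t.flat) :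
    ∃ H : Tree, H.IsObj ∧ H ≠ .triv ∧ Shape X.Edge (upsilon H) P := by
  obtain ⟨N, hN⟩ : ∃ N, t.flat.length < N := ⟨_, Nat.lt_succ_self _⟩
  induction N generalizing n P t with
  | zero => omega
  | succ N ih =>
    obtain ⟨x, T, d, rfl⟩ := t.exists_eq_walk
    obtain ⟨hx, hTn, hTd⟩ := nodup_walk hnodup
    have ht' := ht
    rw [wf_walk_iff] at ht'
    simp only [Nat.zero_le, Nat.zero_add, true_imp_iff] at hx hTn hTd ht'
    obtain ⟨hxP, hTw⟩ := ht'
    have hxdim : ∀ k, k ≤ d → (x k).1 = n := fun k hk => hP _ (hxP k hk)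
    have hEdim : ∀ k, k < d → ∀ v, X.Edge (x k) v (x (k + 1)) → v.1 = n + 1 := fun k hk v hv => by
      rw [hv.dim, hxdim k hk.le]
    have hTdim : ∀ k, k < d → ∀ v ∈ (T k).flat, n + 1 ≤ v.1 := fun k hk =>
      (hTw k hk).le_dim (hEdim k hk)
    have hinj : ∀ i j, i ≤ d → j ≤ d → x i = x j → i = j := by
      intro i j hi hj h
      rcases lt_trichotomy i j with hlt | rfl | hlt
      · exact absurd h (hx i j hlt hj)
      · rfl
      · exact absurd h.symm (hx j i hlt hi)
    have hmem' : ∀ v, v ∈ (walk x T 0 d).flat → v.1 ≠ n → ∃ k < d, v ∈ (T k).flat := by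
      intro v hv hne
      rw [mem_flat_walk] at hv
      rcases hv with ⟨k, -, hk, rfl⟩ | ⟨k, -, hk, h⟩
      · exact absurd (hxdim k (by omega)) hne
      · exact ⟨k, by omega, h⟩
    -- an edge between vertices of the walk occurs between consecutive ones
    have hedge : ∀ i j v, i ≤ d → j ≤ d → X.Edge (x i) v (x j) → j = i + 1 ∧ v ∈ (T i).flat := by
      intro i j v hi hj h
      have hv := habove _ _ _ h ((mem_flat_walk 0 d).2 (Or.inl ⟨i, by omega, by omega, rfl⟩))
      obtain ⟨k, hk, hvk⟩ := hmem' v hv (by rw [h.dim, hxdim i hi]; omega)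
      rcases (hTw k hk).src_mem hvk h with h' | h'
      · obtain ⟨h₁, h₂⟩ := h.unique h'
        obtain rfl := hinj i k hi hk.le h₁
        exact ⟨hinj j (i + 1) hj hk h₂, hvk⟩
      · have := hTdim k hk _ h'
        have := hxdim i hi
        omega
    have hsub : ∀ k : Fin d, ∃ H : Tree, H.IsObj ∧ H ≠ .triv ∧
        Shape X.Edge (upsilon H) fun v => X.Edge (x k) v (x (k + 1)) := by
      intro k
      refine ih (hEdim k k.isLt) (hTw k k.isLt) (hTn k k.isLt)
        (fun v hv => (hedge k (k + 1) v k.isLt.le k.isLt hv).2) (fun a v b h ha => ?_) ?_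
      · have hv := habove a v b h ((mem_flat_walk 0 d).2
          (Or.inr ⟨k, by omega, by have := k.isLt; omega, ha⟩))
        have hadim := hTdim k k.isLt a ha
        obtain ⟨l, hl, hvl⟩ := hmem' v hv (by rw [h.dim]; omega)
        have hal : a ∈ (T l).flat := by
          rcases (hTw l hl).src_mem hvl h with h' | h'
          · rw [(h.unique h').1, hxdim l hl.le] at hadim
            omega
          · exact h'
        rcases lt_trichotomy l k.val with hlt | heq | hlt
        · exact absurd ha (hTd l k hlt k.isLt a hal)
        · rwa [← heq]
        · exact absurd hal (hTd k l hlt hl a ha)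
      · -- the first vertex of the walk is not a label of `T k`
        have hsubset : (x 0 :: (T k).flat).Subperm (walk x T 0 d).flat := by
          refine List.subperm_of_subset (List.nodup_cons.2 ⟨fun h => ?_, hTn k k.isLt⟩) ?_
          · have := hTdim k k.isLt _ h
            rw [hxdim 0 (Nat.zero_le _)] at this
            omega
          · intro v hv
            rw [mem_flat_walk]
            rcases List.mem_cons.1 hv with rfl | hv
            · exact Or.inl ⟨0, le_rfl, by omega, rfl⟩
            · exact Or.inr ⟨k, by omega, by have := k.isLt; omega, hv⟩
        have := hsubset.length_le
        rw [List.length_cons] at this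
        omega
    choose H hH hne hs using hsub
    obtain ⟨c, hc, hc'⟩ := exists_children H
    refine ⟨.node d c, ⟨fun j => ⟨fun h => ?_, hc' j⟩, fun j => ?_⟩, by simp, x, hinj, fun v => ?_,
      fun i j v hi hj h => (hedge i j v hi hj h).1, fun k => ?_⟩
    · rcases eq_endpoint_or_mid j with hj | ⟨k, rfl⟩
      · exact hj
      · exact absurd ((hc k).symm.trans h) (hne k)
    · rcases eq_endpoint_or_mid j with hj | ⟨k, rfl⟩
      · rw [hc' j hj]
        trivial
      · rw [hc k]
        exact hH k
    · refine ⟨fun h => ?_, ?_⟩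
      · have hv := hmem v h
        rw [mem_flat_walk] at hv
        rcases hv with ⟨k, -, hk, rfl⟩ | ⟨k, -, hk, h'⟩
        · exact ⟨k, by omega, rfl⟩
        · have := hTdim k (by omega) v h'
          have := hP v h
          omega
      · rintro ⟨k, hk, rfl⟩
        exact hxP k hk
    · change Shape X.Edge (upsilon (c (mid k))) _
      rw [hc k]
      exact hs k

/-- A copy of a non-empty ordinal graph among the vertices of a globular set can be arranged in a
pasting tree. -/
theorem Shape.exists_tree {X : GlobularSet} {n : ℕ} {o : OrdGraph} {P : X.Vertex → Prop}
    (hP : ∀ v, P v → v.1 = n) (hpar : ∀ a v b, X.Edge a v b → P a → P b) (ho : o.IsOrdinal)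
    (hne : o ≠ .empty) (h : Shape X.Edge o P) :
    ∃ t, WF X.Edge P t ∧ t.flat.Nodup ∧ (∀ v, P v → v ∈ t.flat) ∧
      ∀ a v b, X.Edge a v b → a ∈ t.flat → v ∈ t.flat := by
  induction o generalizing n P with
  | empty => exact absurd rfl hne
  | mk p edge ih =>
    obtain ⟨x, hx, hPx, hE, hs⟩ := h
    have hxP : ∀ k, k ≤ p → P (x k) := fun k hk => (hPx _).2 ⟨k, hk, rfl⟩
    -- the hypothesis on `P` passes to the edges, since parallel vertices have the same boundary
    choose T hT using fun k : Fin p => ih k (n := n + 1)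
      (fun v hv => by rw [hv.dim, hP _ (hxP k k.isLt.le)])
      (fun a v b h ha => (h.parallel (a := x k)).1 ha) (ho k).2 (ho k).1 (hs k)
    let T' : ℕ → PasteTree X.Vertex := fun k => if h : k < p then T ⟨k, h⟩ else .pt (x 0)
    have hT' : ∀ (k : ℕ) (hk : k < p), T' k = T ⟨k, hk⟩ := fun k hk => dif_pos hk
    have hwf : WF X.Edge P (walk x T' 0 p) := by
      rw [wf_walk_iff]
      refine ⟨fun k _ hk => hxP k (by omega), fun k _ hk => ?_⟩
      rw [hT' k (by omega)]
      exact (hT ⟨k, by omega⟩).1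
    refine ⟨walk x T' 0 p, hwf, nodup_walk_of hP hwf (fun k l _ hkl hl e => ?_) (fun k _ hk => ?_),
      fun v hv => ?_, fun a v b h ha => ?_⟩
    · have := hx k l (by omega) (by omega) e
      omega
    · rw [hT' k (by omega)]
      exact (hT _).2.1
    · obtain ⟨i, hi, rfl⟩ := (hPx v).1 hv
      exact (mem_flat_walk 0 p).2 (Or.inl ⟨i, by omega, by omega, rfl⟩)
    · rw [mem_flat_walk] at ha ⊢
      refine Or.inr ?_
      rcases ha with ⟨k, -, hk, rfl⟩ | ⟨k, -, hk, ha⟩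
      · obtain ⟨j, hj, rfl⟩ := (hPx b).1 (hpar _ _ _ h (hxP k (by omega)))
        obtain rfl := hE k j v (by omega) hj h
        refine ⟨k, by omega, by omega, ?_⟩
        rw [hT' k (by omega)]
        exact (hT ⟨k, by omega⟩).2.2.1 v h
      · refine ⟨k, by omega, hk, ?_⟩
        rw [hT' k (by omega)] at ha ⊢
        exact (hT ⟨k, by omega⟩).2.2.2 a v b h ha

/-- Copies of ordinal graphs are transported along embeddings which reflect edges. -/
theorem Shape.transport {V W : Type} {E : V → V → V → Prop} {E' : W → W → W → Prop} {f : V → W}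
    (hf : Function.Injective f)
    (hE : ∀ x y w, E' (f x) w (f y) ↔ ∃ v, E x v y ∧ w = f v) {o : OrdGraph} {P : V → Prop}
    {P' : W → Prop} (hP : ∀ w, P' w ↔ ∃ v, P v ∧ w = f v) (h : Shape E o P) : Shape E' o P' := by
  induction o generalizing P P' with
  | empty =>
    intro w hw
    obtain ⟨v, hv, -⟩ := (hP w).1 hw
    exact h v hv
  | mk p edge ih =>
    obtain ⟨x, hx, hPx, hEx, hs⟩ := h
    refine ⟨fun i => f (x i), fun i j hi hj e => hx i j hi hj (hf e), fun w => ?_,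
      fun i j w hi hj h => ?_, fun k => ih k (fun w => hE _ _ w) (hs k)⟩
    · rw [hP]
      constructor
      · rintro ⟨v, hv, rfl⟩
        obtain ⟨i, hi, rfl⟩ := (hPx v).1 hv
        exact ⟨i, hi, rfl⟩
      · rintro ⟨i, hi, rfl⟩
        exact ⟨x i, (hPx _).2 ⟨i, hi, rfl⟩, rfl⟩
    · obtain ⟨v, hv, -⟩ := (hE _ _ w).1 h
      exact hEx i j v hi hj hv

/-- The globular set with objects `0, …, p`, whose cells from `k` to `k + 1` form the globular set
`G k`, and without other cells. -/
def chainSet {p : ℕ} (G : Fin p → GlobularSet) : GlobularSet where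
  cell
    | 0 => Fin (p + 1)
    | n + 1 => Σ k, (G k).cell n
  src := fun {n} => match n with
    | 0 => fun z => z.1.castSucc
    | _ + 1 => fun z => ⟨z.1, (G z.1).src z.2⟩
  tgt := fun {n} => match n with
    | 0 => fun z => z.1.succ
    | _ + 1 => fun z => ⟨z.1, (G z.1).tgt z.2⟩
  src_src := fun {n} z => match n, z with
    | 0, _ => rfl
    | _ + 1, z => congrArg (Sigma.mk z.1) ((G z.1).src_src z.2)
  tgt_src := fun {n} z => match n, z with
    | 0, _ => rfl
    | _ + 1, z => congrArg (Sigma.mk z.1) ((G z.1).tgt_src z.2)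

section ChainSet

variable {p : ℕ} {G : Fin p → GlobularSet}

/-- A vertex of `G k`, seen as a vertex of `chainSet G` one dimension up. -/
def chainVertex (k : Fin p) (v : (G k).Vertex) : (chainSet G).Vertex := ⟨v.1 + 1, ⟨k, v.2⟩⟩

theorem chainVertex_injective (k : Fin p) : Function.Injective (chainVertex (G := G) k) := by
  rintro ⟨n, z⟩ ⟨m, z'⟩ h
  obtain rfl : n = m := Nat.succ_injective (congrArg Sigma.fst h)
  have h' : (⟨k, z⟩ : Σ k, (G k).cell n) = ⟨k, z'⟩ := eq_of_heq (Sigma.mk.inj h).2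
  rw [eq_of_heq (Sigma.mk.inj h').2]

theorem edge_chainVertex_iff (k : Fin p) (x y : (G k).Vertex) (w : (chainSet G).Vertex) :
    (chainSet G).Edge (chainVertex k x) w (chainVertex k y) ↔
      ∃ v, (G k).Edge x v y ∧ w = chainVertex k v := by
  constructor
  · intro h
    obtain ⟨n, z⟩ := w
    obtain ⟨m, x⟩ := x
    obtain rfl : n = m + 1 + 1 := h.dim
    have hu := h.unique (Edge.mk z)
    obtain ⟨l, z⟩ := z
    have h₁ : (⟨k, x⟩ : Σ k, (G k).cell m) = ⟨l, (G l).src z⟩ := eq_of_heq (Sigma.mk.inj hu.1).2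
    obtain rfl : k = l := congrArg Sigma.fst h₁
    have hy : y = ⟨m, (G k).tgt z⟩ := chainVertex_injective k hu.2
    have hx : x = (G k).src z := eq_of_heq (Sigma.mk.inj h₁).2
    subst hy hx
    exact ⟨⟨m + 1, z⟩, Edge.mk z, rfl⟩
  · rintro ⟨v, h, rfl⟩
    cases h with
    | @mk n z => exact Edge.mk (X := chainSet G) (n := n + 1) ⟨k, z⟩

theorem edge_chainSet_zero_iff (i j : Fin (p + 1)) (w : (chainSet G).Vertex) :
    (chainSet G).Edge ⟨0, i⟩ w ⟨0, j⟩ ↔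
      ∃ (k : Fin p) (z : (G k).cell 0), w = ⟨1, ⟨k, z⟩⟩ ∧ i = k.castSucc ∧ j = k.succ := by
  constructor
  · intro h
    obtain ⟨n, z⟩ := w
    obtain rfl : n = 0 + 1 := h.dim
    have hu := h.unique (Edge.mk z)
    exact ⟨z.1, z.2, rfl, eq_of_heq (Sigma.mk.inj hu.1).2, eq_of_heq (Sigma.mk.inj hu.2).2⟩
  · rintro ⟨k, z, rfl, rfl, rfl⟩
    exact Edge.mk (X := chainSet G) (n := 0) ⟨k, z⟩

theorem shape_chainSet {edge : Fin p → OrdGraph}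
    (h : ∀ k, Shape (G k).Edge (edge k) fun v => v.1 = 0) :
    Shape (chainSet G).Edge (.mk p edge) fun v => v.1 = 0 := by
  let x : ℕ → (chainSet G).Vertex := fun i => ⟨0, Fin.ofNat (p + 1) i⟩
  have hx : ∀ (i : ℕ) (hi : i < p + 1), x i = ⟨0, (⟨i, hi⟩ : Fin (p + 1))⟩ := fun i hi => by
    simp only [x]
    congr 1
    exact Fin.ext (Nat.mod_eq_of_lt hi)
  have hinj : ∀ {i j : Fin (p + 1)}, (⟨0, i⟩ : (chainSet G).Vertex) = ⟨0, j⟩ → i = j := fun h =>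
    eq_of_heq (Sigma.mk.inj h).2
  refine ⟨x, fun i j hi hj e => ?_, fun v => ⟨fun hv => ?_, ?_⟩, fun i j v hi hj h => ?_,
    fun k => ?_⟩
  · rw [hx i (by omega), hx j (by omega)] at e
    exact congrArg Fin.val (hinj e)
  · obtain ⟨n, z⟩ := v
    obtain rfl : n = 0 := hv
    change Fin (p + 1) at z
    exact ⟨z.val, Nat.lt_succ_iff.1 z.isLt, (hx z.val z.isLt).symm⟩
  · rintro ⟨i, -, rfl⟩
    rfl
  · rw [hx i (by omega), hx j (by omega), edge_chainSet_zero_iff] at h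
    obtain ⟨k, z, -, h₁, h₂⟩ := h
    have h₁' : i = k.val := congrArg Fin.val h₁
    have h₂' : j = k.val + 1 := congrArg Fin.val h₂
    omega
  · refine (h k).transport (chainVertex_injective k) (edge_chainVertex_iff k) fun w => ?_
    rw [hx k (by omega), hx (k + 1) (by omega), edge_chainSet_zero_iff]
    constructor
    · rintro ⟨l, z, rfl, h₁, -⟩
      obtain rfl : k = l := Fin.castSucc_injective _ h₁
      exact ⟨⟨0, z⟩, rfl, rfl⟩
    · rintro ⟨⟨n, z⟩, hn, rfl⟩
      obtain rfl : n = 0 := hn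
      exact ⟨k, z, rfl, rfl, rfl⟩

end ChainSet

/-- Every ordinal graph is realized by a globular set. -/
theorem exists_globularSet_shape (o : OrdGraph) :
    ∃ X : GlobularSet, Shape X.Edge o fun v => v.1 = 0 := by
  induction o with
  | empty =>
    exact ⟨⟨fun _ => Empty, fun a => a, fun a => a, fun a => a.elim, fun a => a.elim⟩,
      fun v => v.2.elim⟩
  | mk p edge ih =>
    choose G hG using ih
    exact ⟨chainSet G, shape_chainSet hG⟩

/-! ### The equivalences -/

theorem OmegaCat.exists_iso_of_bijective {C D : OmegaCat} (F : C ⟶ D)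
    (h : Function.Bijective F.map) : Nonempty (C ≅ D) := by
  let e := Equiv.ofBijective F.map h
  have he : ∀ d, F.map (e.symm d) = d := e.apply_symm_apply
  refine ⟨⟨F, ⟨e.symm, fun n d => h.1 ?_, fun n d => h.1 ?_, fun n b a hc hc' => h.1 ?_⟩, ?_, ?_⟩⟩
  · rw [he, F.map_src, he]
  · rw [he, F.map_tgt, he]
  · rw [he, F.map_comp n _ _ hc' (F.map_comp_cond hc')]
    exact D.comp_congr n (he b).symm (he a).symm _ _
  · exact OmegaCat.Hom.ext (funext fun a => e.symm_apply_apply a)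
  · exact OmegaCat.Hom.ext (funext he)

/-- A globular set which is a copy of the ordinal graph `o` generates `𝔉 o` freely. -/
theorem Shape.exists_iso {X : GlobularSet} {o : OrdGraph}
    (h : Shape X.Edge o fun v => v.1 = 0) : Nonempty (o.free ≅ freeCat X) := by
  obtain ⟨e, he⟩ := h.exists_encodes
  refine OmegaCat.exists_iso_of_bijective (D := freeCat X)
    ⟨fun a => ⟨e a, he.wf a⟩, fun n a => Subtype.ext (he.src n a),
      fun n a => Subtype.ext (he.tgt n a), fun n b a h _ => Subtype.ext (he.comp n b a h)⟩
    ⟨fun a b h => he.inj (Subtype.ext_iff.1 h), fun t => ?_⟩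
  obtain ⟨a, ha⟩ := he.surj t.1 t.2
  exact ⟨a, Subtype.ext ha⟩

theorem GlobularSet.mem_of_dim_induction {X : GlobularSet} {S : X.Vertex → Prop}
    (h₀ : ∀ v, v.1 = 0 → S v) (h : ∀ a v b, X.Edge a v b → S a → S v) (v : X.Vertex) : S v := by
  obtain ⟨n, z⟩ := v
  induction n with
  | zero => exact h₀ _ rfl
  | succ n ih => exact h _ _ _ (Edge.mk z) (ih _)

/-- A globular set which is a copy of an ordinal graph is a globular cardinal. -/
theorem Shape.isCardinal {X : GlobularSet} {o : OrdGraph} (ho : o.IsOrdinal)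
    (h : Shape X.Edge o fun v => v.1 = 0) : X.IsCardinal := by
  by_cases hne : o = .empty
  · subst hne
    have hempty : X.Vertex → False := GlobularSet.mem_of_dim_induction h fun _ _ _ _ h => h
    have : IsEmpty X.Vertex := ⟨hempty⟩
    exact ⟨inferInstance, fun x => (hempty x).elim, fun x => (hempty x).elim⟩
  · obtain ⟨t, ht, hn, h₀, h₁⟩ := h.exists_tree (n := 0) (fun _ h => h)
      (fun a v b hE h => by
        have h1 := hE.dim
        have h2 := hE.dim_tgt
        change a.1 = 0 at h
        change b.1 = 0
        omega) ho hne
    exact isCardinal_of_tree ht hn (GlobularSet.mem_of_dim_induction h₀ h₁)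

/-- Every object of `iΔ₊` gives a globular cardinal on which its image under `Ψ` is free. -/
theorem exists_cardinal_of_isObj {H : Tree} (hH : H.IsObj) :
    ∃ (X : GlobularSet) (η : X ⟶ OmegaCat.forget.obj (psiObj H)),
      X.IsCardinal ∧ (H ≠ .triv → Nonempty X.Vertex) ∧ OmegaCat.IsFree η := by
  obtain ⟨X, hX⟩ := exists_globularSet_shape (upsilon H)
  obtain ⟨φ⟩ := hX.exists_iso
  refine ⟨X, _, hX.isCardinal (upsilon_isOrdinal H hH), fun hne => ?_,
    (freeUnit_isFree X).of_iso φ.symm⟩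
  cases H with
  | triv => exact absurd rfl hne
  | node p c =>
    obtain ⟨x, -⟩ := hX
    exact ⟨x 0⟩

/-- Every globular cardinal comes from an object of `iΔ₊`. -/
theorem exists_isObj_of_cardinal {X : GlobularSet} (hX : X.IsCardinal) :
    ∃ H : Tree, H.IsObj ∧ (Nonempty X.Vertex → H ≠ .triv) ∧ Nonempty (psiObj H ≅ freeCat X) := by
  by_cases hne : Nonempty X.Vertex
  · obtain ⟨t, ht, hall⟩ := hX.exists_tree hne
    obtain ⟨H, hH, hH', hs⟩ := ht.exists_shape (n := 0) (fun _ h => h) (hX.nodup_of_wf ht)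
      (fun v _ => hall v) (fun _ v _ _ _ => hall v)
    exact ⟨H, hH, fun _ => hH', hs.exists_iso⟩
  · exact ⟨.triv, trivial, fun h => absurd h hne,
      Shape.exists_iso (o := .empty) fun v => absurd ⟨v⟩ hne⟩

theorem psi_isThetaPlus (H : IDeltaPlus) : OmegaCat.IsThetaPlus (psi.obj H) := by
  obtain ⟨X, η, hX, -, hη⟩ := exists_cardinal_of_isObj H.property
  exact ⟨X, η, hX, hη⟩

theorem psiNontrivial_isTheta (H : IDelta) : OmegaCat.IsTheta (psiNontrivial.obj H) := by
  obtain ⟨X, η, hX, hne, hη⟩ := exists_cardinal_of_isObj H.obj.property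
  exact ⟨X, η, hX, hne H.property, hη⟩

theorem lift_psi_isEquivalence : (OmegaCat.IsThetaPlus.lift psi psi_isThetaPlus).IsEquivalence where
  essSurj := ⟨fun C => by
    obtain ⟨X, η, hX, hη⟩ := C.property
    obtain ⟨φ, -⟩ := hη.exists_iso (freeUnit_isFree X)
    obtain ⟨H, hH, -, ⟨ψ⟩⟩ := exists_isObj_of_cardinal hX
    exact ⟨⟨H, hH⟩, ⟨ObjectProperty.isoMk _ (ψ ≪≫ φ.symm)⟩⟩⟩

theorem lift_psiNontrivial_isEquivalence :
    (OmegaCat.IsTheta.lift psiNontrivial psiNontrivial_isTheta).IsEquivalence where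
  essSurj := ⟨fun C => by
    obtain ⟨X, η, hX, hne, hη⟩ := C.property
    obtain ⟨φ, -⟩ := hη.exists_iso (freeUnit_isFree X)
    obtain ⟨H, hH, hH', ⟨ψ⟩⟩ := exists_isObj_of_cardinal hX
    exact ⟨⟨⟨H, hH⟩, hH' hne⟩, ⟨ObjectProperty.isoMk _ (ψ ≪≫ φ.symm)⟩⟩⟩

end OmegaTheta

theorem mainTheorem1 :
    (∃ h : ∀ H : OmegaTheta.IDeltaPlus, OmegaTheta.OmegaCat.IsThetaPlus (OmegaTheta.psi.obj H),
      (OmegaTheta.OmegaCat.IsThetaPlus.lift OmegaTheta.psi h :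
        OmegaTheta.IDeltaPlus ⥤ OmegaTheta.OmegaCat.ThetaPlus).IsEquivalence) ∧
    (∃ h : ∀ H : OmegaTheta.IDelta, OmegaTheta.OmegaCat.IsTheta (OmegaTheta.psiNontrivial.obj H),
      (OmegaTheta.OmegaCat.IsTheta.lift OmegaTheta.psiNontrivial h :
        OmegaTheta.IDelta ⥤ OmegaTheta.OmegaCat.Theta).IsEquivalence) ∧
    (∃ h : ∀ H : OmegaTheta.IDelta, OmegaTheta.OmegaCat.IsSimple (OmegaTheta.psiNontrivial.obj H),
      (OmegaTheta.OmegaCat.IsSimple.lift OmegaTheta.psiNontrivial h :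
        OmegaTheta.IDelta ⥤ OmegaTheta.OmegaCat.Simple).IsEquivalence) := by
  rw [OmegaTheta.isSimple_eq_isTheta]
  exact ⟨⟨_, OmegaTheta.lift_psi_isEquivalence⟩, ⟨_, OmegaTheta.lift_psiNontrivial_isEquivalence⟩,
    ⟨_, OmegaTheta.lift_psiNontrivial_isEquivalence⟩⟩
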